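/- A signature of arity $k$ is a function $f:\{0,1\}^k\to\mathbb{C}$; it is symmetric if $f(x)$ depends only on the number of ones of $x$, and $[c_0,\dots,c_k]$ denotes the symmetric signature with value $c_i$ on strings with $i$ ones. Let $\mathscr{A}$ be the set of affine signatures, i.e. those of the form $\lambda\,\chi_{Ax=b}\cdot \mathfrak{i}^{\sum_i a_i x_i^2+2\sum_{i<j} b_{ij}x_ix_j}$ with $\lambda\in\mathbb{C}$, $Ax=b$ a linear system over $\mathbb{Z}_2$, and $a_i,b_{ij}\in\{0,1\}$. Let $\mathscr{M}$ be the set of matchgate signatures: $f$ of arity $k$ is in $\mathscr{M}$ if there is a finite plane (multi)graph $G$ with complex edge weights and $k$ distinct external nodes $1,\dots,k$ on its outer face in clockwise order such that, for every $\alpha\in\{0,1\}^k$, $f(\alpha)$ is the sum, over all perfect matchings of the graph obtained from $G$ by deleting the external nodes $i$ with $\alpha_i=1$, of the product of the weights of the edges of the matching. A left-side gadget of $\mathrm{Holant}(\mathcal{F}_1|\mathcal{F}_2)$ with $m$ dangling edges is a finite bipartite (multi)graph with left vertices assigned signatures from $\mathcal{F}_1$ and right vertices assigned signatures from $\mathcal{F}_2$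 (the arity of a signature being the degree of its vertex), together with $m$ dangling edges, each attached to a left vertex. The signature it realizes maps $x\in\{0,1\}^m$ to the sum, over all $0/1$-assignments of the normal edges, of the product of the values of all the vertex signatures, where the dangling edges are assigned $x$. It is planar if it can be drawn in the plane without crossings with the dangling edges in the outer face, in clockwise order $1,\dots,m$. We say that a signature $g$ of arity $m$ can be simulated by $\mathcal{F}_1|\mathcal{F}_2$ in a planar left-side manner if at least one of the following holds. (1) (Gadget) Some planar left-side gadget of $\mathrm{Holant}(\mathcal{F}_1|\mathcal{F}_2)$ realizes $c\,g$ for some $c\in\mathbb{C}\setminus\{0\}$. (2) (Polynomial interpolation) There are a signature $h$ of arity $m$, pairwise distinct $t_0,t_1,\ldots\in\mathbb{C}$, nonzero $c_0,c_1,\ldots\in\mathbb{C}$, and a computable sequence $GG_0,GG_1,\dots$ of planar left-side gadgets of $\mathrm{Holant}(\mathcal{F}_1|\mathcal{F}_2)$, with the number of vertices of $GG_k$ bounded by a polynomial in $k$, such that $GG_k$ realizes $c_k\,(g+t_k h)$ for every $k$. **Lemma.** If $f\in\mathscr{M}-\mathscr{A}$ is symmetric, then $[0,0,1,0]$ can be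 simulated by $\{f\}\,|\,\{[1,0],[1,0,1],[1,0,1,0]\}$ in a planar left-side manner. -/

import Mathlib

namespace Holant

/-! ### Signatures -/

/-- A Boolean signature (constraint function) of arity `k` with complex values. -/
abbrev Sig (k : ℕ) : Type := (Fin k → Bool) → ℂ

/-- The number of ones in a Boolean string. -/
def hammingWeight {k : ℕ} (x : Fin k → Bool) : ℕ :=
  (Finset.univ.filter fun i => x i = true).card

theorem hammingWeight_lt {k : ℕ} (x : Fin k → Bool) : hammingWeight x < k + 1 :=
  Nat.lt_succ_of_le (by simpa [hammingWeight] using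
    Finset.card_filter_le (Finset.univ : Finset (Fin k)) fun i => x i = true)

/-- The symmetric signature `[c₀, c₁, …, c_k]`. -/
def symSig {k : ℕ} (c : Fin (k + 1) → ℂ) : Sig k :=
  fun x => c ⟨hammingWeight x, hammingWeight_lt x⟩

/-- A signature is symmetric if its value depends only on the Hamming weight of the input. -/
def IsSymmetric {k : ℕ} (f : Sig k) : Prop :=
  ∀ x y : Fin k → Bool, hammingWeight x = hammingWeight y → f x = f y

/-- A signature bundled with its arity. -/
structure Signature where
  arity : ℕ
  fn : Sig arity

/-! ### Affine signatures -/

open Classical in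
/-- Affine type:
`λ · χ_{A x = b} · i ^ (∑ᵢ aᵢ xᵢ² + 2 ∑_{i<j} b_{ij} xᵢ xⱼ)` with `aᵢ, b_{ij} ∈ {0, 1}`,
where `A x = b` is a linear system over the field with two elements. -/
def IsAffine {k : ℕ} (f : Sig k) : Prop :=
  ∃ (c : ℂ) (n : ℕ) (A : Matrix (Fin n) (Fin k) (ZMod 2)) (b : Fin n → ZMod 2)
    (q : Fin k → Bool) (r : Fin k → Fin k → Bool),
    ∀ x : Fin k → Bool,
      f x = c * (if A.mulVec (fun i => ((x i).toNat : ZMod 2)) = b then 1 else 0) *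
        Complex.I ^ ((∑ i, (q i).toNat * (x i).toNat ^ 2) +
          2 * ∑ i, ∑ j ∈ Finset.univ.filter (fun j => i < j),
            (r i j).toNat * (x i).toNat * (x j).toNat)

/-! ### Plane multigraphs with dangling edges

A multigraph with vertex type `N` and finite edge type `E` is given by the map sending each
half-edge `(e, b) : E × Bool` to the vertex it is attached to. -/

/-- The involution exchanging the two halves of every edge. -/
def flipHalf (E : Type) : Equiv.Perm (E × Bool) :=
  Equiv.prodCongr (Equiv.refl E) Equiv.boolNot

/-- The number of cycles of a permutation, fixed points included. -/
noncomputable def numCycles {D : Type} (ρ : Equiv.Perm D) : ℕ :=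
  Nat.card (Quotient (Equiv.Perm.SameCycle.setoid ρ))

/-- `ρ` is the rotation system of an embedding of the multigraph in the sphere: its cycles are
exactly the sets of half-edges around the (non-isolated) vertices, so that `ρ h` is the next
half-edge counterclockwise after `h`, and it has genus `0`, that is, Euler's formula
`#vertices + #faces = #edges + 2 · #components` holds. Faces are the cycles of `ρ * flip`,
components are the orbits of the group generated by `ρ` and `flip`; isolated vertices play
no role for planarity and are not counted. -/
def IsPlaneRotation {N E : Type} (att : E × Bool → N) (ρ : Equiv.Perm (E × Bool)) : Prop :=
  (∀ h h' : E × Bool, ρ.SameCycle h h' ↔ att h = att h') ∧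
  numCycles ρ + numCycles (ρ * flipHalf E) =
    Nat.card E + 2 * Nat.card (MulAction.orbitRel.Quotient
      (Subgroup.closure {ρ, flipHalf E} : Subgroup (Equiv.Perm (E × Bool))) (E × Bool))

/-- Half-edges of the graph obtained from a graph with `m` dangling edges by joining the free end
of every dangling edge to one additional vertex `none` (the "point at infinity"). -/
def closeUp {N E : Type} {m : ℕ} (att : E × Bool → N) (dang : Fin m → N) :
    (E ⊕ Fin m) × Bool → Option N
  | (Sum.inl e, b) => some (att (e, b))
  | (Sum.inr j, false) => some (dang j)
  | (Sum.inr _, true) => none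

/-- A multigraph with edges attached by `att` and with `m` dangling edges, the `j`th one attached
to the vertex `dang j`, can be drawn in the plane without crossings so that all the dangling edges
lie in the outer face (run off to infinity) and appear there in the clockwise order
`0, 1, …, m - 1`. Equivalently, after joining the dangling edges to a vertex at infinity, there is
a spherical embedding in which they leave that vertex in the counterclockwise cyclic order
`0, 1, …, m - 1`. -/
def IsPlaneOpenGraph {N E : Type} {m : ℕ} (att : E × Bool → N) (dang : Fin m → N) : Prop :=
  ∃ ρ : Equiv.Perm ((E ⊕ Fin m) × Bool),
    IsPlaneRotation (closeUp att dang) ρ ∧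
    ∀ j : Fin m, ρ (Sum.inr j, true) = (Sum.inr (finRotate m j), true)

/-! ### Matchgates -/

/-- A matchgate with `m` external nodes: a finite plane multigraph with complex edge weights and
`m` distinct external nodes, which lie on the outer face in clockwise order. The last condition
says that a dangling edge can be attached to each external node inside the outer face, these
edges being in clockwise order. -/
structure Matchgate (m : ℕ) where
  V : Type
  E : Type
  [fintypeV : Fintype V]
  [fintypeE : Fintype E]
  att : E × Bool → V
  weight : E → ℂ
  ext : Fin m → V
  ext_injective : Function.Injective ext
  plane : IsPlaneOpenGraph att ext

attribute [instance] Matchgate.fintypeV Matchgate.fintypeE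

open Classical in
/-- `M` is a perfect matching of the graph after deletion of the external nodes `j` with `x j = 1`:
no deleted vertex is incident to an edge of `M`, and every other vertex is incident to exactly one
half-edge that belongs to an edge of `M`. -/
def Matchgate.IsPerfectMatching {m : ℕ} (Γ : Matchgate m) (x : Fin m → Bool)
    (M : Finset Γ.E) : Prop :=
  ∀ v : Γ.V, (Finset.univ.filter fun h : Γ.E × Bool => h.1 ∈ M ∧ Γ.att h = v).card =
    if ∃ j, Γ.ext j = v ∧ x j = true then 0 else 1

open Classical in
/-- The signature of a matchgate: the weighted number of perfect matchings after deletion. -/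
noncomputable def Matchgate.signature {m : ℕ} (Γ : Matchgate m) : Sig m :=
  fun x => ∑ M : Finset Γ.E, if Γ.IsPerfectMatching x M then ∏ e ∈ M, Γ.weight e else 0

/-- Matchgate signatures. -/
def IsMatchgateSignature {k : ℕ} (f : Sig k) : Prop :=
  ∃ Γ : Matchgate k, Γ.signature = f

/-! ### Left-side gadgets -/

/-- A left-side gadget of `Holant(L | R)` with `m` dangling edges. It has `nU` left vertices, each
assigned a signature from `L`, and `nW` right vertices, each assigned a signature from `R`. A slot
of a vertex is an input variable of its signature, that is, one of the half-edges at the vertex.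
The bijection `link` says that every slot of a left vertex is joined by an edge to a slot of a right
vertex, or carries a dangling edge, and that all slots of right vertices and all dangling edges
occur exactly once. In particular the normal edges correspond to the slots of right vertices. -/
structure LeftGadget {a b : ℕ} (L : Fin a → Signature) (R : Fin b → Signature) (m : ℕ) where
  nU : ℕ
  nW : ℕ
  labU : Fin nU → Fin a
  labW : Fin nW → Fin b
  link : (Σ u : Fin nU, Fin (L (labU u)).arity) ≃ (Σ w : Fin nW, Fin (R (labW w)).arity) ⊕ Fin m

namespace LeftGadget

variable {a b : ℕ} {L : Fin a → Signature} {R : Fin b → Signature} {m : ℕ}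

/-- The normal edges, each identified with its slot at its right endpoint. -/
abbrev Edge (G : LeftGadget L R m) : Type := Σ w : Fin G.nW, Fin (R (G.labW w)).arity

/-- The two endpoints of a normal edge. -/
def att (G : LeftGadget L R m) : G.Edge × Bool → Fin G.nU ⊕ Fin G.nW
  | (e, false) => Sum.inl (G.link.symm (Sum.inl e)).1
  | (e, true) => Sum.inr e.1

/-- The (left) endpoint of a dangling edge. -/
def dang (G : LeftGadget L R m) (j : Fin m) : Fin G.nU ⊕ Fin G.nW :=
  Sum.inl (G.link.symm (Sum.inr j)).1

/-- The gadget is planar, with its dangling edges in the outer face, in clockwise order. -/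
def IsPlanar (G : LeftGadget L R m) : Prop := IsPlaneOpenGraph G.att G.dang

/-- The signature realized by the gadget: the sum over all assignments `σ` of the normal edges of
the product of the values of all vertices, the dangling edges being assigned `x`. -/
noncomputable def signature (G : LeftGadget L R m) : Sig m := fun x =>
  ∑ σ : G.Edge → Bool,
    (∏ u, (L (G.labU u)).fn fun i => Sum.elim σ x (G.link ⟨u, i⟩)) *
      ∏ w, (R (G.labW w)).fn fun i => σ ⟨w, i⟩

/-- The number of vertices. -/
def size (G : LeftGadget L R m) : ℕ := G.nU + G.nW

/-- The description of a gadget as finite data: for each left vertex the index of its signature and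
the list of what its slots are joined to (a slot of a right vertex, or the end of a dangling edge),
and for each right vertex the index of its signature. -/
def code (G : LeftGadget L R m) : List (ℕ × List (ℕ × ℕ ⊕ ℕ)) × List ℕ :=
  (List.ofFn fun u : Fin G.nU => ((G.labU u : ℕ),
      List.ofFn fun i : Fin (L (G.labU u)).arity =>
        Sum.map (fun s : G.Edge => ((s.1 : ℕ), (s.2 : ℕ))) (fun j : Fin m => (j : ℕ))
          (G.link ⟨u, i⟩)),
    List.ofFn fun w : Fin G.nW => (G.labW w : ℕ))

end LeftGadget

/-! ### Simulation -/

/-- `g` is realized, up to a nonzero factor, by a planar left-side gadget of `Holant(L | R)`. -/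
def PlanarLeftRealizes {a b : ℕ} (L : Fin a → Signature) (R : Fin b → Signature) {m : ℕ}
    (g : Sig m) : Prop :=
  ∃ G : LeftGadget L R m, G.IsPlanar ∧ ∃ c : ℂ, c ≠ 0 ∧ ∀ x, G.signature x = c * g x

/-- `g` is obtained by polynomial interpolation from planar left-side gadgets of `Holant(L | R)`:
there is a computable sequence of such gadgets, of polynomial size, which realize, up to nonzero
factors, infinitely many pairwise distinct points `g + tₖ h` of an affine line through `g`.
(Then the value of an instance in which `g + t h` replaces `g` is a polynomial in `t`, whose value
at `0` can be recovered from its values at the `tₖ`.) -/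
def PlanarLeftInterpolates {a b : ℕ} (L : Fin a → Signature) (R : Fin b → Signature) {m : ℕ}
    (g : Sig m) : Prop :=
  ∃ G : ℕ → LeftGadget L R m,
    (∀ k, (G k).IsPlanar) ∧
    Computable (fun k => (G k).code) ∧
    (∃ p : Polynomial ℕ, ∀ k, (G k).size ≤ p.eval k) ∧
    ∃ (h : Sig m) (t c : ℕ → ℂ), Function.Injective t ∧ (∀ k, c k ≠ 0) ∧
      ∀ k x, (G k).signature x = c k * (g x + t k * h x)

/-- `g` can be simulated by `L | R` in a planar left-side manner. -/
def PlanarLeftSimulates {a b : ℕ} (L : Fin a → Signature) (R : Fin b → Signature) {m : ℕ}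
    (g : Sig m) : Prop :=
  PlanarLeftRealizes L R g ∨ PlanarLeftInterpolates L R g

end Holant

/-! A matchgate signature vanishes off one parity of the weight, and planarity forces the matchgate
identity `Matchgate.sum_signature_mul_signature`. To prove it, superpose two matchings whose deleted
sets are complementary on the first `n` external nodes. The node with the flipped bit is the end of
a path in the superposition. The path cannot cross the others, so its other end has an index of
opposite parity, and exchanging the two matchings along it pairs off terms of opposite sign. For a
symmetric `f` with value `f_i` at weight `i` this yields `f_i f_{i+2l+2} = f_{i+2} f_{i+2l}`. Hence
on its parity class `f` is either geometric or supported on the last weight.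

Signatures supported on one string and geometric ones of ratio `1` or `-1` are affine. In the
remaining cases pinning, loops and a few small gadgets lead either to a multiple of [0,0,1,0] or to
[a,0,b,0] with `a`, `b` nonzero and `a² ≠ b²`. In the second case (`simulates_of_even`) there is a
binary gadget [u,0,v] with `|u| ≠ |v|`, and attaching its powers to the three edges gives multiples
of [0,0,1,0] + t_k [1,0,0,0]. The `|t_k|` form a geometric progression of ratio other than 1, so the
`t_k` are distinct and interpolation applies.

Planarity is treated as genus zero of a pair of permutations, with cycles counted by dimensions of
spaces of invariant functions over the field with two elements. Equality in the genus inequality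
says that every flow has a potential on the faces, which is how planarity of a matchgate is
exploited (`Matchgate.Superposed.even_between`). Conversely gadgets are kept planar because genus
zero survives merging vertices of different components and splitting a vertex (`IsSphere.merge`,
`IsSphere.split`). -/

section

open Equiv Module

namespace Holant

/-! ### Genus of a pair of permutations, by linear algebra over the field with two elements -/

section Invariants

variable {X Y : Type*}

/-- The functions to `ZMod 2` that are constant on the cycles of a permutation. -/
def invFun (A : Perm X) : Submodule (ZMod 2) (X → ZMod 2) where
  carrier := {φ | ∀ x, φ (A x) = φ x}
  add_mem' := fun ha hb x => by simp [ha x, hb x]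
  zero_mem' := fun _ => rfl
  smul_mem' := fun c φ h x => by simp [h x]

theorem mem_invFun {A : Perm X} {φ : X → ZMod 2} : φ ∈ invFun A ↔ ∀ x, φ (A x) = φ x := Iff.rfl

theorem invFun_pow_apply {A : Perm X} {φ : X → ZMod 2} (h : φ ∈ invFun A) (n : ℕ) (x : X) :
    φ ((A ^ n) x) = φ x := by
  induction n with
  | zero => rfl
  | succ n ih => rw [pow_succ', Perm.mul_apply, h, ih]

theorem eq_of_sameCycle [Finite X] {A : Perm X} {φ : X → ZMod 2} (h : φ ∈ invFun A) {x y : X}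
    (hxy : A.SameCycle x y) : φ x = φ y := by
  obtain ⟨n, rfl⟩ := hxy.exists_nat_pow_eq
  exact (invFun_pow_apply h n x).symm

theorem mem_invFun_iff_sameCycle [Finite X] {A : Perm X} {φ : X → ZMod 2} :
    φ ∈ invFun A ↔ ∀ x y, A.SameCycle x y → φ x = φ y :=
  ⟨fun h _ _ hxy => eq_of_sameCycle h hxy,
    fun h x => h _ _ (Perm.sameCycle_apply_left.2 (Perm.SameCycle.refl A x))⟩

open Classical in
theorem exists_invFun_ne {A : Perm X} {x y : X} (h : ¬ A.SameCycle x y) :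
    ∃ φ ∈ invFun A, φ x ≠ φ y := by
  refine ⟨fun z => if A.SameCycle x z then 1 else 0, fun z => ?_, ?_⟩
  · simp [Perm.sameCycle_apply_right]
  · simp [h, Perm.SameCycle.refl]

/-- Functions constant on the classes are the functions on the quotient. This turns each orbit count
in Euler's formula into a dimension. -/
theorem card_quotient_eq_finrank [Finite X] (r : Setoid X)
    (W : Submodule (ZMod 2) (X → ZMod 2)) (hW : ∀ φ, φ ∈ W ↔ ∀ x y, r x y → φ x = φ y) :
    Nat.card (Quotient r) = finrank (ZMod 2) W := by
  have hr : LinearMap.range (LinearMap.funLeft (ZMod 2) (ZMod 2) (Quotient.mk r)) = W := by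
    ext φ
    rw [hW, LinearMap.mem_range]
    constructor
    · rintro ⟨ψ, rfl⟩ x y hxy
      simp [LinearMap.funLeft_apply, Quotient.sound hxy]
    · intro h
      exact ⟨Quotient.lift φ h, by ext; simp [LinearMap.funLeft_apply]⟩
  have := Fintype.ofFinite (Quotient r)
  rw [← hr, LinearMap.finrank_range_of_inj
    (LinearMap.funLeft_injective_of_surjective _ _ _ Quotient.mk_surjective),
    finrank_fintype_fun_eq_card, Nat.card_eq_fintype_card]

theorem numCycles_eq_finrank {X : Type} [Finite X] (A : Perm X) :
    numCycles A = finrank (ZMod 2) (invFun A) :=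
  card_quotient_eq_finrank _ _ fun _ => mem_invFun_iff_sameCycle

theorem card_orbits_eq_finrank [Finite X] (A B : Perm X) :
    Nat.card (MulAction.orbitRel.Quotient (Subgroup.closure {A, B} : Subgroup (Perm X)) X) =
      finrank (ZMod 2) ↥(invFun A ⊓ invFun B) := by
  refine card_quotient_eq_finrank _ _ fun φ => ⟨fun h x y hxy => ?_, fun h => ⟨fun x => ?_, fun x => ?_⟩⟩
  · obtain ⟨⟨g, hg⟩, rfl⟩ := hxy
    change φ (g y) = φ y
    induction hg using Subgroup.closure_induction generalizing y with
    | mem g hg =>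
      rcases hg with rfl | rfl
      · exact h.1 y
      · exact h.2 y
    | one => rfl
    | mul a b _ _ ha hb => rw [Perm.mul_apply, ha, hb]
    | inv a _ ha => rw [← ha, ← Perm.mul_apply, mul_inv_cancel, Perm.one_apply]
  · exact h _ _ ⟨⟨A, Subgroup.subset_closure (by simp)⟩, rfl⟩
  · exact h _ _ ⟨⟨B, Subgroup.subset_closure (by simp)⟩, rfl⟩

/-- The pair of permutations `A`, `B` has genus `0` (as a hypermap). -/
def IsSphere (A B : Perm X) : Prop :=
  finrank (ZMod 2) (invFun A) + finrank (ZMod 2) (invFun B) + finrank (ZMod 2) (invFun (B * A)) =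
    Nat.card X + 2 * finrank (ZMod 2) ↥(invFun A ⊓ invFun B)

variable [Fintype X]

/-- The coboundary `ψ ↦ ψ - ψ ∘ B`. -/
def sideDiff (B : Perm X) : (X → ZMod 2) →ₗ[ZMod 2] (X → ZMod 2) :=
  LinearMap.id - LinearMap.funLeft (ZMod 2) (ZMod 2) B

omit [Fintype X] in
theorem sideDiff_apply (B : Perm X) (ψ : X → ZMod 2) (x : X) :
    sideDiff B ψ x = ψ x - ψ (B x) := rfl

/-- The standard bilinear form on functions. -/
def stdForm (X : Type*) [Fintype X] : LinearMap.BilinForm (ZMod 2) (X → ZMod 2) :=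
  dotProductBilin (ZMod 2) (ZMod 2)

theorem stdForm_apply (u v : X → ZMod 2) : stdForm X u v = ∑ x, u x * v x := rfl

theorem stdForm_isRefl : (stdForm X).IsRefl := fun u v h => by
  rw [stdForm_apply] at h ⊢
  rw [← h]
  exact Finset.sum_congr rfl fun _ _ => mul_comm _ _

theorem stdForm_nondegenerate : (stdForm X).Nondegenerate := by
  classical
  have key : ∀ u : X → ZMod 2, (∀ v, stdForm X u v = 0) → u = 0 := fun u h => by
    ext x
    simpa [stdForm_apply, Pi.single_apply] using h (Pi.single x 1)
  exact ⟨key, fun u h => key u fun v => stdForm_isRefl _ _ (h v)⟩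

/-- Rank-nullity for the coboundary on face functions: a function invariant under both `B` and `B *
A` is invariant under `A`. -/
theorem finrank_sideDiff (A B : Perm X) :
    finrank (ZMod 2) ((invFun (B * A)).map (sideDiff B)) +
      finrank (ZMod 2) ↥(invFun A ⊓ invFun B) = finrank (ZMod 2) (invFun (B * A)) := by
  rw [← LinearMap.finrank_range_add_finrank_ker ((sideDiff B).domRestrict (invFun (B * A))),
    LinearMap.range_domRestrict]
  congr 1
  have h : (LinearMap.ker ((sideDiff B).domRestrict (invFun (B * A)))).map
      (invFun (B * A)).subtype = invFun A ⊓ invFun B := by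
    ext φ
    simp only [Submodule.mem_map, LinearMap.mem_ker, LinearMap.domRestrict_apply,
      Submodule.subtype_apply, Subtype.exists, Submodule.mem_inf]
    constructor
    · rintro ⟨ψ, hψ, h0, rfl⟩
      have hB : ψ ∈ invFun B := fun x => by
        have := congrFun h0 x
        rw [sideDiff_apply] at this
        exact (sub_eq_zero.1 this).symm
      exact ⟨fun x => by rw [← hB (A x)]; exact hψ x, hB⟩
    · rintro ⟨hA, hB⟩
      refine ⟨φ, fun x => ?_, ?_, rfl⟩
      · rw [Perm.mul_apply, hB, hA]
      · ext x
        simp [sideDiff_apply, hB x]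
  rw [← h]
  exact (LinearEquiv.finrank_eq (Submodule.equivMapOfInjective _ (Submodule.subtype_injective _) _)).symm

/-- Summation by parts. Reindexing along `B` cancels the pairing with a `B`-invariant function;
reindexing along `A` cancels the pairing with an `A`-invariant one, since there `ψ` is invariant
under `B * A`. -/
theorem map_sideDiff_le_orthogonal (A B : Perm X) :
    (invFun (B * A)).map (sideDiff B) ≤ (stdForm X).orthogonal (invFun A ⊔ invFun B) := by
  rintro _ ⟨ψ, hψ, rfl⟩ w hw
  obtain ⟨α, hα, β, hβ, rfl⟩ := Submodule.mem_sup.1 hw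
  change stdForm X (α + β) (sideDiff B ψ) = 0
  simp only [stdForm_apply, sideDiff_apply, Pi.add_apply, add_mul, mul_sub,
    Finset.sum_add_distrib, Finset.sum_sub_distrib]
  have h1 : ∑ x, β x * ψ (B x) = ∑ x, β x * ψ x := by
    rw [← Equiv.sum_comp B fun x => β x * ψ x]
    exact Finset.sum_congr rfl fun x _ => by rw [hβ x]
  have h2 : ∑ x, α x * ψ (B x) = ∑ x, α x * ψ x := by
    rw [← Equiv.sum_comp A]
    exact Finset.sum_congr rfl fun x _ => by rw [hα x]; congr 1; exact hψ x
  rw [h1, h2]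
  ring

/-- The inclusion of coboundaries in the orthogonal complement of `invFun A ⊔ invFun B`, read as an
inequality of dimensions. The defect is twice the genus. -/
theorem genus_nonneg (A B : Perm X) :
    finrank (ZMod 2) (invFun A) + finrank (ZMod 2) (invFun B) + finrank (ZMod 2) (invFun (B * A)) ≤
      Nat.card X + 2 * finrank (ZMod 2) ↥(invFun A ⊓ invFun B) := by
  rw [Nat.card_eq_fintype_card]
  have h1 := Submodule.finrank_mono (map_sideDiff_le_orthogonal A B)
  have h2 := finrank_sideDiff A B
  have h3 := LinearMap.BilinForm.finrank_orthogonal stdForm_nondegenerate (invFun A ⊔ invFun B)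
  have h4 := Submodule.finrank_sup_add_finrank_inf_eq (invFun A) (invFun B)
  have h5 := Submodule.finrank_le (invFun A ⊔ invFun B)
  rw [finrank_fintype_fun_eq_card] at h3 h5
  omega

/-- On a sphere every flow has a potential on the faces. -/
theorem IsSphere.exists_potential {A B : Perm X} (h : IsSphere A B) (z : X → ZMod 2)
    (hA : ∀ α ∈ invFun A, ∑ x, α x * z x = 0) (hB : ∀ β ∈ invFun B, ∑ x, β x * z x = 0) :
    ∃ ψ ∈ invFun (B * A), ∀ x, z x = ψ x - ψ (B x) := by
  have h2 := finrank_sideDiff A B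
  have h3 := LinearMap.BilinForm.finrank_orthogonal stdForm_nondegenerate (invFun A ⊔ invFun B)
  have h4 := Submodule.finrank_sup_add_finrank_inf_eq (invFun A) (invFun B)
  have h5 := Submodule.finrank_le (invFun A ⊔ invFun B)
  rw [finrank_fintype_fun_eq_card] at h3 h5
  unfold IsSphere at h
  rw [Nat.card_eq_fintype_card] at h
  -- In genus zero the dimensions agree, so every element of the orthogonal complement is a
  -- coboundary.
  have h6 := Submodule.eq_of_le_of_finrank_eq (map_sideDiff_le_orthogonal A B) (by omega)
  have hz : z ∈ (invFun (B * A)).map (sideDiff B) := by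
    rw [h6]
    intro w hw
    obtain ⟨α, hα, β, hβ, rfl⟩ := Submodule.mem_sup.1 hw
    change stdForm X (α + β) z = 0
    simp only [stdForm_apply, Pi.add_apply, add_mul, Finset.sum_add_distrib, hA α hα, hB β hβ,
      add_zero]
  obtain ⟨ψ, hψ, rfl⟩ := hz
  exact ⟨ψ, hψ, fun x => rfl⟩

end Invariants

/-! ### Multiplication by a transposition -/

section Swap

variable {X : Type*} [Finite X] [DecidableEq X]

/-- Up to the first return of the orbit of `x` to the set {x, y}, composing with the transposition
changes nothing; at that moment it redirects the orbit. -/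
theorem exists_first_return (σ : Perm X) (x y : X) :
    ∃ N, 0 < N ∧ ((σ ^ N) x = x ∨ (σ ^ N) x = y) ∧
      ∀ j, 0 < j → j < N → (σ ^ j) x ≠ x ∧ (σ ^ j) x ≠ y ∧
        ((swap x y * σ) ^ j) x = (σ ^ j) x := by
  have hex : ∃ N, 0 < N ∧ ((σ ^ N) x = x ∨ (σ ^ N) x = y) :=
    ⟨orderOf σ, orderOf_pos σ, Or.inl (by simp [pow_orderOf_eq_one])⟩
  classical
  refine ⟨Nat.find hex, (Nat.find_spec hex).1, (Nat.find_spec hex).2, fun j => ?_⟩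
  induction j with
  | zero => intro h; omega
  | succ j ih =>
    intro _ hj
    have h := Nat.find_min hex hj
    push Not at h
    obtain ⟨h1, h2⟩ := h j.succ_pos
    refine ⟨h1, h2, ?_⟩
    rw [pow_succ', pow_succ', Perm.mul_apply, Perm.mul_apply, Perm.mul_apply]
    rw [pow_succ', Perm.mul_apply] at h1 h2
    rcases Nat.eq_zero_or_pos j with rfl | hj0
    · exact swap_apply_of_ne_of_ne h1 h2
    · rw [(ih hj0 (by omega)).2.2]
      exact swap_apply_of_ne_of_ne h1 h2

omit [Finite X] in
theorem swap_mul_pow_first_return {σ : Perm X} {x y : X} {N : ℕ} (hN : 0 < N)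
    (h : ∀ j, 0 < j → j < N → (σ ^ j) x ≠ x ∧ (σ ^ j) x ≠ y ∧
        ((swap x y * σ) ^ j) x = (σ ^ j) x) :
    ((swap x y * σ) ^ N) x = swap x y ((σ ^ N) x) := by
  obtain ⟨M, rfl⟩ : ∃ M, N = M + 1 := ⟨N - 1, by omega⟩
  rw [pow_succ', pow_succ', Perm.mul_apply, Perm.mul_apply, Perm.mul_apply]
  rcases Nat.eq_zero_or_pos M with rfl | hM
  · rfl
  · rw [(h M hM (by omega)).2.2]

theorem sameCycle_swap_mul {σ : Perm X} {x y : X} (h : ¬ σ.SameCycle x y) :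
    (swap x y * σ).SameCycle x y := by
  obtain ⟨N, hN, hx, hj⟩ := exists_first_return σ x y
  have h1 : (σ ^ N) x = x := hx.resolve_right fun h' => h ⟨N, by simpa using h'⟩
  have h2 := swap_mul_pow_first_return hN hj
  rw [h1, swap_apply_left] at h2
  exact ⟨N, by simpa using h2⟩

omit [Finite X] [DecidableEq X] in
theorem pow_mod_apply_of_fixed {τ : Perm X} {x : X} {N : ℕ} (h : (τ ^ N) x = x) (M : ℕ) :
    (τ ^ (M % N)) x = (τ ^ M) x := by
  have : ((τ ^ N) ^ (M / N)) x = x := by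
    have : ∀ k : ℕ, ((τ ^ N) ^ k) x = x := fun k => by
      induction k with
      | zero => rfl
      | succ k ih => rw [pow_succ, Perm.mul_apply, h, ih]
    exact this _
  conv_rhs => rw [← Nat.mod_add_div M N, pow_add, pow_mul, Perm.mul_apply, this]

/-- The orbit of `x` under `σ` reaches `y` before it returns to `x`. The transposition sends it back
to `x` at that moment, so the new cycle closes without containing `y`. -/
theorem not_sameCycle_swap_mul {σ : Perm X} {x y : X} (hxy : x ≠ y) (h : σ.SameCycle x y) :
    ¬ (swap x y * σ).SameCycle x y := by
  obtain ⟨N, hN, hx, hj⟩ := exists_first_return σ x y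
  have h1 : (σ ^ N) x = y := by
    refine hx.resolve_left fun hx => ?_
    obtain ⟨M, hM⟩ := h.exists_nat_pow_eq
    rw [← pow_mod_apply_of_fixed hx] at hM
    rcases Nat.eq_zero_or_pos (M % N) with h0 | h0
    · rw [h0] at hM; exact hxy hM
    · exact (hj _ h0 (Nat.mod_lt _ hN)).2.1 hM
  have h2 := swap_mul_pow_first_return hN hj
  rw [h1, swap_apply_right] at h2
  intro h
  obtain ⟨M, hM⟩ := h.exists_nat_pow_eq
  rw [← pow_mod_apply_of_fixed h2] at hM
  rcases Nat.eq_zero_or_pos (M % N) with h0 | h0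
  · rw [h0] at hM; exact hxy hM
  · obtain ⟨_, h3, h4⟩ := hj _ h0 (Nat.mod_lt _ hN)
    exact h3 (h4.symm.trans hM)

/-- The functions with equal values at two points. -/
def eqFun (x y : X) : Submodule (ZMod 2) (X → ZMod 2) :=
  LinearMap.ker (LinearMap.proj (R := ZMod 2) (φ := fun _ : X => ZMod 2) x - LinearMap.proj y)

omit [Finite X] [DecidableEq X] in
theorem mem_eqFun {x y : X} {φ : X → ZMod 2} : φ ∈ eqFun x y ↔ φ x = φ y := by
  simp [eqFun, sub_eq_zero]

-- The form `φ x - φ y` is nonzero on `W`, so its kernel has codimension one.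
omit [DecidableEq X] in
theorem finrank_inf_eqFun (W : Submodule (ZMod 2) (X → ZMod 2)) {x y : X}
    (h : ∃ φ ∈ W, φ x ≠ φ y) :
    finrank (ZMod 2) ↥(W ⊓ eqFun x y) + 1 = finrank (ZMod 2) W := by
  set L := LinearMap.proj (R := ZMod 2) (φ := fun _ : X => ZMod 2) x - LinearMap.proj y with hL
  have h1 := LinearMap.finrank_range_add_finrank_ker (L.domRestrict W)
  have h2 : LinearMap.range (L.domRestrict W) = ⊤ := by
    obtain ⟨φ, hφ, hne⟩ := h
    refine LinearMap.range_eq_top.2 (LinearMap.surjective fun h0 => hne ?_)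
    have := LinearMap.congr_fun h0 ⟨φ, hφ⟩
    simpa [hL, sub_eq_zero] using this
  have h3 : (LinearMap.ker (L.domRestrict W)).map W.subtype = W ⊓ eqFun x y := by
    ext φ
    simp only [Submodule.mem_map, LinearMap.mem_ker, LinearMap.domRestrict_apply,
      Submodule.subtype_apply, Subtype.exists, Submodule.mem_inf, eqFun]
    exact ⟨by rintro ⟨ψ, hψ, h0, rfl⟩; exact ⟨hψ, h0⟩, fun ⟨a, b⟩ => ⟨φ, a, b, rfl⟩⟩
  rw [h2, finrank_top, finrank_self] at h1
  rw [← h3, ← h1, add_comm]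
  congr 1
  exact (LinearEquiv.finrank_eq
    (Submodule.equivMapOfInjective _ (Submodule.subtype_injective _) _)).symm

omit [Finite X] in
theorem invFun_swap_mul_inf_eqFun (σ : Perm X) (x y : X) :
    invFun (swap x y * σ) ⊓ eqFun x y = invFun σ ⊓ eqFun x y := by
  ext φ
  simp only [Submodule.mem_inf, mem_eqFun]
  refine and_congr_left fun h => ?_
  have : ∀ z, φ (swap x y z) = φ z := fun z => by
    rcases eq_or_ne z x with rfl | hx
    · rw [swap_apply_left, h]
    · rcases eq_or_ne z y with rfl | hy
      · rw [swap_apply_right, h]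
      · rw [swap_apply_of_ne_of_ne hx hy]
  exact forall_congr' fun z => by rw [Perm.mul_apply, this]

theorem invFun_swap_mul_of_not_sameCycle {σ : Perm X} {x y : X} (h : ¬ σ.SameCycle x y) :
    invFun (swap x y * σ) = invFun σ ⊓ eqFun x y := by
  rw [← invFun_swap_mul_inf_eqFun, left_eq_inf]
  exact fun φ hφ => mem_eqFun.2 (eq_of_sameCycle hφ (sameCycle_swap_mul h))

theorem finrank_invFun_swap_mul_of_not_sameCycle {σ : Perm X} {x y : X} (h : ¬ σ.SameCycle x y) :
    finrank (ZMod 2) (invFun (swap x y * σ)) + 1 = finrank (ZMod 2) (invFun σ) := by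
  rw [invFun_swap_mul_of_not_sameCycle h]
  exact finrank_inf_eqFun _ (exists_invFun_ne h)

theorem invFun_eq_of_sameCycle {σ : Perm X} {x y : X} (hxy : x ≠ y) (h : σ.SameCycle x y) :
    invFun σ = invFun (swap x y * σ) ⊓ eqFun x y := by
  have := invFun_swap_mul_of_not_sameCycle (not_sameCycle_swap_mul hxy h)
  rwa [swap_mul_self_mul] at this

theorem finrank_invFun_swap_mul_of_sameCycle {σ : Perm X} {x y : X} (hxy : x ≠ y)
    (h : σ.SameCycle x y) :
    finrank (ZMod 2) (invFun (swap x y * σ)) = finrank (ZMod 2) (invFun σ) + 1 := by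
  rw [invFun_eq_of_sameCycle hxy h]
  exact (finrank_inf_eqFun _ (exists_invFun_ne (not_sameCycle_swap_mul hxy h))).symm

end Swap

/-! ### Operations that preserve genus zero -/

section Sphere

variable {X Y : Type*} [Fintype X] [Fintype Y]

/-- Merging two vertices that lie in different components. -/
theorem IsSphere.merge [DecidableEq X] {A B : Perm X} (h : IsSphere A B) {x y : X}
    (hxy : ∃ φ, φ ∈ invFun A ∧ φ ∈ invFun B ∧ φ x ≠ φ y) : IsSphere A (swap x y * B) := by
  obtain ⟨φ, hA, hB, hne⟩ := hxy
  have hBA : φ ∈ invFun (B * A) := fun z => by rw [Perm.mul_apply, hB, hA]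
  have h1 : ¬ B.SameCycle x y := fun h => hne (eq_of_sameCycle hB h)
  have h2 : ¬ (B * A).SameCycle x y := fun h => hne (eq_of_sameCycle hBA h)
  have e1 := finrank_invFun_swap_mul_of_not_sameCycle h1
  have e2 := finrank_invFun_swap_mul_of_not_sameCycle h2
  have e3 := finrank_inf_eqFun (invFun A ⊓ invFun B) ⟨φ, ⟨hA, hB⟩, hne⟩
  rw [inf_assoc, ← invFun_swap_mul_of_not_sameCycle h1] at e3
  unfold IsSphere at h ⊢
  rw [mul_assoc]
  omega

/-- Splitting a vertex. -/
theorem IsSphere.split [DecidableEq X] {A B : Perm X} (h : IsSphere A B) {x y : X} (hne : x ≠ y)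
    (hxy : B.SameCycle x y) : IsSphere A (swap x y * B) := by
  have e1 := finrank_invFun_swap_mul_of_sameCycle hne hxy
  have hg := genus_nonneg A (swap x y * B)
  -- If the split separates `x` from `y` into two components, the face through both is cut too, and
  -- the counts balance. Otherwise the number of components is unchanged, and the number of faces
  -- must drop by one, since an increase would make the genus negative.
  by_cases hφ : ∃ φ ∈ invFun A ⊓ invFun (swap x y * B), φ x ≠ φ y
  · have e3 := finrank_inf_eqFun _ hφ
    rw [inf_assoc, ← invFun_eq_of_sameCycle hne hxy] at e3
    obtain ⟨φ, ⟨hA, hB⟩, hφ⟩ := hφ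
    have hBA : φ ∈ invFun (swap x y * (B * A)) := fun z => by
      rw [← mul_assoc, Perm.mul_apply, hB, hA]
    have h2 : (B * A).SameCycle x y := by
      by_contra h2
      exact hφ (eq_of_sameCycle hBA (sameCycle_swap_mul h2))
    have e2 := finrank_invFun_swap_mul_of_sameCycle hne h2
    unfold IsSphere at h ⊢
    rw [mul_assoc]
    omega
  · push Not at hφ
    have e3 : invFun A ⊓ invFun B = invFun A ⊓ invFun (swap x y * B) := by
      rw [invFun_eq_of_sameCycle hne hxy, ← inf_assoc, inf_eq_left]
      exact fun φ h => mem_eqFun.2 (hφ φ h)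
    unfold IsSphere at h ⊢
    rw [mul_assoc] at hg ⊢
    rw [← e3] at hg ⊢
    by_cases h2 : (B * A).SameCycle x y
    · have e2 := finrank_invFun_swap_mul_of_sameCycle hne h2
      omega
    · have e2 := finrank_invFun_swap_mul_of_not_sameCycle h2
      omega

omit [Fintype X] [Fintype Y] in
theorem finrank_eq_of_equiv (e : X ≃ Y) (W : Submodule (ZMod 2) (X → ZMod 2))
    (W' : Submodule (ZMod 2) (Y → ZMod 2)) (h : ∀ φ, φ ∈ W' ↔ φ ∘ e ∈ W) :
    finrank (ZMod 2) W' = finrank (ZMod 2) W := by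
  have : W' = W.comap (LinearEquiv.funCongrLeft (ZMod 2) (ZMod 2) e).toLinearMap := by
    ext φ; exact h φ
  rw [this, Submodule.comap_equiv_eq_map_symm]
  exact LinearEquiv.finrank_map_eq _ _

omit [Fintype X] [Fintype Y] in
theorem mem_invFun_permCongr (e : X ≃ Y) (A : Perm X) (φ : Y → ZMod 2) :
    φ ∈ invFun (e.permCongr A) ↔ φ ∘ e ∈ invFun A := by
  simp only [mem_invFun, Equiv.permCongr_apply, Function.comp]
  exact ⟨fun h x => by simpa using h (e x), fun h y => by simpa using h (e.symm y)⟩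

omit [Fintype X] [Fintype Y] in
theorem IsSphere.permCongr {A B : Perm X} (h : IsSphere A B) (e : X ≃ Y) :
    IsSphere (e.permCongr A) (e.permCongr B) := by
  unfold IsSphere at h ⊢
  have hm : e.permCongr B * e.permCongr A = e.permCongr (B * A) := by
    ext; simp
  rw [hm, finrank_eq_of_equiv e _ _ (mem_invFun_permCongr e A),
    finrank_eq_of_equiv e _ _ (mem_invFun_permCongr e B),
    finrank_eq_of_equiv e _ _ (mem_invFun_permCongr e (B * A)),
    finrank_eq_of_equiv e (invFun A ⊓ invFun B) _ fun φ =>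
      and_congr (mem_invFun_permCongr e A φ) (mem_invFun_permCongr e B φ),
    ← Nat.card_congr e, h]

theorem finrank_eq_add_of_sum (W₁ : Submodule (ZMod 2) (X → ZMod 2))
    (W₂ : Submodule (ZMod 2) (Y → ZMod 2)) (W : Submodule (ZMod 2) (X ⊕ Y → ZMod 2))
    (h : ∀ φ, φ ∈ W ↔ φ ∘ Sum.inl ∈ W₁ ∧ φ ∘ Sum.inr ∈ W₂) :
    finrank (ZMod 2) W = finrank (ZMod 2) W₁ + finrank (ZMod 2) W₂ := by
  let e : W ≃ₗ[ZMod 2] W₁ × W₂ :=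
    { toFun := fun φ => (⟨φ.1 ∘ Sum.inl, ((h _).1 φ.2).1⟩, ⟨φ.1 ∘ Sum.inr, ((h _).1 φ.2).2⟩)
      invFun := fun p => ⟨Sum.elim p.1.1 p.2.1, (h _).2 ⟨p.1.2, p.2.2⟩⟩
      left_inv := fun φ => Subtype.ext (Sum.elim_comp_inl_inr φ.1)
      right_inv := fun _ => rfl
      map_add' := fun _ _ => rfl
      map_smul' := fun _ _ => rfl }
  rw [LinearEquiv.finrank_eq e, finrank_prod]

omit [Fintype X] [Fintype Y] in
theorem mem_invFun_sumCongr (A : Perm X) (B : Perm Y) (φ : X ⊕ Y → ZMod 2) :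
    φ ∈ invFun (Perm.sumCongr A B) ↔ φ ∘ Sum.inl ∈ invFun A ∧ φ ∘ Sum.inr ∈ invFun B := by
  simp [mem_invFun]

theorem IsSphere.sumCongr {A B : Perm X} {A' B' : Perm Y} (h : IsSphere A B)
    (h' : IsSphere A' B') : IsSphere (Perm.sumCongr A A') (Perm.sumCongr B B') := by
  unfold IsSphere at h h' ⊢
  rw [Perm.sumCongr_mul, finrank_eq_add_of_sum _ _ _ (mem_invFun_sumCongr A A'),
    finrank_eq_add_of_sum _ _ _ (mem_invFun_sumCongr B B'),
    finrank_eq_add_of_sum _ _ _ (mem_invFun_sumCongr (B * A) (B' * A')),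
    finrank_eq_add_of_sum (invFun A ⊓ invFun B) (invFun A' ⊓ invFun B') _ fun φ => by
      simp only [Submodule.mem_inf, mem_invFun_sumCongr]; tauto,
    Nat.card_sum]
  omega

end Sphere

/-! ### Plane rotations as spheres -/

section PlaneRotation

variable {N E : Type} [Fintype E]

theorem finrank_invFun_flipHalf : finrank (ZMod 2) (invFun (flipHalf E)) = Fintype.card E := by
  have : invFun (flipHalf E) =
      LinearMap.range (LinearMap.funLeft (ZMod 2) (ZMod 2) (Prod.fst : E × Bool → E)) := by
    ext φ
    constructor
    · intro h
      refine ⟨fun e => φ (e, true), ?_⟩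
      ext ⟨e, b⟩
      cases b
      · exact h (e, false)
      · rfl
    · rintro ⟨ψ, rfl⟩ ⟨e, b⟩
      rfl
  rw [this, LinearMap.finrank_range_of_inj
    (LinearMap.funLeft_injective_of_surjective _ _ _ Prod.fst_surjective),
    finrank_fintype_fun_eq_card]

/-- The flip contributes one cycle per edge while there are two half-edges per edge, so Euler's
formula for the embedding is the genus-zero condition for the pair of flip and rotation. -/
theorem isPlaneRotation_iff (att : E × Bool → N) (ρ : Perm (E × Bool)) :
    IsPlaneRotation att ρ ↔
      (∀ h h' : E × Bool, ρ.SameCycle h h' ↔ att h = att h') ∧ IsSphere (flipHalf E) ρ := by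
  unfold IsPlaneRotation IsSphere
  rw [numCycles_eq_finrank, numCycles_eq_finrank, card_orbits_eq_finrank, finrank_invFun_flipHalf,
    Nat.card_prod, Nat.card_eq_fintype_card, Nat.card_eq_fintype_card, Fintype.card_bool,
    inf_comm (invFun (flipHalf E))]
  refine and_congr_right fun _ => ?_
  omega

end PlaneRotation

/-! ### Degrees and components in superposed matchings -/

namespace Matchgate

open Classical

variable {k : ℕ} (Γ : Matchgate k)

/-- The number of half-edges at `v` that belong to edges of `M`. -/
noncomputable def deg (M : Finset Γ.E) (v : Γ.V) : ℕ :=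
  (Finset.univ.filter fun h : Γ.E × Bool => h.1 ∈ M ∧ Γ.att h = v).card

theorem deg_eq_sum (M : Finset Γ.E) (v : Γ.V) :
    Γ.deg M v = ∑ e, ∑ b, if e ∈ M ∧ Γ.att (e, b) = v then 1 else 0 := by
  rw [deg, Finset.card_filter, Fintype.sum_prod_type]

/-- No edge of `M` leaves the vertex set `T`. -/
def IsClosed (M : Finset Γ.E) (T : Finset Γ.V) : Prop :=
  ∀ e ∈ M, ∀ b, Γ.att (e, b) ∈ T ↔ Γ.att (e, false) ∈ T

variable {Γ}

theorem IsClosed.mono {M M' : Finset Γ.E} {T : Finset Γ.V} (h : Γ.IsClosed M T) (hM : M' ⊆ M) :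
    Γ.IsClosed M' T := fun e he => h e (hM he)

theorem IsClosed.sum_deg {M : Finset Γ.E} {T : Finset Γ.V} (h : Γ.IsClosed M T) :
    ∑ v ∈ T, Γ.deg M v = 2 * (M.filter fun e => Γ.att (e, false) ∈ T).card := by
  have h1 : ∀ e b, (∑ v ∈ T, if e ∈ M ∧ Γ.att (e, b) = v then 1 else 0) =
      if e ∈ M ∧ Γ.att (e, false) ∈ T then 1 else 0 := fun e b => by
    by_cases he : e ∈ M
    · simp [he, h e he b]
    · simp [he]
  simp only [deg_eq_sum]
  rw [Finset.sum_comm]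
  rw [Finset.sum_congr rfl fun e _ => Finset.sum_comm]
  simp only [h1, Finset.sum_const, Finset.card_univ, Fintype.card_bool, smul_eq_mul]
  rw [← Finset.mul_sum, ← Finset.card_filter]
  congr 2
  ext e
  simp

/-- The graph formed by the edges in `M`. -/
def edgeGraph (Γ : Matchgate k) (M : Finset Γ.E) : SimpleGraph Γ.V where
  Adj v w := v ≠ w ∧ ∃ e ∈ M, ∃ b, Γ.att (e, b) = v ∧ Γ.att (e, !b) = w
  symm := ⟨fun v w ⟨hne, e, he, b, hv, hw⟩ => ⟨hne.symm, e, he, !b, hw, by simpa using hv⟩⟩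
  loopless := ⟨fun v h => h.1 rfl⟩

theorem edgeGraph_reachable {M : Finset Γ.E} {e : Γ.E} (he : e ∈ M) (b : Bool) :
    (Γ.edgeGraph M).Reachable (Γ.att (e, b)) (Γ.att (e, !b)) := by
  by_cases h : Γ.att (e, b) = Γ.att (e, !b)
  · rw [h]
  · exact SimpleGraph.Adj.reachable ⟨h, e, he, b, rfl, rfl⟩

/-- The vertices of the component of `v` in the graph formed by the edges in `M`. -/
noncomputable def component (Γ : Matchgate k) (M : Finset Γ.E) (v : Γ.V) : Finset Γ.V :=
  Finset.univ.filter fun w => (Γ.edgeGraph M).Reachable v w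

theorem mem_component {M : Finset Γ.E} {v w : Γ.V} :
    w ∈ Γ.component M v ↔ (Γ.edgeGraph M).Reachable v w := by simp [component]

theorem self_mem_component (M : Finset Γ.E) (v : Γ.V) : v ∈ Γ.component M v :=
  mem_component.2 (SimpleGraph.Reachable.refl v)

theorem component_eq {M : Finset Γ.E} {v w : Γ.V} (h : w ∈ Γ.component M v) :
    Γ.component M w = Γ.component M v := by
  rw [mem_component] at h
  ext u
  rw [mem_component, mem_component]
  exact ⟨h.trans, h.symm.trans⟩

theorem isClosed_of_reachable {M : Finset Γ.E} {T : Finset Γ.V}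
    (h : ∀ v w, (Γ.edgeGraph M).Reachable v w → v ∈ T → w ∈ T) : Γ.IsClosed M T := by
  intro e he b
  cases b
  · rfl
  · exact ⟨h _ _ (edgeGraph_reachable he true), h _ _ (edgeGraph_reachable he false)⟩

theorem isClosed_component (M : Finset Γ.E) (v : Γ.V) : Γ.IsClosed M (Γ.component M v) :=
  isClosed_of_reachable fun _ _ h hu =>
    mem_component.2 ((mem_component.1 hu).trans h)

/-- A connected simple graph has at most one vertex more than edges. Each of its edges comes from
some edge of `M`, and loops and parallel edges only add to the right-hand side. -/
theorem card_component_le (M : Finset Γ.E) (v : Γ.V) :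
    (Γ.component M v).card ≤
      (M.filter fun e => Γ.att (e, false) ∈ Γ.component M v).card + 1 := by
  set C := (Γ.edgeGraph M).connectedComponentMk v with hC
  have hmem : ∀ w, w ∈ C ↔ w ∈ Γ.component M v := fun w => by
    rw [mem_component, hC]
    change (Γ.edgeGraph M).connectedComponentMk w = _ ↔ _
    rw [SimpleGraph.ConnectedComponent.eq]
    exact SimpleGraph.reachable_comm
  have h1 := C.connected_toSimpleGraph.card_vert_le_card_edgeSet_add_one
  have h2 : Nat.card C = (Γ.component M v).card := by
    rw [Nat.card_congr (Equiv.subtypeEquivRight hmem)]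
    simp
  rw [← h2]
  refine h1.trans (Nat.add_le_add_right ?_ 1)
  have h3 : ∀ d : C.toSimpleGraph.edgeSet, ∃ e : {e // e ∈ M.filter fun e =>
      Γ.att (e, false) ∈ Γ.component M v},
      s(Γ.att (e.1, false), Γ.att (e.1, true)) = Sym2.map Subtype.val d.1 := by
    rintro ⟨d, hd⟩
    induction d using Sym2.ind with
    | _ u w =>
      obtain ⟨-, e, he, b, h1, h2⟩ : (Γ.edgeGraph M).Adj u.1 w.1 := hd
      have hmem : Γ.att (e, false) ∈ Γ.component M v := by
        rw [← isClosed_component M v e he b, h1]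
        exact (hmem _).1 u.2
      refine ⟨⟨e, Finset.mem_filter.2 ⟨he, hmem⟩⟩, ?_⟩
      change s(Γ.att (e, false), Γ.att (e, true)) = s(u.1, w.1)
      rw [← h1, ← h2]
      cases b
      · rfl
      · exact Sym2.eq_swap
  choose g hg using h3
  have hinj : Function.Injective g := fun d d' h => by
    have := hg d
    rw [h, hg d'] at this
    exact Subtype.ext (Sym2.map.injective Subtype.val_injective this.symm)
  have := Nat.card_le_card_of_injective g hinj
  rwa [Nat.card_eq_fintype_card, Nat.card_eq_fintype_card, Fintype.card_coe,
    ← Nat.card_eq_fintype_card] at this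

/-- `M₁`, `M₂` are perfect matchings after deletion of two sets of external nodes that are
complementary on the first `n` external nodes and agree on the other ones. -/
structure Superposed (Γ : Matchgate k) (n : ℕ) (x₁ x₂ : Fin k → Bool) (M₁ M₂ : Finset Γ.E) :
    Prop where
  left : Γ.IsPerfectMatching x₁ M₁
  right : Γ.IsPerfectMatching x₂ M₂
  compl : ∀ i, x₂ i = xor (x₁ i) (decide (i.val < n))

/-! ### Components of a superposition and the external nodes they join -/

namespace Superposed

variable {n : ℕ} {x₁ x₂ : Fin k → Bool} {M₁ M₂ : Finset Γ.E}

theorem deg_ext (h : Γ.Superposed n x₁ x₂ M₁ M₂) {i : Fin k} (hi : i.val < n) :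
    Γ.deg M₁ (Γ.ext i) + Γ.deg M₂ (Γ.ext i) = 1 := by
  have h1 : Γ.deg M₁ (Γ.ext i) = _ := h.left (Γ.ext i)
  have h2 : Γ.deg M₂ (Γ.ext i) = _ := h.right (Γ.ext i)
  have hx : ∀ x : Fin k → Bool, (∃ j, Γ.ext j = Γ.ext i ∧ x j = true) ↔ x i = true := fun x =>
    ⟨fun ⟨j, hj, hx⟩ => Γ.ext_injective hj ▸ hx, fun h => ⟨i, rfl, h⟩⟩
  rw [h1, h2, if_congr (hx x₁) rfl rfl, if_congr (hx x₂) rfl rfl, h.compl i]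
  cases x₁ i <;> simp [hi]

theorem deg_of_ne (h : Γ.Superposed n x₁ x₂ M₁ M₂) {v : Γ.V}
    (hv : ∀ i : Fin k, i.val < n → Γ.ext i ≠ v) :
    Γ.deg M₁ v + Γ.deg M₂ v = 0 ∨ Γ.deg M₁ v + Γ.deg M₂ v = 2 := by
  have h1 : Γ.deg M₁ v = _ := h.left v
  have h2 : Γ.deg M₂ v = _ := h.right v
  have hx : (∃ j, Γ.ext j = v ∧ x₂ j = true) ↔ ∃ j, Γ.ext j = v ∧ x₁ j = true := by
    refine exists_congr fun j => and_congr_right fun hj => ?_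
    rw [h.compl j, decide_eq_false fun hlt => hv j hlt hj, Bool.xor_false]
  rw [h1, h2, if_congr hx rfl rfl]
  split_ifs <;> simp

/-- The external nodes among the first `n` that belong to `T`. -/
noncomputable def nodes (Γ : Matchgate k) (n : ℕ) (T : Finset Γ.V) : Finset (Fin k) :=
  Finset.univ.filter fun i => i.val < n ∧ Γ.ext i ∈ T

theorem mem_nodes {T : Finset Γ.V} {i : Fin k} :
    i ∈ nodes Γ n T ↔ i.val < n ∧ Γ.ext i ∈ T := by simp [nodes]

theorem card_nodes (T : Finset Γ.V) :
    (nodes Γ n T).card = ∑ v ∈ T, if ∃ i : Fin k, i.val < n ∧ Γ.ext i = v then 1 else 0 := by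
  rw [← Finset.card_filter, ← Finset.card_image_of_injective _ Γ.ext_injective]
  congr 1
  ext v
  simp only [Finset.mem_image, mem_nodes, Finset.mem_filter]
  constructor
  · rintro ⟨i, ⟨hi, hT⟩, rfl⟩
    exact ⟨hT, i, hi, rfl⟩
  · rintro ⟨hT, i, hi, rfl⟩
    exact ⟨i, ⟨hi, hT⟩, rfl⟩

theorem deg_add_cast (h : Γ.Superposed n x₁ x₂ M₁ M₂) (v : Γ.V) :
    ((Γ.deg M₁ v + Γ.deg M₂ v : ℕ) : ZMod 2) =
      if ∃ i : Fin k, i.val < n ∧ Γ.ext i = v then 1 else 0 := by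
  split_ifs with hv
  · obtain ⟨i, hi, rfl⟩ := hv
    rw [h.deg_ext hi, Nat.cast_one]
  · push Not at hv
    rcases h.deg_of_ne hv with h | h <;> rw [h]
    · rfl
    · rfl

theorem even_card_nodes (h : Γ.Superposed n x₁ x₂ M₁ M₂) {T : Finset Γ.V}
    (hT : Γ.IsClosed (M₁ ∪ M₂) T) : Even (nodes Γ n T).card := by
  rw [← ZMod.natCast_eq_zero_iff_even, card_nodes, Nat.cast_sum]
  push_cast
  rw [← Finset.sum_congr rfl fun v _ => h.deg_add_cast v, ← Nat.cast_sum, Finset.sum_add_distrib,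
    (hT.mono Finset.subset_union_left).sum_deg, (hT.mono Finset.subset_union_right).sum_deg,
    ZMod.natCast_eq_zero_iff_even]
  exact (even_two_mul _).add (even_two_mul _)

/-- The total degree in a component is at most twice its number of vertices minus its number of
nodes, since a node has degree 1 and any other vertex at most 2. Connectedness makes the total
degree at least twice the number of vertices minus 2. -/
theorem card_nodes_le_two (h : Γ.Superposed n x₁ x₂ M₁ M₂) (v : Γ.V) :
    (nodes Γ n (Γ.component (M₁ ∪ M₂) v)).card ≤ 2 := by
  set T := Γ.component (M₁ ∪ M₂) v with hTdef
  have hT : Γ.IsClosed (M₁ ∪ M₂) T := isClosed_component _ _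
  have h1 := card_component_le (M₁ ∪ M₂) v
  have h2 := (hT.mono Finset.subset_union_left).sum_deg
  have h3 := (hT.mono Finset.subset_union_right).sum_deg
  have h4 : ((M₁ ∪ M₂).filter fun e => Γ.att (e, false) ∈ T).card ≤
      (M₁.filter fun e => Γ.att (e, false) ∈ T).card +
        (M₂.filter fun e => Γ.att (e, false) ∈ T).card := by
    rw [Finset.filter_union]
    exact Finset.card_union_le _ _
  have h5 : ∑ v ∈ T, (Γ.deg M₁ v + Γ.deg M₂ v) + (nodes Γ n T).card ≤ 2 * T.card := by
    rw [card_nodes, ← Finset.sum_add_distrib, mul_comm, ← smul_eq_mul, ← Finset.sum_const]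
    refine Finset.sum_le_sum fun w _ => ?_
    split_ifs with hw
    · obtain ⟨i, hi, rfl⟩ := hw
      rw [h.deg_ext hi]
    · push Not at hw
      rcases h.deg_of_ne hw with h | h <;> omega
  rw [Finset.sum_add_distrib, h2, h3] at h5
  rw [← hTdef] at h1
  omega

theorem exists_nodes_eq (h : Γ.Superposed n x₁ x₂ M₁ M₂) {i : Fin k} (hi : i.val < n) :
    ∃ j, j ≠ i ∧ nodes Γ n (Γ.component (M₁ ∪ M₂) (Γ.ext i)) = {i, j} := by
  have h1 := h.card_nodes_le_two (Γ.ext i)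
  have h2 := h.even_card_nodes (isClosed_component (M₁ ∪ M₂) (Γ.ext i))
  have hmem : i ∈ nodes Γ n (Γ.component (M₁ ∪ M₂) (Γ.ext i)) :=
    mem_nodes.2 ⟨hi, self_mem_component _ _⟩
  have h3 : (nodes Γ n (Γ.component (M₁ ∪ M₂) (Γ.ext i))).card = 2 := by
    have := Finset.card_pos.2 ⟨i, hmem⟩
    obtain ⟨c, hc⟩ := h2
    omega
  obtain ⟨a, b, hab, hS⟩ := Finset.card_eq_two.1 h3
  rw [hS] at hmem ⊢
  simp only [Finset.mem_insert, Finset.mem_singleton] at hmem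
  rcases hmem with rfl | rfl
  · exact ⟨b, hab.symm, rfl⟩
  · exact ⟨a, hab, Finset.pair_comm _ _⟩

/-- The flow that runs along the component with vertex set `T` and through infinity. -/
noncomputable def flow (Γ : Matchgate k) (n : ℕ) (M₁ M₂ : Finset Γ.E) (T : Finset Γ.V) :
    (Γ.E ⊕ Fin k) × Bool → ZMod 2
  | (Sum.inl e, _) => if Γ.att (e, false) ∈ T then
      (if e ∈ M₁ then 1 else 0) + (if e ∈ M₂ then 1 else 0) else 0
  | (Sum.inr s, _) => if s ∈ nodes Γ n T then 1 else 0

theorem flow_inl {T : Finset Γ.V} (hT : Γ.IsClosed (M₁ ∪ M₂) T) (e : Γ.E) (b : Bool) :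
    flow Γ n M₁ M₂ T (Sum.inl e, b) = if Γ.att (e, b) ∈ T then
      (if e ∈ M₁ then 1 else 0) + (if e ∈ M₂ then 1 else 0) else 0 := by
  rw [flow]
  by_cases he : e ∈ M₁ ∪ M₂
  · rw [if_congr (hT e he b) rfl rfl]
  · rw [Finset.mem_union, not_or] at he
    simp [he]

/-- Conservation modulo 2. A node of `T` has odd degree in the superposition, compensated by its
dangling edge; every other vertex has even degree; and at infinity an even number of nodes arrive.
-/
theorem sum_flow_eq_zero (h : Γ.Superposed n x₁ x₂ M₁ M₂) {T : Finset Γ.V}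
    (hT : Γ.IsClosed (M₁ ∪ M₂) T) (v : Option Γ.V) :
    ∑ d, (if closeUp Γ.att Γ.ext d = v then flow Γ n M₁ M₂ T d else 0) = 0 := by
  rw [Fintype.sum_prod_type]
  simp only [Fintype.sum_sum_type, Fintype.sum_bool]
  cases v with
  | none =>
    simp only [closeUp, reduceCtorEq, if_false, if_true, add_zero, zero_add,
      Finset.sum_const_zero, flow]
    rw [← Finset.sum_filter, Finset.sum_const, nsmul_one, Finset.filter_mem_eq_inter,
      Finset.univ_inter, ZMod.natCast_eq_zero_iff_even]
    exact h.even_card_nodes hT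
  | some v =>
    simp only [closeUp, reduceCtorEq, if_false, zero_add, flow_inl hT, Option.some.injEq]
    have h1 : ∀ e b, (if Γ.att (e, b) = v then if Γ.att (e, b) ∈ T then
        (if e ∈ M₁ then (1 : ZMod 2) else 0) + (if e ∈ M₂ then 1 else 0) else 0 else 0) =
        if v ∈ T then (if e ∈ M₁ ∧ Γ.att (e, b) = v then 1 else 0) +
          (if e ∈ M₂ ∧ Γ.att (e, b) = v then 1 else 0) else 0 := fun e b => by
      by_cases hv : Γ.att (e, b) = v
      · simp [hv]
      · simp [hv]
    simp only [h1, flow]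
    by_cases hv : v ∈ T
    · simp only [hv, if_true]
      have h2 := h.deg_add_cast v
      rw [deg_eq_sum, deg_eq_sum] at h2
      push_cast at h2
      simp only [Fintype.sum_bool] at h2
      have h3 : (∑ s, if Γ.ext s = v then if s ∈ nodes Γ n T then (1 : ZMod 2) else 0 else 0) =
          if ∃ i : Fin k, i.val < n ∧ Γ.ext i = v then 1 else 0 := by
        by_cases hs : ∃ s, Γ.ext s = v
        · obtain ⟨s, rfl⟩ := hs
          simp only [Γ.ext_injective.eq_iff, Finset.sum_ite_eq', Finset.mem_univ, if_true,
            mem_nodes, hv, and_true, exists_eq_right]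
        · push Not at hs
          simp [hs]
      rw [h3, ← h2]
      simp only [Finset.sum_add_distrib]
      have : ∀ a b c d : ZMod 2, a + b + (c + d) + (a + c + (b + d)) = 0 := by decide
      exact this _ _ _ _
    · simp only [hv, if_false, add_zero, Finset.sum_const_zero, zero_add]
      refine Finset.sum_eq_zero fun s _ => ?_
      split_ifs with h1 h2
      · exact absurd (h1 ▸ (mem_nodes.1 h2).2) hv
      · rfl
      · rfl

/-- The flow through a closed set is the coboundary of a function on the faces. The potential
therefore changes only on crossing the flow: it is constant around a vertex and across an edge
carrying none, and at infinity it jumps exactly at the nodes of `T`. -/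
theorem exists_face_potential (h : Γ.Superposed n x₁ x₂ M₁ M₂) {T : Finset Γ.V}
    (hT : Γ.IsClosed (M₁ ∪ M₂) T) :
    ∃ ψ : (Γ.E ⊕ Fin k) × Bool → ZMod 2,
      (∀ d d', closeUp Γ.att Γ.ext d = closeUp Γ.att Γ.ext d' →
        (∀ d'', closeUp Γ.att Γ.ext d'' = closeUp Γ.att Γ.ext d → flow Γ n M₁ M₂ T d'' = 0) →
          ψ d = ψ d') ∧
      (∀ d, flow Γ n M₁ M₂ T d = 0 → ψ (flipHalf _ d) = ψ d) ∧
      ∀ j : Fin k, ψ (Sum.inr (finRotate k j), true) =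
        ψ (Sum.inr j, true) + if j ∈ nodes Γ n T then 1 else 0 := by
  obtain ⟨ρ, hρ, hinf⟩ := Γ.plane
  rw [isPlaneRotation_iff] at hρ
  obtain ⟨hcyc, hs⟩ := hρ
  have hα : ∀ α ∈ invFun (flipHalf (Γ.E ⊕ Fin k)), ∑ d, α d * flow Γ n M₁ M₂ T d = 0 := by
    intro α hα
    rw [Fintype.sum_prod_type]
    refine Finset.sum_eq_zero fun e _ => ?_
    rw [Fintype.sum_bool, show α (e, true) = α (e, false) from hα (e, false)]
    have : flow Γ n M₁ M₂ T (e, true) = flow Γ n M₁ M₂ T (e, false) := by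
      cases e <;> rfl
    rw [this]
    exact CharTwo.add_self_eq_zero _
  have hβ : ∀ β ∈ invFun ρ, ∑ d, β d * flow Γ n M₁ M₂ T d = 0 := by
    intro β hβ
    rw [← Finset.sum_fiberwise _ (closeUp Γ.att Γ.ext)]
    refine Finset.sum_eq_zero fun v _ => ?_
    by_cases hv : ∃ d, closeUp Γ.att Γ.ext d = v
    · obtain ⟨d, rfl⟩ := hv
      rw [Finset.sum_congr rfl fun d' hd' => by
        rw [eq_of_sameCycle hβ ((hcyc _ _).2 (Finset.mem_filter.1 hd').2)], ← Finset.mul_sum,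
        Finset.sum_filter, h.sum_flow_eq_zero hT, mul_zero]
    · push Not at hv
      simp [hv]
  obtain ⟨ψ, hψ, hz⟩ := hs.exists_potential (flow Γ n M₁ M₂ T) hα hβ
  refine ⟨ψ, fun d d' hd h0 => ?_, fun d hd => ?_, fun j => ?_⟩
  · obtain ⟨m, rfl⟩ := ((hcyc d d').2 hd).exists_nat_pow_eq
    clear hd
    induction m with
    | zero => rfl
    | succ m ih =>
      rw [ih, pow_succ', Perm.mul_apply]
      have := hz ((ρ ^ m) d)
      rw [h0 _ ((hcyc _ _).1 (Perm.sameCycle_pow_left.2 (Perm.SameCycle.refl ρ d)))] at this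
      exact sub_eq_zero.1 this.symm
  · have h1 := hz d
    rw [hd] at h1
    have h2 := hψ (flipHalf _ d)
    rw [Perm.mul_apply] at h2
    have h3 : flipHalf (Γ.E ⊕ Fin k) (flipHalf _ d) = d := by
      rcases d with ⟨e, b⟩; simp [flipHalf]
    rw [h3] at h2
    rw [← h2]
    exact (sub_eq_zero.1 h1.symm).symm
  · have h1 := hz (Sum.inr j, true)
    rw [hinf j, flow] at h1
    rw [h1]
    have : ∀ a b : ZMod 2, b = a + (a - b) := by decide
    exact this _ _

/-- A discrete Jordan curve argument. The path from `i` to `j`, closed through infinity, separates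
the nodes strictly between them from the other ones, so components starting between stay between.
Their union is closed and contains an even number of nodes. -/
theorem even_between (h : Γ.Superposed n x₁ x₂ M₁ M₂) {i j : Fin k} (hij : i < j)
    (hn : nodes Γ n (Γ.component (M₁ ∪ M₂) (Γ.ext i)) = {i, j}) :
    Even (j.val - i.val - 1) := by
  set T := Γ.component (M₁ ∪ M₂) (Γ.ext i) with hTdef
  have hT : Γ.IsClosed (M₁ ∪ M₂) T := isClosed_component _ _
  obtain ⟨ψ, hψ1, hψ2, hψ3⟩ := h.exists_face_potential hT
  have hjn : j.val < n ∧ Γ.ext j ∈ T := by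
    rw [← mem_nodes, hn]; simp
  -- The jump at a node appears in the value at the next one, whence the half-open interval. The end
  -- `j` is later excluded because it lies in `T`.
  have hinf : ∀ t (ht : t < k), ψ (Sum.inr ⟨t, ht⟩, true) =
      ψ (Sum.inr ⟨0, by omega⟩, true) + if i.val < t ∧ t ≤ j.val then 1 else 0 := fun t => by
    induction t with
    | zero => intro ht; simp
    | succ t ih =>
      intro ht
      have h1 := hψ3 ⟨t, by omega⟩
      obtain ⟨k, rfl⟩ : ∃ k', k = k' + 1 := ⟨k - 1, by omega⟩
      rw [finRotate_of_lt (by omega), ih, hn] at h1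
      rw [h1, add_assoc]
      congr 1
      simp only [Finset.mem_insert, Finset.mem_singleton, Fin.ext_iff]
      have hij' : i.val < j.val := hij
      by_cases h1 : t = i.val
      · rw [if_neg (by omega), if_pos (by omega), if_pos (by omega)]; rfl
      · by_cases h2 : t = j.val
        · rw [if_pos (by omega), if_pos (by omega), if_neg (by omega)]; rfl
        · rw [if_neg (c := t = i.val ∨ t = j.val) (by omega), add_zero]
          exact if_congr (by omega) rfl rfl
  have hoff : ∀ d v, closeUp Γ.att Γ.ext d = some v → v ∉ T → flow Γ n M₁ M₂ T d = 0 := by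
    rintro ⟨e | s, b⟩ v hd hv
    · rw [flow_inl hT]
      obtain rfl : Γ.att (e, b) = v := Option.some.inj hd
      exact if_neg hv
    · cases b
      · obtain rfl : Γ.ext s = v := Option.some.inj hd
        exact if_neg fun h => hv (mem_nodes.1 h).2
      · cases hd
  -- A walk that starts outside `T` never enters `T`, so it meets no flow and the potential is
  -- constant along it.
  have hwalk : ∀ v w, (Γ.edgeGraph (M₁ ∪ M₂)).Reachable v w → v ∉ T → ∀ d d',
      closeUp Γ.att Γ.ext d = some v → closeUp Γ.att Γ.ext d' = some w → ψ d = ψ d' := by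
    rintro v w ⟨p⟩
    induction p with
    | nil => 
      intro hv d d' hd hd'
      exact hψ1 d d' (hd.trans hd'.symm) fun d'' hd'' => hoff d'' _ (hd''.trans hd) hv
    | @cons a b c hadj p ih =>
      intro hv d d' hd hd'
      obtain ⟨-, e, he, β, rfl, rfl⟩ := hadj
      have hv' : Γ.att (e, !β) ∉ T := by rwa [hT e he, ← hT e he β]
      rw [← ih hv' (Sum.inl e, !β) d' rfl hd',
        hψ1 d (Sum.inl e, β) hd fun d'' hd'' => hoff d'' _ (hd''.trans hd) hv]
      exact (hψ2 (Sum.inl e, β) (hoff _ _ rfl hv)).symm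
  set S : Finset Γ.V := Finset.univ.filter fun v =>
    ∃ t : Fin k, i < t ∧ t < j ∧ (Γ.edgeGraph (M₁ ∪ M₂)).Reachable (Γ.ext t) v with hS
  have hSc : Γ.IsClosed (M₁ ∪ M₂) S := isClosed_of_reachable fun v w hvw hv => by
    obtain ⟨t, h1, h2, h3⟩ := (Finset.mem_filter.1 hv).2
    exact Finset.mem_filter.2 ⟨Finset.mem_univ _, t, h1, h2, h3.trans hvw⟩
  have hnotT : ∀ t : Fin k, i < t → t < j → Γ.ext t ∉ T := fun t h1 h2 ht => by
    have : t ∈ nodes Γ n T := mem_nodes.2 ⟨lt_trans (Fin.lt_def.1 h2) hjn.1, ht⟩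
    rw [hn, Finset.mem_insert, Finset.mem_singleton] at this
    rcases this with rfl | rfl
    · exact lt_irrefl _ h1
    · exact lt_irrefl _ h2
  have hnodes : nodes Γ n S = Finset.Ioo i j := by
    ext s
    rw [mem_nodes, Finset.mem_Ioo, hS, Finset.mem_filter]
    constructor
    · rintro ⟨hs, -, t, h1, h2, h3⟩
      have htT := hnotT t h1 h2
      have hsT : Γ.ext s ∉ T := fun hs' =>
        htT (mem_component.2 ((mem_component.1 hs').trans h3.symm))
      have e1 := hwalk _ _ h3 htT (Sum.inr t, false) (Sum.inr s, false) rfl rfl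
      have e2 := hψ2 (Sum.inr t, false) (hoff _ _ rfl htT)
      have e3 := hψ2 (Sum.inr s, false) (hoff _ _ rfl hsT)
      have e4 : ψ (Sum.inr t, true) = ψ (Sum.inr s, true) := e2.trans (e1.trans e3.symm)
      rw [hinf t.val t.2, hinf s.val s.2, if_pos ⟨h1, le_of_lt h2⟩] at e4
      by_cases hc : i.val < s.val ∧ s.val ≤ j.val
      · refine ⟨hc.1, lt_of_le_of_ne hc.2 ?_⟩
        rintro rfl
        exact hsT hjn.2
      · rw [if_neg hc, add_right_inj] at e4
        exact absurd e4 (by decide)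
    · rintro ⟨h1, h2⟩
      exact ⟨lt_trans (Fin.lt_def.1 h2) hjn.1, Finset.mem_univ _, s, h1, h2, SimpleGraph.Reachable.refl _⟩
  have := h.even_card_nodes hSc
  rwa [hnodes, Fin.card_Ioo] at this

/-- Along a component of the superposition, nodes of opposite parity are joined. -/
theorem exists_partner (h : Γ.Superposed n x₁ x₂ M₁ M₂) {i : Fin k} (hi : i.val < n) :
    ∃ j, nodes Γ n (Γ.component (M₁ ∪ M₂) (Γ.ext i)) = {i, j} ∧ j ≠ i ∧
      (-1 : ℂ) ^ j.val = -(-1) ^ i.val := by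
  obtain ⟨j, hne, hn⟩ := h.exists_nodes_eq hi
  refine ⟨j, hn, hne, ?_⟩
  have hj : j.val < n ∧ Γ.ext j ∈ Γ.component (M₁ ∪ M₂) (Γ.ext i) := by
    rw [← mem_nodes, hn]; simp
  have key : ∀ a b : ℕ, a < b → Even (b - a - 1) → (-1 : ℂ) ^ b = -(-1) ^ a := fun a b hab hev => by
    obtain ⟨c, rfl⟩ : ∃ c, b = a + (c + 1) := ⟨b - a - 1, by omega⟩
    have : Even c := by convert hev using 1; omega
    rw [pow_add, pow_succ, this.neg_one_pow]
    ring
  rcases lt_or_gt_of_ne hne with hlt | hlt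
  · rw [← component_eq hj.2, Finset.pair_comm] at hn
    rw [key _ _ hlt (h.even_between hlt hn), neg_neg]
  · exact key _ _ hlt (h.even_between hlt hn)

end Superposed

/-! ### Exchange of two matchings on a closed set and the matchgate identity -/

/-- The edge set that agrees with `M'` on `T` and with `M` outside `T`. -/
noncomputable def swapOn (T : Finset Γ.V) (M M' : Finset Γ.E) : Finset Γ.E :=
  Finset.univ.filter fun e => if Γ.att (e, false) ∈ T then e ∈ M' else e ∈ M

theorem mem_swapOn {T : Finset Γ.V} {M M' : Finset Γ.E} {e : Γ.E} :
    e ∈ swapOn T M M' ↔ if Γ.att (e, false) ∈ T then e ∈ M' else e ∈ M := by simp [swapOn]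

theorem swapOn_swapOn (T : Finset Γ.V) (M M' : Finset Γ.E) :
    swapOn T (swapOn T M M') (swapOn T M' M) = M := by
  ext e
  simp only [mem_swapOn]
  split_ifs <;> rfl

theorem swapOn_union_swapOn (T : Finset Γ.V) (M M' : Finset Γ.E) :
    swapOn T M M' ∪ swapOn T M' M = M ∪ M' := by
  ext e
  simp only [Finset.mem_union, mem_swapOn]
  split_ifs <;> tauto

theorem prod_swapOn (T : Finset Γ.V) (M M' : Finset Γ.E) (w : Γ.E → ℂ) :
    (∏ e ∈ swapOn T M M', w e) * ∏ e ∈ swapOn T M' M, w e =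
      (∏ e ∈ M, w e) * ∏ e ∈ M', w e := by
  have h : ∀ S : Finset Γ.E, ∏ e ∈ S, w e = ∏ e, if e ∈ S then w e else 1 := fun S => by
    rw [Finset.prod_ite_mem, Finset.univ_inter]
  rw [h, h, h M, h M', ← Finset.prod_mul_distrib, ← Finset.prod_mul_distrib]
  refine Finset.prod_congr rfl fun e _ => ?_
  simp only [mem_swapOn]
  split_ifs <;> ring

theorem deg_swapOn {T : Finset Γ.V} {M M' : Finset Γ.E} (hT : Γ.IsClosed (M ∪ M') T) (v : Γ.V) :
    Γ.deg (swapOn T M M') v = if v ∈ T then Γ.deg M' v else Γ.deg M v := by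
  have : ∀ h : Γ.E × Bool, (h.1 ∈ swapOn T M M' ∧ Γ.att h = v) ↔
      if v ∈ T then h.1 ∈ M' ∧ Γ.att h = v else h.1 ∈ M ∧ Γ.att h = v := by
    rintro ⟨e, b⟩
    rw [mem_swapOn]
    by_cases he : e ∈ M ∪ M'
    · have := hT e he b
      by_cases hv : Γ.att (e, b) = v
      · rw [hv] at this
        simp only [hv, and_true, ← this]
      · simp [hv]
    · rw [Finset.mem_union, not_or] at he
      simp [he]
  rw [deg, Finset.filter_congr fun h _ => this h]
  split_ifs <;> rfl

theorem isPerfectMatching_swapOn {T : Finset Γ.V} {M M' : Finset Γ.E} {x x' y : Fin k → Bool}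
    (hT : Γ.IsClosed (M ∪ M') T) (hM : Γ.IsPerfectMatching x M)
    (hM' : Γ.IsPerfectMatching x' M') (h : ∀ i, Γ.ext i ∈ T → y i = x' i)
    (h' : ∀ i, Γ.ext i ∉ T → y i = x i) : Γ.IsPerfectMatching y (swapOn T M M') := by
  intro v
  change Γ.deg (swapOn T M M') v = _
  rw [deg_swapOn hT]
  split_ifs with hv h1 h1
  · have e : Γ.deg M' v = _ := hM' v
    obtain ⟨j, rfl, hj⟩ := h1
    rw [e, if_pos ⟨j, rfl, by rw [← h j hv, hj]⟩]
  · have e : Γ.deg M' v = _ := hM' v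
    rw [e, if_neg]
    rintro ⟨j, rfl, hj⟩
    exact h1 ⟨j, rfl, by rw [h j hv, hj]⟩
  · have e : Γ.deg M v = _ := hM v
    obtain ⟨j, rfl, hj⟩ := h1
    rw [e, if_pos ⟨j, rfl, by rw [← h' j hv, hj]⟩]
  · have e : Γ.deg M v = _ := hM v
    rw [e, if_neg]
    rintro ⟨j, rfl, hj⟩
    exact h1 ⟨j, rfl, by rw [h' j hv, hj]⟩

/-- The string `α` with the bit at `j` flipped. -/
def flipBit (α : Fin k → Bool) (j : Fin k) : Fin k → Bool := fun i => xor (α i) (decide (i = j))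

/-- The string `α` with the first `n` bits flipped. -/
def flipFirst (n : ℕ) (α : Fin k → Bool) : Fin k → Bool :=
  fun i => xor (α i) (decide (i.val < n))

/-- The matchgate identity. -/
theorem sum_signature_mul_signature (Γ : Matchgate k) (n : ℕ) (α : Fin k → Bool) :
    ∑ j ∈ Finset.univ.filter fun j : Fin k => j.val < n,
      (-1 : ℂ) ^ j.val *
        (Γ.signature (flipBit α j) * Γ.signature (flipBit (flipFirst n α) j)) = 0 := by
  set s : Finset (Fin k × Finset Γ.E × Finset Γ.E) := Finset.univ.filter fun p =>
    p.1.val < n ∧ Γ.IsPerfectMatching (flipBit α p.1) p.2.1 ∧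
      Γ.IsPerfectMatching (flipBit (flipFirst n α) p.1) p.2.2 with hs
  have hsum : ∑ p ∈ s, (-1 : ℂ) ^ p.1.val *
      ((∏ e ∈ p.2.1, Γ.weight e) * ∏ e ∈ p.2.2, Γ.weight e) = 0 := by
    have hsup : ∀ p ∈ s, p.1.val < n ∧ Γ.Superposed n (flipBit α p.1)
        (flipBit (flipFirst n α) p.1) p.2.1 p.2.2 := fun p hp => by
      obtain ⟨h1, h2, h3⟩ := (Finset.mem_filter.1 hp).2
      refine ⟨h1, h2, h3, fun i => ?_⟩
      simp only [flipBit, flipFirst]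
      rw [Bool.xor_assoc, Bool.xor_assoc, Bool.xor_comm (decide (i = p.1))]
    have hex : ∀ p : Fin k × Finset Γ.E × Finset Γ.E, ∃ j, p ∈ s →
        Superposed.nodes Γ n (Γ.component (p.2.1 ∪ p.2.2) (Γ.ext p.1)) = {p.1, j} ∧ j ≠ p.1 ∧
          (-1 : ℂ) ^ j.val = -(-1) ^ p.1.val := fun p => by
      by_cases hp : p ∈ s
      · obtain ⟨j, hj⟩ := (hsup p hp).2.exists_partner (hsup p hp).1
        exact ⟨j, fun _ => hj⟩
      · exact ⟨p.1, fun h => absurd h hp⟩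
    choose f hf using hex
    have hf1 := fun p hp => (hf p hp).1
    have hf2 := fun p hp => (hf p hp).2.1
    have hf3 := fun p hp => (hf p hp).2.2
    set T : Fin k × Finset Γ.E × Finset Γ.E → Finset Γ.V := fun p =>
      Γ.component (p.2.1 ∪ p.2.2) (Γ.ext p.1) with hT
    -- The sign-reversing map: the flipped bit moves to the other end of the path and the two
    -- matchings are exchanged along it. The union of the matchings, hence the path, does not
    -- change, so the map is an involution.
    set g : Fin k × Finset Γ.E × Finset Γ.E → Fin k × Finset Γ.E × Finset Γ.E := fun p =>
      (f p, swapOn (T p) p.2.1 p.2.2, swapOn (T p) p.2.2 p.2.1) with hg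
    have hfn : ∀ p ∈ s, (f p).val < n ∧ Γ.ext (f p) ∈ T p := fun p hp => by
      rw [← Superposed.mem_nodes, hf1 p hp]; simp
    have hTg : ∀ p ∈ s, T (g p) = T p := fun p hp => by
      simp only [hT, hg, swapOn_union_swapOn]
      exact component_eq (hfn p hp).2
    have hgs : ∀ p ∈ s, g p ∈ s := fun p hp => by
      have hcl : Γ.IsClosed (p.2.1 ∪ p.2.2) (T p) := isClosed_component _ _
      have hS := (hsup p hp).2
      -- Inside the component, the nodes among the first `n` are just the two ends of the path.
      -- Flipping the first `n` bits is there the same as flipping these two.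
      have hin : ∀ i, Γ.ext i ∈ T p →
          (decide (i.val < n) = xor (decide (i = p.1)) (decide (i = f p))) := fun i hi => by
        have := @Superposed.mem_nodes _ Γ n (T p) i
        rw [hf1 p hp] at this
        have hne := hf2 p hp
        simp only [Finset.mem_insert, Finset.mem_singleton, hi, and_true] at this
        rw [Bool.eq_iff_iff, decide_eq_true_iff, ← this]
        by_cases h1 : i = p.1
        · subst h1; simp [hne.symm]
        · simp [h1]
      have hout : ∀ i, Γ.ext i ∉ T p → i ≠ p.1 ∧ i ≠ f p := fun i hi =>
        ⟨by rintro rfl; exact hi (self_mem_component _ _), by rintro rfl; exact hi (hfn p hp).2⟩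
      refine Finset.mem_filter.2 ⟨Finset.mem_univ _, (hfn p hp).1,
        isPerfectMatching_swapOn hcl hS.left hS.right (fun i hi => ?_) fun i hi => ?_,
        isPerfectMatching_swapOn (by rwa [Finset.union_comm]) hS.right hS.left
          (fun i hi => ?_) fun i hi => ?_⟩
      · simp only [flipBit, flipFirst, hin i hi]
        generalize α i = a, decide (i = p.1) = b, decide (i = f p) = c
        revert a b c; decide
      · simp [flipBit, (hout i hi).1, show i ≠ (g p).1 from (hout i hi).2]
      · simp only [flipBit, flipFirst, hin i hi]
        generalize α i = a, decide (i = p.1) = b, decide (i = f p) = c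
        revert a b c; decide
      · simp [flipBit, (hout i hi).1, show i ≠ (g p).1 from (hout i hi).2]
    refine Finset.sum_involution (fun p _ => g p) (fun p hp => ?_) (fun p hp _ h => ?_)
      hgs fun p hp => ?_
    · simp only [hg, prod_swapOn, hf3 p hp]
      ring
    · exact hf2 p hp (congrArg Prod.fst h)
    · have h1 := hf1 (g p) (hgs p hp)
      have h2 := hf2 (g p) (hgs p hp)
      have h3 : Superposed.nodes Γ n (T (g p)) = {(g p).1, f (g p)} := h1
      rw [hTg p hp, show Superposed.nodes Γ n (T p) = _ from hf1 p hp] at h3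
      have h4 : f (g p) = p.1 := by
        have : f (g p) ∈ ({p.1, f p} : Finset (Fin k)) := by rw [h3]; simp
        rw [Finset.mem_insert, Finset.mem_singleton] at this
        exact this.resolve_right h2
      have h5 : g (g p) = (f (g p), swapOn (T (g p)) (g p).2.1 (g p).2.2,
        swapOn (T (g p)) (g p).2.2 (g p).2.1) := rfl
      rw [h5, h4, hTg p hp]
      simp only [hg, swapOn_swapOn]
  rw [← hsum, hs, Finset.sum_filter, Finset.sum_filter, Fintype.sum_prod_type]
  refine Finset.sum_congr rfl fun j _ => ?_
  rw [signature, signature]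
  split_ifs with hj
  · rw [Fintype.sum_prod_type, Finset.sum_mul_sum, Finset.mul_sum]
    refine Finset.sum_congr rfl fun M₁ _ => ?_
    rw [Finset.mul_sum]
    refine Finset.sum_congr rfl fun M₂ _ => ?_
    by_cases h1 : Γ.IsPerfectMatching (flipBit α j) M₁ <;>
      by_cases h2 : Γ.IsPerfectMatching (flipBit (flipFirst n α) j) M₂ <;> simp [h1, h2, hj]
  · simp [hj]

/-- A matching covers evenly many vertices, and those left out are the deleted external nodes. So
all weights in the support have the parity of the number of vertices. -/
theorem card_eq_of_signature_ne_zero {x : Fin k → Bool} (h : Γ.signature x ≠ 0) :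
    ∃ c, Fintype.card Γ.V = 2 * c + hammingWeight x := by
  obtain ⟨M, -, hM⟩ := Finset.exists_ne_zero_of_sum_ne_zero h
  have hM : Γ.IsPerfectMatching x M := by
    by_contra h0
    exact hM (if_neg h0)
  have h1 := IsClosed.sum_deg (Γ := Γ) (M := M) (T := Finset.univ) fun e _ b => by simp
  refine ⟨(M.filter fun e => Γ.att (e, false) ∈ Finset.univ).card, ?_⟩
  · rw [← h1, hammingWeight, ← Finset.card_image_of_injective _ Γ.ext_injective]
    rw [Finset.sum_congr rfl fun v _ => show Γ.deg M v = _ from hM v]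
    rw [← Finset.card_univ, ← Finset.card_filter_add_card_filter_not
      (p := fun v => ¬ ∃ j, Γ.ext j = v ∧ x j = true)]
    congr 1
    · rw [Finset.card_filter]
      exact Finset.sum_congr rfl fun v _ => by split_ifs <;> tauto
    · congr 1
      ext v
      simp [and_comm]

end Matchgate

/-! ### Symmetric matchgate signatures -/

theorem hammingWeight_eq_card {k : ℕ} (x : Fin k → Bool) (S : Finset ℕ)
    (hS : ∀ n ∈ S, n < k) (h : ∀ i, x i = true ↔ i.val ∈ S) : hammingWeight x = S.card := by
  rw [hammingWeight, ← Finset.card_map Fin.valEmbedding]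
  congr 1
  ext n
  simp only [Finset.mem_map, Finset.mem_filter, Finset.mem_univ, true_and, Fin.valEmbedding_apply, h]
  exact ⟨by rintro ⟨i, hi, rfl⟩; exact hi, fun hn => ⟨⟨n, hS n hn⟩, hn, rfl⟩⟩

/-- The value of a symmetric signature on strings with `n` ones. -/
noncomputable def weightValue {k : ℕ} (f : Sig k) (n : ℕ) : ℂ := f fun i => decide (i.val < n)

theorem hammingWeight_initial {k n : ℕ} (hn : n ≤ k) :
    hammingWeight (fun i : Fin k => decide (i.val < n)) = n := by
  rw [hammingWeight_eq_card _ (Finset.range n) (fun m hm => by simp at hm; omega)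
    fun i => by simp, Finset.card_range]

theorem IsSymmetric.eq_weightValue {k : ℕ} {f : Sig k} (h : IsSymmetric f) (x : Fin k → Bool) :
    f x = weightValue f (hammingWeight x) :=
  h _ _ (hammingWeight_initial (Nat.lt_succ_iff.1 (hammingWeight_lt x))).symm

theorem IsMatchgateSignature.parity {k : ℕ} {f : Sig k} (hM : IsMatchgateSignature f) {i j : ℕ}
    (hik : i ≤ k) (hjk : j ≤ k) (hi : weightValue f i ≠ 0) (hj : weightValue f j ≠ 0) :
    i % 2 = j % 2 := by
  obtain ⟨Γ, rfl⟩ := hM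
  obtain ⟨c, hc⟩ := Matchgate.card_eq_of_signature_ne_zero hi
  obtain ⟨d, hd⟩ := Matchgate.card_eq_of_signature_ne_zero hj
  rw [hammingWeight_initial hik] at hc
  rw [hammingWeight_initial hjk] at hd
  omega

/-- In the matchgate identity on `2 * l + 2` nodes the term of node 0 differs from the others, which
all have the same value up to sign. Their signs start with minus and are odd in number, so they sum
to -1. -/
theorem IsMatchgateSignature.mul_eq_mul {k : ℕ} {f : Sig k} (hM : IsMatchgateSignature f)
    (hsym : IsSymmetric f) {i l : ℕ} (h : i + (2 * l + 2) ≤ k) :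
    weightValue f i * weightValue f (i + (2 * l + 2)) =
      weightValue f (i + 2) * weightValue f (i + 2 * l) := by
  obtain ⟨Γ, rfl⟩ := hM
  set n := 2 * l + 2 with hn
  -- The string has a one at node 0 and `i` ones just after the first `n` nodes. Flipping bit 0
  -- gives weights `i` and `i + n`; flipping any other of the first `n` bits gives `i + 2` and `i +
  -- n - 2`.
  have key := Γ.sum_signature_mul_signature n
    fun i' => decide (i'.val = 0 ∨ (n ≤ i'.val ∧ i'.val < n + i))
  set F := weightValue Γ.signature
  have hterm : ∀ j : Fin k, j.val < n → Γ.signature (Matchgate.flipBit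
      (fun i' => decide (i'.val = 0 ∨ (n ≤ i'.val ∧ i'.val < n + i))) j) *
      Γ.signature (Matchgate.flipBit (Matchgate.flipFirst n
        fun i' => decide (i'.val = 0 ∨ (n ≤ i'.val ∧ i'.val < n + i))) j) =
      if j.val = 0 then F i * F (i + n) else F (i + 2) * F (i + 2 * l) := fun j hj => by
    rw [hsym.eq_weightValue, hsym.eq_weightValue]
    split_ifs with h0
    · congr 2
      · rw [hammingWeight_eq_card _ (Finset.Ico n (n + i)), Nat.card_Ico, Nat.add_sub_cancel_left]
        · intro m hm; rw [Finset.mem_Ico] at hm; omega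
        · intro i'
          simp only [Matchgate.flipBit, Finset.mem_Ico, Fin.ext_iff]
          by_cases h : i'.val = j.val
          · simp [h, h0]
          · simp [h]; omega
      · rw [hammingWeight_eq_card _ (Finset.range (i + n)), Finset.card_range]
        · intro m hm; rw [Finset.mem_range] at hm; omega
        · intro i'
          simp only [Matchgate.flipBit, Matchgate.flipFirst, Finset.mem_range, Fin.ext_iff]
          by_cases h : i'.val = j.val
          · simp [h, h0]; omega
          · by_cases h' : i'.val < n
            · simp [h, h']; omega
            · simp [h, h']; omega
    · congr 2
      · rw [hammingWeight_eq_card _ (insert 0 (insert j.val (Finset.Ico n (n + i)))),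
          Finset.card_insert_of_notMem, Finset.card_insert_of_notMem, Nat.card_Ico,
          Nat.add_sub_cancel_left]
        · simp; omega
        · simp; omega
        · intro m hm; simp only [Finset.mem_insert, Finset.mem_Ico] at hm; omega
        · intro i'
          simp only [Matchgate.flipBit, Finset.mem_Ico, Finset.mem_insert, Fin.ext_iff]
          by_cases h : i'.val = j.val
          · simp [h]; omega
          · simp [h]
      · rw [hammingWeight_eq_card _ (((Finset.range (i + n)).erase 0).erase j.val),
          Finset.card_erase_of_mem, Finset.card_erase_of_mem, Finset.card_range]
        · omega
        · simp; omega
        · simp; omega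
        · intro m hm; simp only [Finset.mem_erase, Finset.mem_range] at hm; omega
        · intro i'
          simp only [Matchgate.flipBit, Matchgate.flipFirst, Finset.mem_range, Finset.mem_erase,
            Fin.ext_iff]
          by_cases h : i'.val = j.val
          · simp [h, h0, hj]
          · by_cases h' : i'.val < n
            · simp [h, h']; omega
            · simp [h, h']; omega
  rw [Finset.sum_congr rfl fun j hj => by rw [hterm j (Finset.mem_filter.1 hj).2]] at key
  have hmap : (Finset.univ.filter fun j : Fin k => j.val < n).map Fin.valEmbedding =
      Finset.range n := by
    ext m
    simp only [Finset.mem_map, Finset.mem_filter, Finset.mem_univ, true_and,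
      Fin.valEmbedding_apply, Finset.mem_range]
    exact ⟨by rintro ⟨j, hj, rfl⟩; exact hj, fun hm => ⟨⟨m, by omega⟩, hm, rfl⟩⟩
  have hsum := Finset.sum_map (Finset.univ.filter fun j : Fin k => j.val < n) Fin.valEmbedding
    fun m => (-1 : ℂ) ^ m * if m = 0 then F i * F (i + n) else F (i + 2) * F (i + 2 * l)
  rw [hmap] at hsum
  simp only [Fin.valEmbedding_apply] at hsum
  rw [← hsum, hn, Finset.sum_range_succ'] at key
  simp only [Nat.succ_ne_zero, if_false, if_true, pow_zero, one_mul] at key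
  rw [← Finset.sum_mul, Finset.sum_congr rfl fun m _ => pow_succ (-1 : ℂ) m, ← Finset.sum_mul,
    neg_one_geom_sum, if_neg (by simp)] at key
  linear_combination key

/-! ### Rotations of bipartite graphs -/

theorem finRotate_pow_zero {n : ℕ} (i : Fin (n + 1)) : ((finRotate (n + 1)) ^ i.val) 0 = i := by
  obtain ⟨i, hi⟩ := i
  induction i with
  | zero => rfl
  | succ i ih =>
    change ((finRotate (n + 1)) ^ (i + 1)) 0 = _
    rw [pow_succ', Perm.mul_apply, show ((finRotate (n + 1)) ^ i) 0 = _ from ih (by omega)]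
    exact finRotate_of_lt (by omega)

theorem sameCycle_finRotate {n : ℕ} (i j : Fin n) : (finRotate n).SameCycle i j := by
  obtain ⟨n, rfl⟩ : ∃ n', n = n' + 1 := ⟨n - 1, by have := i.2; omega⟩
  have h : ∀ i : Fin (n + 1), (finRotate (n + 1)).SameCycle 0 i := fun i =>
    ⟨i.val, by simpa using finRotate_pow_zero i⟩
  exact (h i).symm.trans (h j)

/-- One long cycle is two shorter ones joined by the transposition of their starting points. Thus
placing gadgets side by side is a merge at infinity, and capping dangling edges is a split there. -/
theorem finRotate_finSumFinEquiv {a b : ℕ} (ha : 0 < a) (hb : 0 < b) (y : Fin a ⊕ Fin b) :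
    finRotate (a + b) (finSumFinEquiv y) =
      swap (Fin.castAdd b ⟨0, ha⟩) (Fin.natAdd a ⟨0, hb⟩)
        (finSumFinEquiv (Perm.sumCongr (finRotate a) (finRotate b) y)) := by
  obtain ⟨a, rfl⟩ : ∃ a', a = a' + 1 := ⟨a - 1, by omega⟩
  obtain ⟨b, rfl⟩ : ∃ b', b = b' + 1 := ⟨b - 1, by omega⟩
  rcases y with i | i
  · simp only [Perm.sumCongr_apply, Sum.map_inl, finSumFinEquiv_apply_left]
    by_cases hi : i.val < a
    · have h1 : finRotate (a + 1) i = ⟨i.val + 1, by omega⟩ := finRotate_of_lt hi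
      have h2 : finRotate (a + 1 + (b + 1)) (Fin.castAdd (b + 1) i) = ⟨i.val + 1, by omega⟩ :=
        finRotate_of_lt (n := a + 1 + b) (by omega)
      rw [h1, h2, swap_apply_of_ne_of_ne (Fin.ne_of_val_ne (by change i.val + 1 ≠ 0; omega))
        (Fin.ne_of_val_ne (by change i.val + 1 ≠ a + 1 + 0; omega))]
      rfl
    · have h1 : finRotate (a + 1) i = ⟨0, by omega⟩ := by
        have : i = ⟨a, by omega⟩ := Fin.ext (by have := i.2; change _ = a; omega)
        rw [this]; exact finRotate_last'
      have h2 : finRotate (a + 1 + (b + 1)) (Fin.castAdd (b + 1) i) = ⟨i.val + 1, by omega⟩ :=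
        finRotate_of_lt (n := a + 1 + b) (by omega)
      rw [h1, h2, swap_apply_left]
      exact Fin.ext (by simp; omega)
  · simp only [Perm.sumCongr_apply, Sum.map_inr, finSumFinEquiv_apply_right]
    by_cases hi : i.val < b
    · have h1 : finRotate (b + 1) i = ⟨i.val + 1, by omega⟩ := finRotate_of_lt hi
      have h2 : finRotate (a + 1 + (b + 1)) (Fin.natAdd (a + 1) i) =
          ⟨a + 1 + i.val + 1, by omega⟩ :=
        finRotate_of_lt (n := a + 1 + b) (by omega)
      rw [h1, h2, swap_apply_of_ne_of_ne
        (Fin.ne_of_val_ne (by change a + 1 + (i.val + 1) ≠ 0; omega))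
        (Fin.ne_of_val_ne (by change a + 1 + (i.val + 1) ≠ a + 1 + 0; omega))]
      rfl
    · have h1 : finRotate (b + 1) i = ⟨0, by omega⟩ := by
        have : i = ⟨b, by omega⟩ := Fin.ext (by have := i.2; change _ = b; omega)
        rw [this]; exact finRotate_last'
      have h2 : finRotate (a + 1 + (b + 1)) (Fin.natAdd (a + 1) i) = ⟨0, by omega⟩ := by
        have : Fin.natAdd (a + 1) i = ⟨a + 1 + b, by omega⟩ := Fin.ext (by simp; omega)
        rw [this]; exact finRotate_last' (n := a + 1 + b)
      rw [h1, h2, swap_apply_right]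
      exact Fin.ext (by simp)

/-- Two vertices joined by `k` parallel edges, turned in opposite senses: the product of the
rotations is the identity, so there are `k` faces. -/
theorem isSphere_finRotate {k : ℕ} (hk : 0 < k) : IsSphere (finRotate k)⁻¹ (finRotate k) := by
  have h1 : invFun (finRotate k)⁻¹ = invFun (finRotate k) := by
    ext φ
    exact ⟨fun h x => by rw [← h (finRotate k x), ← Perm.mul_apply, inv_mul_cancel]; rfl,
      fun h x => by rw [← h ((finRotate k)⁻¹ x), ← Perm.mul_apply, mul_inv_cancel]; rfl⟩
  have h2 : finrank (ZMod 2) (invFun (finRotate k)) = 1 := by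
    rw [← numCycles_eq_finrank, numCycles, Nat.card_eq_one_iff_unique]
    refine ⟨⟨fun a b => ?_⟩, ⟨Quotient.mk _ ⟨0, hk⟩⟩⟩
    induction a using Quotient.inductionOn
    induction b using Quotient.inductionOn
    exact Quotient.sound (sameCycle_finRotate _ _)
  have h3 : invFun (1 : Perm (Fin k)) = ⊤ := by
    ext φ
    simp [mem_invFun]
  unfold IsSphere
  rw [h1, inf_idem, h2, mul_inv_cancel, h3, finrank_top, finrank_fintype_fun_eq_card,
    Fintype.card_fin, Nat.card_eq_fintype_card, Fintype.card_fin]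
  omega

section Bipartite

variable {X : Type}

/-- The rotation of a bipartite graph that consists of the rotations `A` at the left vertices and
`B` at the right vertices. -/
def bipRotation (A B : Perm X) : Perm (X × Bool) where
  toFun p := ((bif p.2 then B else A) p.1, p.2)
  invFun p := ((bif p.2 then B else A)⁻¹ p.1, p.2)
  left_inv p := by simp
  right_inv p := by simp

theorem bipRotation_apply (A B : Perm X) (x : X) (b : Bool) :
    bipRotation A B (x, b) = ((bif b then B else A) x, b) := rfl

theorem bipRotation_pow_apply (A B : Perm X) (x : X) (b : Bool) (n : ℕ) :
    (bipRotation A B ^ n) (x, b) = (((bif b then B else A) ^ n) x, b) := by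
  induction n with
  | zero => rfl
  | succ n ih => rw [pow_succ', Perm.mul_apply, ih, bipRotation_apply, pow_succ', Perm.mul_apply]

variable [Fintype X]

theorem sameCycle_bipRotation (A B : Perm X) (x y : X) (b c : Bool) :
    (bipRotation A B).SameCycle (x, b) (y, c) ↔ b = c ∧ (bif b then B else A).SameCycle x y := by
  constructor
  · intro h
    obtain ⟨n, hn⟩ := h.exists_nat_pow_eq
    rw [bipRotation_pow_apply, Prod.mk.injEq] at hn
    exact ⟨hn.2, n, by simpa using hn.1⟩
  · rintro ⟨rfl, h⟩
    obtain ⟨n, hn⟩ := h.exists_nat_pow_eq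
    exact ⟨n, by rw [zpow_natCast, bipRotation_pow_apply, hn]⟩

/-- In a bipartite graph a face alternates between the two sides, so faces correspond to cycles of
`B * A` on edges. It suffices to work with permutations of edges instead of half-edges. -/
theorem IsSphere.bipRotation {A B : Perm X} (h : IsSphere A B) :
    IsSphere (flipHalf X) (bipRotation A B) := by
  have h1 : finrank (ZMod 2) (invFun (Holant.bipRotation A B)) =
      finrank (ZMod 2) (invFun A) + finrank (ZMod 2) (invFun B) := by
    rw [← finrank_eq_add_of_sum _ _ _ (mem_invFun_sumCongr A B)]
    refine finrank_eq_of_equiv ((Equiv.boolProdEquivSum X).symm.trans (Equiv.prodComm _ _)) _ _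
      fun φ => ?_
    rw [mem_invFun_sumCongr]
    exact ⟨fun h => ⟨fun x => h (x, false), fun x => h (x, true)⟩,
      fun h ⟨x, b⟩ => by cases b; exacts [h.1 x, h.2 x]⟩
  let e2 : invFun (Holant.bipRotation A B * flipHalf X) ≃ₗ[ZMod 2] invFun (B * A) :=
    { toFun := fun φ => ⟨fun x => φ.1 (x, true), fun x =>
        (φ.2 (A x, false)).trans (φ.2 (x, true))⟩
      invFun := fun ψ => ⟨fun p => bif p.2 then ψ.1 p.1 else ψ.1 (B p.1), fun ⟨x, b⟩ => by
        cases b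
        · rfl
        · exact ψ.2 x⟩
      left_inv := fun φ => Subtype.ext (funext fun ⟨x, b⟩ => by
        cases b
        · exact φ.2 (x, false)
        · rfl)
      right_inv := fun ψ => rfl
      map_add' := fun _ _ => rfl
      map_smul' := fun _ _ => rfl }
  let e3 : ↥(invFun (flipHalf X) ⊓ invFun (Holant.bipRotation A B)) ≃ₗ[ZMod 2]
      ↥(invFun A ⊓ invFun B) :=
    { toFun := fun φ => ⟨fun x => φ.1 (x, true),
        fun x => (φ.2.1 (A x, false)).trans ((φ.2.2 (x, false)).trans (φ.2.1 (x, true))),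
        fun x => φ.2.2 (x, true)⟩
      invFun := fun ψ => ⟨fun p => ψ.1 p.1, fun _ => rfl, fun ⟨x, b⟩ => by
        cases b
        · exact ψ.2.1 x
        · exact ψ.2.2 x⟩
      left_inv := fun φ => Subtype.ext (funext fun ⟨x, b⟩ => by
        cases b
        · exact φ.2.1 (x, false)
        · rfl)
      right_inv := fun ψ => rfl
      map_add' := fun _ _ => rfl
      map_smul' := fun _ _ => rfl }
  unfold IsSphere at h ⊢
  rw [finrank_invFun_flipHalf, h1, LinearEquiv.finrank_eq e2, LinearEquiv.finrank_eq e3,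
    Nat.card_prod, Nat.card_eq_fintype_card, Nat.card_eq_fintype_card, Fintype.card_bool]
  rw [Nat.card_eq_fintype_card] at h
  omega

end Bipartite

/-- The vertex at infinity counts as one more right vertex: every edge, dangling or not, then has
one left end and one right end. -/
theorem isPlaneOpenGraph_of_isSphere {N E : Type} [Fintype E] {m : ℕ} (att : E × Bool → N)
    (dang : Fin m → N) (A B : Perm (E ⊕ Fin m)) (hs : IsSphere A B)
    (hA : ∀ x y, A.SameCycle x y ↔ closeUp att dang (x, false) = closeUp att dang (y, false))
    (hB : ∀ x y, B.SameCycle x y ↔ closeUp att dang (x, true) = closeUp att dang (y, true))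
    (hAB : ∀ x y, closeUp att dang (x, false) ≠ closeUp att dang (y, true))
    (hinf : ∀ j, B (Sum.inr j) = Sum.inr (finRotate m j)) : IsPlaneOpenGraph att dang := by
  refine ⟨bipRotation A B, (isPlaneRotation_iff _ _).2 ⟨?_, hs.bipRotation⟩, fun j => ?_⟩
  · rintro ⟨x, b⟩ ⟨y, c⟩
    rw [sameCycle_bipRotation]
    cases b <;> cases c
    · simpa using hA x y
    · simpa using hAB x y
    · simpa using (hAB y x).symm
    · simpa using hB x y
  · rw [bipRotation_apply]
    exact congrArg (·, true) (hinf j)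

theorem sameCycle_map {X Y : Type*} [Finite Y] {σ : Perm X} {τ : Perm Y} (g : Y → X)
    (h : ∀ y, σ (g y) = g (τ y)) {y y' : Y} (hy : τ.SameCycle y y') :
    σ.SameCycle (g y) (g y') := by
  obtain ⟨n, rfl⟩ := hy.exists_nat_pow_eq
  refine ⟨n, ?_⟩
  rw [zpow_natCast]
  clear hy
  induction n with
  | zero => rfl
  | succ n ih => rw [pow_succ', Perm.mul_apply, ih, h, pow_succ', Perm.mul_apply]

theorem apply_eq_of_sameCycle {X T : Type*} [Finite X] {σ : Perm X} (f : X → T)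
    (h : ∀ x, f (σ x) = f x) {x y : X} (hxy : σ.SameCycle x y) : f x = f y := by
  obtain ⟨n, rfl⟩ := hxy.exists_nat_pow_eq
  clear hxy
  induction n with
  | zero => rfl
  | succ n ih => rw [pow_succ', Perm.mul_apply, h, ih]

/-! ### Assembling left-side gadgets -/

/-- A left-side gadget whose vertices are the elements of arbitrary finite types, enumerated in
some way. -/
structure Assembly {a b : ℕ} (L : Fin a → Signature) (R : Fin b → Signature) (m : ℕ) where
  U : Type
  W : Type
  nU : ℕ
  nW : ℕ
  eU : U ≃ Fin nU
  eW : W ≃ Fin nW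
  labU : U → Fin a
  labW : W → Fin b
  link : (Σ u, Fin (L (labU u)).arity) ≃ (Σ w, Fin (R (labW w)).arity) ⊕ Fin m

namespace Assembly

variable {a b : ℕ} {L : Fin a → Signature} {R : Fin b → Signature} {m n : ℕ}

instance (A : Assembly L R m) : Fintype A.U := Fintype.ofEquiv _ A.eU.symm
instance (A : Assembly L R m) : Fintype A.W := Fintype.ofEquiv _ A.eW.symm
instance (A : Assembly L R m) : DecidableEq A.W := A.eW.injective.decidableEq

/-- The normal edges. -/
abbrev Edge (A : Assembly L R m) : Type := Σ w, Fin (R (A.labW w)).arity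

/-- The clockwise rotation of the edges around the left vertices. -/
def leftRot (A : Assembly L R m) : Perm (A.Edge ⊕ Fin m) :=
  A.link.permCongr (Perm.sigmaCongrRight fun _ => (finRotate _)⁻¹)

/-- The counterclockwise rotation of the edges around the right vertices and infinity. -/
def rightRot (A : Assembly L R m) : Perm (A.Edge ⊕ Fin m) :=
  Perm.sumCongr (Perm.sigmaCongrRight fun _ => finRotate _) (finRotate m)

/-- The gadget is plane when the edges are arranged in the standard order around every vertex. -/
def Plane (A : Assembly L R m) : Prop := IsSphere A.leftRot A.rightRot

/-- The signature realized by the gadget. -/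
noncomputable def signature (A : Assembly L R m) : Sig m := fun x =>
  ∑ σ : A.Edge → Bool,
    (∏ u, (L (A.labU u)).fn fun i => Sum.elim σ x (A.link ⟨u, i⟩)) *
      ∏ w, (R (A.labW w)).fn fun i => σ ⟨w, i⟩

/-- The number of vertices. -/
def size (A : Assembly L R m) : ℕ := A.nU + A.nW

/-- The code of a slot. -/
def entry (A : Assembly L R m) : A.Edge ⊕ Fin m → ℕ × ℕ ⊕ ℕ :=
  Sum.map (fun s => ((A.eW s.1 : ℕ), (s.2 : ℕ))) (fun j => (j : ℕ))

/-- The code of a left vertex. -/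
def codeU (A : Assembly L R m) (u : A.U) : ℕ × List (ℕ × ℕ ⊕ ℕ) :=
  ((A.labU u : ℕ), List.ofFn fun i => A.entry (A.link ⟨u, i⟩))

/-- The description of the gadget as finite data. -/
def code (A : Assembly L R m) : List (ℕ × List (ℕ × ℕ ⊕ ℕ)) × List ℕ :=
  (List.ofFn fun u => A.codeU (A.eU.symm u), List.ofFn fun w => (A.labW (A.eW.symm w) : ℕ))

/-- The slots of the left vertices in the enumeration. -/
def slotU (A : Assembly L R m) :
    (Σ u : Fin A.nU, Fin (L (A.labU (A.eU.symm u))).arity) ≃ Σ u, Fin (L (A.labU u)).arity :=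
  Equiv.sigmaCongrLeft (β := fun u => Fin (L (A.labU u)).arity) A.eU.symm

/-- The slots of the right vertices in the enumeration. -/
def slotW (A : Assembly L R m) :
    (Σ w : Fin A.nW, Fin (R (A.labW (A.eW.symm w))).arity) ≃ A.Edge :=
  Equiv.sigmaCongrLeft (β := fun w => Fin (R (A.labW w)).arity) A.eW.symm

/-- The gadget with its vertices replaced by their numbers. -/
abbrev toLeftGadget (A : Assembly L R m) : LeftGadget L R m where
  nU := A.nU
  nW := A.nW
  labU := fun u => A.labU (A.eU.symm u)
  labW := fun w => A.labW (A.eW.symm w)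
  link := (A.slotU.trans A.link).trans (Equiv.sumCongr A.slotW.symm (Equiv.refl _))

theorem code_toLeftGadget (A : Assembly L R m) : A.toLeftGadget.code = A.code := by
  have h : ∀ s : A.Edge, (((A.slotW.symm s).1 : ℕ), ((A.slotW.symm s).2 : ℕ)) =
      ((A.eW s.1 : ℕ), (s.2 : ℕ)) := fun s => by
    obtain ⟨t, rfl⟩ := A.slotW.surjective s
    rw [Equiv.symm_apply_apply]
    obtain ⟨w, i⟩ := t
    change (_, _) = ((A.eW (A.eW.symm w) : ℕ), (i : ℕ))
    rw [Equiv.apply_symm_apply]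
  have h' : ∀ t : A.Edge ⊕ Fin m,
      Sum.map (fun s : A.toLeftGadget.Edge => ((s.1 : ℕ), (s.2 : ℕ))) (fun j : Fin m => (j : ℕ))
        (Sum.map A.slotW.symm id t) = A.entry t := fun t => by
    rcases t with s | j
    · exact congrArg Sum.inl (h s)
    · rfl
  refine Prod.ext ?_ rfl
  refine congrArg List.ofFn (funext fun u => Prod.ext rfl ?_)
  exact congrArg List.ofFn (funext fun i => h' _)

theorem signature_toLeftGadget (A : Assembly L R m) : A.toLeftGadget.signature = A.signature := by
  ext x
  unfold signature LeftGadget.signature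
  refine Fintype.sum_equiv (Equiv.arrowCongr A.slotW (Equiv.refl Bool)) _ _ fun σ => ?_
  congr 1
  · refine Fintype.prod_equiv A.eU.symm _ _ fun u => ?_
    refine congrArg (L (A.labU (A.eU.symm u))).fn (funext fun i => ?_)
    change Sum.elim σ x (Sum.map A.slotW.symm id (A.link ⟨A.eU.symm u, i⟩)) = _
    rcases A.link ⟨A.eU.symm u, i⟩ with s | j <;> rfl
  · refine Fintype.prod_equiv A.eW.symm _ _ fun w => ?_
    refine congrArg (R (A.labW (A.eW.symm w))).fn (funext fun i => ?_)
    exact congrArg σ (A.slotW.symm_apply_apply ⟨w, i⟩).symm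

theorem Plane.isPlanar {A : Assembly L R m} (h : A.Plane) : A.toLeftGadget.IsPlanar := by
  set e : A.Edge ⊕ Fin m ≃ A.toLeftGadget.Edge ⊕ Fin m :=
    Equiv.sumCongr A.slotW.symm (Equiv.refl _) with he
  have hl : ∀ x, closeUp A.toLeftGadget.att A.toLeftGadget.dang (e x, false) =
      some (Sum.inl (A.eU (A.link.symm x).1)) := fun x => by
    have key : (A.toLeftGadget.link.symm (e x)).1 = A.eU (A.link.symm x).1 := by
      change (A.slotU.symm (A.link.symm (e.symm (e x)))).1 = _
      rw [Equiv.symm_apply_apply]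
      obtain ⟨⟨u, i⟩, h⟩ := A.slotU.surjective (A.link.symm x)
      rw [← h, Equiv.symm_apply_apply]
      exact (A.eU.apply_symm_apply u).symm
    rcases x with s | j
    · exact congrArg (fun t => some (Sum.inl t)) key
    · exact congrArg (fun t => some (Sum.inl t)) key
  have hre : ∀ s, closeUp A.toLeftGadget.att A.toLeftGadget.dang (e (Sum.inl s), true) =
      some (Sum.inr (A.eW s.1)) := fun s => by
    obtain ⟨⟨w, i⟩, rfl⟩ := A.slotW.surjective s
    change some (Sum.inr (A.slotW.symm (A.slotW ⟨w, i⟩)).1) = _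
    rw [Equiv.symm_apply_apply]
    exact congrArg (fun t => some (Sum.inr t)) (A.eW.apply_symm_apply w).symm
  have hrd : ∀ j, closeUp A.toLeftGadget.att A.toLeftGadget.dang (e (Sum.inr j), true) = none :=
    fun j => rfl
  have hconj : ∀ (σ : Perm (A.Edge ⊕ Fin m)) (b : Bool),
      (∀ x y, σ.SameCycle x y ↔ closeUp A.toLeftGadget.att A.toLeftGadget.dang (e x, b) =
        closeUp A.toLeftGadget.att A.toLeftGadget.dang (e y, b)) →
      ∀ x y, (e.permCongr σ).SameCycle x y ↔
        closeUp A.toLeftGadget.att A.toLeftGadget.dang (x, b) =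
        closeUp A.toLeftGadget.att A.toLeftGadget.dang (y, b) := fun σ b hσ x y => by
    obtain ⟨x, rfl⟩ := e.surjective x
    obtain ⟨y, rfl⟩ := e.surjective y
    rw [← hσ]
    constructor
    · intro h
      simpa using sameCycle_map (σ := σ) e.symm (fun z => by simp [Equiv.permCongr_apply]) h
    · exact sameCycle_map e (fun z => by simp [Equiv.permCongr_apply])
  refine isPlaneOpenGraph_of_isSphere _ _ _ _ (h.permCongr e) (hconj _ _ fun x y => ?_)
    (hconj _ _ fun x y => ?_) (fun x y => ?_) fun j => ?_
  · rw [hl, hl, Option.some.injEq, Sum.inl.injEq, A.eU.injective.eq_iff]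
    constructor
    · refine apply_eq_of_sameCycle (fun x => (A.link.symm x).1) fun z => ?_
      simp [leftRot, Equiv.permCongr_apply]
    · intro hxy
      obtain ⟨⟨u, i⟩, rfl⟩ := A.link.surjective x
      obtain ⟨⟨v, j⟩, rfl⟩ := A.link.surjective y
      rw [Equiv.symm_apply_apply, Equiv.symm_apply_apply] at hxy
      obtain rfl : u = v := hxy
      exact sameCycle_map (τ := (finRotate _)⁻¹) (fun i => A.link ⟨u, i⟩)
        (fun i => by simp [leftRot, Equiv.permCongr_apply])
        (Perm.sameCycle_inv.2 (sameCycle_finRotate i j))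
  · constructor
    · refine apply_eq_of_sameCycle (fun x => closeUp A.toLeftGadget.att A.toLeftGadget.dang
        (e x, true)) fun z => ?_
      rcases z with ⟨w, i⟩ | j
      · change closeUp _ _ (e (Sum.inl ⟨w, finRotate _ i⟩), true) = _
        rw [hre, hre]
      · rfl
    · intro hxy
      rcases x with ⟨w, i⟩ | i <;> rcases y with ⟨w', j⟩ | j
      · rw [hre, hre, Option.some.injEq, Sum.inr.injEq, A.eW.injective.eq_iff] at hxy
        obtain rfl : w = w' := hxy
        exact sameCycle_map (τ := finRotate _) (fun i => (Sum.inl ⟨w, i⟩ : A.Edge ⊕ Fin m))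
          (fun i => rfl) (sameCycle_finRotate i j)
      · rw [hre, hrd] at hxy; cases hxy
      · rw [hre, hrd] at hxy; cases hxy
      · exact sameCycle_map (τ := finRotate _) (fun i => (Sum.inr i : A.Edge ⊕ Fin m))
          (fun i => rfl) (sameCycle_finRotate i j)
  · obtain ⟨x, rfl⟩ := e.surjective x
    obtain ⟨y, rfl⟩ := e.surjective y
    rw [hl]
    rcases y with s | j
    · rw [hre]; simp
    · rw [hrd]; simp
  · rfl

theorem leftRot_link (A : Assembly L R m) (u : A.U) (i) :
    A.leftRot (A.link ⟨u, i⟩) = A.link ⟨u, (finRotate _)⁻¹ i⟩ := by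
  rw [leftRot, Equiv.permCongr_apply, Equiv.symm_apply_apply]
  rfl

theorem permCongr_apply_apply {X Y : Type*} (e : X ≃ Y) (σ : Perm X) (x : X) :
    e.permCongr σ (e x) = e (σ x) := by
  rw [Equiv.permCongr_apply, Equiv.symm_apply_apply]

theorem signature_eq_sum (A : Assembly L R m) {T : Type*} [Fintype T] (e : T ≃ (A.Edge → Bool))
    (x : Fin m → Bool) : A.signature x = ∑ t,
      (∏ u, (L (A.labU u)).fn fun i => Sum.elim (e t) x (A.link ⟨u, i⟩)) *
        ∏ w, (R (A.labW w)).fn fun i => e t ⟨w, i⟩ :=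
  (Fintype.sum_equiv e _ _ fun _ => rfl).symm

/-! ### A single left vertex -/

instance (R : Fin b → Signature) : IsEmpty (Σ w : Empty, Fin (R (Empty.elim w)).arity) :=
  ⟨fun s => s.1.elim⟩

/-- The gadget that consists of one left vertex. -/
abbrev vertex (L : Fin a → Signature) (R : Fin b → Signature) (u : Fin a) :
    Assembly L R (L u).arity where
  U := Unit
  W := Empty
  nU := 1
  nW := 0
  eU := Equiv.ofUnique _ _
  eW := Equiv.equivOfIsEmpty _ _
  labU := fun _ => u
  labW := Empty.elim
  link := (Equiv.uniqueSigma fun _ : Unit => Fin (L u).arity).trans (Equiv.emptySum _ _).symm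

theorem vertex_plane {u : Fin a} (h : 0 < (L u).arity) : (vertex L R u).Plane := by
  have := (isSphere_finRotate h).permCongr
    (Equiv.emptySum (Σ w : Empty, Fin (R (Empty.elim w)).arity) (Fin (L u).arity)).symm
  refine (congrArg₂ IsSphere (Equiv.ext fun x => ?_) (Equiv.ext fun x => ?_)).mp this
  · rcases x with s | j
    · exact s.1.elim
    · rfl
  · rcases x with s | j
    · exact s.1.elim
    · rfl

theorem vertex_signature (u : Fin a) : (vertex L R u).signature = (L u).fn := by
  ext x
  unfold signature
  have : IsEmpty (vertex L R u).Edge := ⟨fun s => s.1.elim⟩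
  rw [Fintype.sum_unique]
  have h1 : ∀ F : (vertex L R u).U → ℂ, ∏ u, F u = F () := fun F =>
    Fintype.prod_unique (ι := Unit) F
  have h2 : ∀ F : (vertex L R u).W → ℂ, ∏ w, F w = 1 := fun F =>
    Finset.prod_eq_one fun w _ => w.elim
  exact (congrArg₂ (· * ·) (h1 _) (h2 _)).trans (mul_one _)

/-! ### Rotation of the dangling edges -/

/-- The gadget with its dangling edges renamed cyclically. -/
abbrev rotate (A : Assembly L R m) : Assembly L R m where
  __ := A
  link := A.link.trans (Equiv.sumCongr (Equiv.refl _) (finRotate m))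

theorem Plane.rotate {A : Assembly L R m} (h : A.Plane) : A.rotate.Plane := by
  have := h.permCongr (Equiv.sumCongr (Equiv.refl A.Edge) (finRotate m))
  refine (congrArg₂ IsSphere (Equiv.ext fun x => ?_) (Equiv.ext fun x => ?_)).mp this
  · rfl
  · rcases x with s | j
    · rfl
    · exact congrArg (fun i => Sum.inr (finRotate m i)) ((finRotate m).apply_symm_apply j)

theorem rotate_signature (A : Assembly L R m) (x : Fin m → Bool) :
    A.rotate.signature x = A.signature (x ∘ finRotate m) := by
  refine Finset.sum_congr rfl fun σ _ => ?_
  refine congrArg₂ _ (Finset.prod_congr rfl fun u _ => congrArg _ (funext fun i => ?_)) rfl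
  change Sum.elim σ x (Sum.map id (finRotate m) (A.link ⟨u, i⟩)) = _
  rcases A.link ⟨u, i⟩ with s | j <;> rfl

/-! ### Disjoint union -/

/-- Exchange of the two inner summands, with the dangling edges put side by side. -/
def unionEquiv {E F G : Type} (e : E ⊕ F ≃ G) (m n : ℕ) :
    (E ⊕ Fin m) ⊕ (F ⊕ Fin n) ≃ G ⊕ Fin (m + n) :=
  (Equiv.sumSumSumComm E (Fin m) F (Fin n)).trans (Equiv.sumCongr e finSumFinEquiv)

/-- Two gadgets side by side. -/
abbrev union (A : Assembly L R m) (B : Assembly L R n) : Assembly L R (m + n) where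
  U := A.U ⊕ B.U
  W := A.W ⊕ B.W
  nU := A.nU + B.nU
  nW := A.nW + B.nW
  eU := (Equiv.sumCongr A.eU B.eU).trans finSumFinEquiv
  eW := (Equiv.sumCongr A.eW B.eW).trans finSumFinEquiv
  labU := Sum.elim A.labU B.labU
  labW := Sum.elim A.labW B.labW
  link := ((Equiv.sumSigmaDistrib fun u => Fin (L (Sum.elim A.labU B.labU u)).arity).trans
    (Equiv.sumCongr A.link B.link)).trans (unionEquiv
      (Equiv.sumSigmaDistrib fun w => Fin (R (Sum.elim A.labW B.labW w)).arity).symm m n)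

/-- The darts of a union. -/
def unionDarts (A : Assembly L R m) (B : Assembly L R n) :
    (A.Edge ⊕ Fin m) ⊕ (B.Edge ⊕ Fin n) ≃ (A.union B).Edge ⊕ Fin (m + n) :=
  unionEquiv (Equiv.sumSigmaDistrib fun w => Fin (R (Sum.elim A.labW B.labW w)).arity).symm m n

theorem Plane.union {A : Assembly L R m} {B : Assembly L R n} (hA : A.Plane) (hB : B.Plane)
    (hm : 0 < m) (hn : 0 < n) : (A.union B).Plane := by
  classical
  set e := A.unionDarts B with he
  have h := (hA.sumCongr hB).permCongr e
  have h1 : (A.union B).leftRot = e.permCongr (Perm.sumCongr A.leftRot B.leftRot) := by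
    refine Equiv.ext fun x => ?_
    obtain ⟨⟨u | u, i⟩, rfl⟩ := (A.union B).link.surjective x
    · refine (leftRot_link (A.union B) (Sum.inl u) i).trans
        (Eq.trans ?_ (permCongr_apply_apply e _ (Sum.inl (A.link ⟨u, i⟩))).symm)
      exact congrArg (fun t => e (Sum.inl t)) (leftRot_link A u i).symm
    · refine (leftRot_link (A.union B) (Sum.inr u) i).trans
        (Eq.trans ?_ (permCongr_apply_apply e _ (Sum.inr (B.link ⟨u, i⟩))).symm)
      exact congrArg (fun t => e (Sum.inr t)) (leftRot_link B u i).symm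
  -- Each gadget brings its own vertex at infinity; the transposition of the two first dangling
  -- edges merges them.
  have h2 : (A.union B).rightRot = swap (Sum.inr (Fin.castAdd n ⟨0, hm⟩))
      (Sum.inr (Fin.natAdd m ⟨0, hn⟩)) *
        e.permCongr (Perm.sumCongr A.rightRot B.rightRot) := by
    refine Equiv.ext fun x => ?_
    obtain ⟨x, rfl⟩ := e.surjective x
    rw [Perm.mul_apply, Equiv.permCongr_apply, Equiv.symm_apply_apply]
    obtain (⟨w, i⟩ | j) | (⟨w, i⟩ | j) := x
    · exact (swap_apply_of_ne_of_ne Sum.inl_ne_inr Sum.inl_ne_inr).symm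
    · change Sum.inr (finRotate (m + n) (finSumFinEquiv (Sum.inl j))) =
        swap _ _ (Sum.inr (finSumFinEquiv (Perm.sumCongr (finRotate m) (finRotate n) (Sum.inl j))))
      rw [finRotate_finSumFinEquiv hm hn, Sum.inr_injective.map_swap]
    · exact (swap_apply_of_ne_of_ne Sum.inl_ne_inr Sum.inl_ne_inr).symm
    · change Sum.inr (finRotate (m + n) (finSumFinEquiv (Sum.inr j))) =
        swap _ _ (Sum.inr (finSumFinEquiv (Perm.sumCongr (finRotate m) (finRotate n) (Sum.inr j))))
      rw [finRotate_finSumFinEquiv hm hn, Sum.inr_injective.map_swap]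
  unfold Plane
  rw [h1, h2]
  refine h.merge ?_
  -- The indicator of the second gadget witnesses that the merged vertices lie in different
  -- components.
  refine ⟨fun x => Sum.elim (fun _ => 0) (fun _ => 1) (e.symm x),
    (mem_invFun_permCongr e _ _).2 ?_, (mem_invFun_permCongr e _ _).2 ?_, ?_⟩
  · rw [mem_invFun_sumCongr]
    exact ⟨fun x => by simp, fun x => by simp⟩
  · rw [mem_invFun_sumCongr]
    exact ⟨fun x => by simp, fun x => by simp⟩
  · have e1 : e.symm (Sum.inr (Fin.castAdd n ⟨0, hm⟩)) = Sum.inl (Sum.inr ⟨0, hm⟩) :=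
      e.symm_apply_eq.2 rfl
    have e2 : e.symm (Sum.inr (Fin.natAdd m ⟨0, hn⟩)) = Sum.inr (Sum.inr ⟨0, hn⟩) :=
      e.symm_apply_eq.2 rfl
    change Sum.elim (fun _ => 0) (fun _ => 1) (e.symm _) ≠
      Sum.elim (fun _ => 0) (fun _ => 1) (e.symm _)
    rw [e1, e2]
    exact zero_ne_one

theorem prod_sum_of_fintype {X Y : Type} [Fintype X] [Fintype Y] (I : Fintype (X ⊕ Y))
    (F : X ⊕ Y → ℂ) : (@Finset.univ _ I).prod F = (∏ x, F (Sum.inl x)) * ∏ y, F (Sum.inr y) := by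
  rw [← Fintype.prod_sum_type]
  exact Finset.prod_congr (by ext; simp) fun _ _ => rfl

theorem union_signature (A : Assembly L R m) (B : Assembly L R n) (x : Fin (m + n) → Bool) :
    (A.union B).signature x =
      A.signature (fun i => x (Fin.castAdd n i)) * B.signature (fun i => x (Fin.natAdd m i)) := by
  let e : ((A.union B).Edge → Bool) ≃ (A.Edge → Bool) × (B.Edge → Bool) :=
    (Equiv.arrowCongr (Equiv.sumSigmaDistrib fun w =>
      Fin (R (Sum.elim A.labW B.labW w)).arity) (Equiv.refl Bool)).trans
        (Equiv.sumArrowEquivProdArrow A.Edge B.Edge Bool)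
  rw [signature_eq_sum (A.union B) e.symm, signature, signature, Finset.sum_mul_sum,
    ← Fintype.sum_prod_type' (γ := ℂ)]
  refine Finset.sum_congr rfl fun t _ => ?_
  obtain ⟨σ, rfl⟩ := e.surjective t
  rw [Equiv.symm_apply_apply]
  refine (congrArg₂ (· * ·) (prod_sum_of_fintype _ _) (prod_sum_of_fintype _ _)).trans ((mul_mul_mul_comm _ _ _ _).trans ?_)
  refine congrArg₂ (· * ·) (congrArg₂ (· * ·) ?_ rfl) (congrArg₂ (· * ·) ?_ rfl)
  · refine Finset.prod_congr rfl fun u _ => congrArg (L (A.labU u)).fn (funext fun i => ?_)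
    change Sum.elim σ x (unionEquiv _ m n (Sum.inl (A.link ⟨u, i⟩))) = _
    rcases A.link ⟨u, i⟩ with s | j <;> rfl
  · refine Finset.prod_congr rfl fun u _ => congrArg (L (B.labU u)).fn (funext fun i => ?_)
    change Sum.elim σ x (unionEquiv _ m n (Sum.inr (B.link ⟨u, i⟩))) = _
    rcases B.link ⟨u, i⟩ with s | j <;> rfl

/-! ### Capping dangling edges by a right vertex -/

/-- The last dangling edges become the normal edges of a new vertex. -/
def capEquiv (E : Type) (m d : ℕ) : E ⊕ Fin (m + d) ≃ (E ⊕ Fin d) ⊕ Fin m :=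
  ((Equiv.sumCongr (Equiv.refl E) (finSumFinEquiv.symm.trans (Equiv.sumComm _ _))).trans
    (Equiv.sumAssoc E (Fin d) (Fin m)).symm)

/-- The slots of the right vertices after addition of a new vertex. -/
def capSlots (A : Assembly L R n) (w : Fin b) :
    A.Edge ⊕ Fin (R w).arity ≃
      Σ v : A.W ⊕ Unit, Fin (R (Sum.elim A.labW (fun _ => w) v)).arity :=
  (Equiv.sumCongr (Equiv.refl A.Edge)
    (Equiv.uniqueSigma fun _ : Unit => Fin (R w).arity).symm).trans
    (Equiv.sumSigmaDistrib fun v => Fin (R (Sum.elim A.labW (fun _ => w) v)).arity).symm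

/-- The gadget with its last dangling edges joined to a new right vertex. -/
abbrev cap (w : Fin b) (A : Assembly L R (m + (R w).arity)) : Assembly L R m where
  U := A.U
  W := A.W ⊕ Unit
  nU := A.nU
  nW := A.nW + 1
  eU := A.eU
  eW := (Equiv.sumCongr A.eW (Equiv.ofUnique Unit (Fin 1))).trans finSumFinEquiv
  labU := A.labU
  labW := Sum.elim A.labW fun _ => w
  link := A.link.trans ((capEquiv A.Edge m (R w).arity).trans
    (Equiv.sumCongr (A.capSlots w) (Equiv.refl _)))

theorem Plane.cap {w : Fin b} {A : Assembly L R (m + (R w).arity)} (h : A.Plane) (hm : 0 < m)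
    (hw : 0 < (R w).arity) : (cap w A).Plane := by
  classical
  set e := (capEquiv A.Edge m (R w).arity).trans (Equiv.sumCongr (A.capSlots w) (Equiv.refl (Fin m)))
    with he
  have hcyc : A.rightRot.SameCycle (Sum.inr (Fin.castAdd (R w).arity ⟨0, hm⟩))
      (Sum.inr (Fin.natAdd m ⟨0, hw⟩)) :=
    sameCycle_map (τ := finRotate _) (fun i => (Sum.inr i : A.Edge ⊕ Fin (m + (R w).arity)))
      (fun i => rfl) (sameCycle_finRotate _ _)
  -- The vertex at infinity is cut in two: one part keeps the remaining dangling edges, the other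
  -- becomes the new right vertex.
  have hsplit := IsSphere.split h (fun heq => by
    have := congrArg Fin.val (Sum.inr_injective heq)
    change 0 = m + 0 at this
    omega) hcyc
  have hl : (Assembly.cap w A).leftRot = e.permCongr A.leftRot := by
    refine Equiv.ext fun x => ?_
    obtain ⟨⟨u, i⟩, rfl⟩ := (Assembly.cap w A).link.surjective x
    refine (leftRot_link (Assembly.cap w A) u i).trans ?_
    refine Eq.trans ?_ (permCongr_apply_apply e _ (A.link ⟨u, i⟩)).symm
    exact congrArg e (leftRot_link A u i).symm
  unfold Plane
  rw [hl]
  refine (congrArg (IsSphere _) (Equiv.ext ?_)).mp (hsplit.permCongr e)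
  refine fun x => Eq.symm ?_
  obtain ⟨x, rfl⟩ := e.surjective x
  rw [Equiv.permCongr_apply, Equiv.symm_apply_apply, Perm.mul_apply]
  obtain ⟨v, i⟩ | j := x
  · change _ = e (swap _ _ (Sum.inl _))
    rw [swap_apply_of_ne_of_ne Sum.inl_ne_inr Sum.inl_ne_inr]
    rfl
  · obtain ⟨j, rfl⟩ := finSumFinEquiv.surjective j
    change _ = e (swap _ _ (Sum.inr (finRotate (m + (R w).arity) _)))
    rw [finRotate_finSumFinEquiv hm hw, ← Sum.inr_injective.map_swap, swap_apply_self]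
    rcases j with j | j
    · have h1 : ∀ j, e (Sum.inr (finSumFinEquiv (Sum.inl j))) = Sum.inr j := fun j => by
        simp only [he, capEquiv, Equiv.trans_apply, Equiv.sumCongr_apply, Sum.map_inr,
          Equiv.symm_apply_apply]
        rfl
      change _ = e (Sum.inr (finSumFinEquiv (Sum.inl (finRotate m j))))
      rw [h1, h1]
      rfl
    · have h1 : ∀ j, e (Sum.inr (finSumFinEquiv (Sum.inr j))) = Sum.inl ⟨Sum.inr (), j⟩ :=
        fun j => by
          simp only [he, capEquiv, Equiv.trans_apply, Equiv.sumCongr_apply, Sum.map_inr,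
            Equiv.symm_apply_apply]
          rfl
      change _ = e (Sum.inr (finSumFinEquiv (Sum.inr (finRotate (R w).arity j))))
      rw [h1, h1]
      rfl

theorem cap_signature (w : Fin b) (A : Assembly L R (m + (R w).arity)) (x : Fin m → Bool) :
    (cap w A).signature x = ∑ y, A.signature (Fin.append x y) * (R w).fn y := by
  let e : ((cap w A).Edge → Bool) ≃ (A.Edge → Bool) × (Fin (R w).arity → Bool) :=
    (Equiv.arrowCongr (A.capSlots w).symm (Equiv.refl Bool)).trans
      (Equiv.sumArrowEquivProdArrow A.Edge (Fin (R w).arity) Bool)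
  rw [signature_eq_sum (cap w A) e.symm]
  unfold signature
  simp only [Finset.sum_mul]
  rw [Finset.sum_comm, ← Fintype.sum_prod_type' (γ := ℂ)]
  refine Finset.sum_congr rfl fun t _ => ?_
  obtain ⟨σ, rfl⟩ := e.surjective t
  rw [Equiv.symm_apply_apply]
  have hW := fun F => prod_sum_of_fintype (cap w A).instFintypeW F
  simp only [Finset.univ_unique, Finset.prod_singleton] at hW
  refine (congrArg₂ (· * ·) rfl (hW _)).trans ((mul_assoc _ _ _).symm.trans ?_)
  refine congrArg₂ (· * ·) (congrArg₂ (· * ·) ?_ rfl) rfl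
  refine Finset.prod_congr rfl fun u _ => congrArg (L (A.labU u)).fn (funext fun i => ?_)
  change Sum.elim σ x (Sum.map (A.capSlots w) id (capEquiv _ _ _ (A.link ⟨u, i⟩))) = _
  rcases A.link ⟨u, i⟩ with s | j
  · rfl
  · obtain ⟨j, rfl⟩ := finSumFinEquiv.surjective j
    simp only [capEquiv, Equiv.trans_apply, Equiv.sumCongr_apply, Sum.map_inr,
          Equiv.symm_apply_apply]
    rcases j with j | j
    · rw [finSumFinEquiv_apply_left, Sum.elim_inr, Fin.append_left]
      rfl
    · rw [finSumFinEquiv_apply_right, Sum.elim_inr, Fin.append_right]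
      rfl

/-! ### Codes of the constructions -/

/-- Change of the description of what the slots of the left vertices are joined to. -/
def mapEntries (φ : ℕ × ℕ ⊕ ℕ → ℕ × ℕ ⊕ ℕ) (l : List (ℕ × List (ℕ × ℕ ⊕ ℕ))) :
    List (ℕ × List (ℕ × ℕ ⊕ ℕ)) :=
  l.map fun p => (p.1, p.2.map φ)

theorem mapEntries_primrec {α : Type*} [Primcodable α]
    {φ : α → ℕ × ℕ ⊕ ℕ → ℕ × ℕ ⊕ ℕ} {l : α → List (ℕ × List (ℕ × ℕ ⊕ ℕ))} (hφ : Primrec₂ φ)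
    (hl : Primrec l) : Primrec fun x => mapEntries (φ x) (l x) := by
  refine Primrec.list_map hl (Primrec.pair (Primrec.fst.comp Primrec.snd) ?_)
  refine Primrec.list_map (Primrec.snd.comp Primrec.snd) ?_
  exact hφ.comp (Primrec.fst.comp Primrec.fst) Primrec.snd

theorem map_codeU (A : Assembly L R m) (u : A.U) (φ : ℕ × ℕ ⊕ ℕ → ℕ × ℕ ⊕ ℕ) :
    (((A.codeU u).1, (A.codeU u).2.map φ) : ℕ × List (ℕ × ℕ ⊕ ℕ)) =
      ((A.labU u : ℕ), List.ofFn fun i => φ (A.entry (A.link ⟨u, i⟩))) := by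
  rw [codeU, List.map_ofFn]
  rfl

theorem ofFn_finSumFinEquiv {X Y T : Type} (e : X ≃ Fin m) (f : Y ≃ Fin n) (g : X ⊕ Y → T) :
    List.ofFn (fun i => g (((Equiv.sumCongr e f).trans finSumFinEquiv).symm i)) =
      List.ofFn (fun i => g (Sum.inl (e.symm i))) ++
        List.ofFn fun i => g (Sum.inr (f.symm i)) := by
  rw [List.ofFn_add]
  congr 2
  · refine funext fun i => congrArg g ?_
    rw [Equiv.symm_apply_eq]
    exact Fin.ext (by simp)
  · refine funext fun i => congrArg g ?_
    rw [Equiv.symm_apply_eq]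
    exact Fin.ext (by simp)

/-- The code of a gadget after rotation. -/
def rotateCode (m : ℕ) (c : List (ℕ × List (ℕ × ℕ ⊕ ℕ)) × List ℕ) :
    List (ℕ × List (ℕ × ℕ ⊕ ℕ)) × List ℕ :=
  (mapEntries (fun z => Sum.casesOn z Sum.inl
    fun j => Sum.inr (if j + 1 = m then 0 else j + 1)) c.1, c.2)

theorem val_finRotate (j : Fin m) :
    (finRotate m j : ℕ) = if (j : ℕ) + 1 = m then 0 else (j : ℕ) + 1 := by
  obtain ⟨m, rfl⟩ : ∃ m', m = m' + 1 := ⟨m - 1, by have := j.2; omega⟩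
  rw [coe_finRotate]
  simp [Fin.ext_iff]

theorem rotate_code (A : Assembly L R m) : A.rotate.code = rotateCode m A.code := by
  refine Prod.ext ?_ rfl
  refine Eq.trans ?_ List.map_ofFn.symm
  refine congrArg List.ofFn (funext fun u => ?_)
  refine Eq.trans ?_ (map_codeU A (A.eU.symm u) _).symm
  refine congrArg (Prod.mk _) (congrArg List.ofFn (funext fun i => ?_))
  change A.rotate.entry (Sum.map id (finRotate m) (A.link _)) = _
  rcases A.link ⟨A.eU.symm u, i⟩ with s | j
  · rfl
  · exact congrArg Sum.inr (val_finRotate j)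

/-- The code of a union, from the codes of the parts. -/
def unionCode (m : ℕ) (c d : List (ℕ × List (ℕ × ℕ ⊕ ℕ)) × List ℕ) :
    List (ℕ × List (ℕ × ℕ ⊕ ℕ)) × List ℕ :=
  (c.1 ++ mapEntries (fun z => Sum.casesOn z (fun s => Sum.inl (c.2.length + s.1, s.2))
    fun j => Sum.inr (m + j)) d.1, c.2 ++ d.2)

theorem length_code_snd (A : Assembly L R m) : A.code.2.length = A.nW := List.length_ofFn

theorem entry_union_inl (A : Assembly L R m) (B : Assembly L R n) (z : A.Edge ⊕ Fin m) :
    (A.union B).entry (A.unionDarts B (Sum.inl z)) = A.entry z := by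
  rcases z with s | j <;> rfl

theorem entry_union_inr (A : Assembly L R m) (B : Assembly L R n) (z : B.Edge ⊕ Fin n) :
    (A.union B).entry (A.unionDarts B (Sum.inr z)) = Sum.casesOn (B.entry z)
      (fun s => Sum.inl (A.nW + s.1, s.2)) fun j => Sum.inr (m + j) := by
  rcases z with s | j <;> rfl

theorem union_code (A : Assembly L R m) (B : Assembly L R n) :
    (A.union B).code = unionCode m A.code B.code := by
  refine Prod.ext ?_ (ofFn_finSumFinEquiv A.eW B.eW fun w => ((A.union B).labW w : ℕ))
  refine (ofFn_finSumFinEquiv A.eU B.eU (A.union B).codeU).trans ?_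
  refine congrArg₂ (· ++ ·) ?_ ?_
  · refine congrArg List.ofFn (funext fun u => ?_)
    refine congrArg (Prod.mk _) (congrArg List.ofFn (funext fun i => ?_))
    exact entry_union_inl A B _
  · refine Eq.trans ?_ List.map_ofFn.symm
    refine congrArg List.ofFn (funext fun u => ?_)
    refine Eq.trans ?_ (map_codeU B (B.eU.symm u) _).symm
    refine congrArg (Prod.mk _) (congrArg List.ofFn (funext fun i => ?_))
    rw [length_code_snd]
    exact entry_union_inr A B _

/-- The code of a gadget after the last dangling edges have been joined to a right vertex. -/
def capCode (m w : ℕ) (c : List (ℕ × List (ℕ × ℕ ⊕ ℕ)) × List ℕ) :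
    List (ℕ × List (ℕ × ℕ ⊕ ℕ)) × List ℕ :=
  (mapEntries (fun z => Sum.casesOn z Sum.inl
    fun j => if j < m then Sum.inr j else Sum.inl (c.2.length, j - m)) c.1, c.2 ++ [w])

theorem cap_code (w : Fin b) (A : Assembly L R (m + (R w).arity)) :
    (cap w A).code = capCode m w A.code := by
  refine Prod.ext ?_ (ofFn_finSumFinEquiv A.eW (Equiv.ofUnique Unit (Fin 1))
    fun v => ((cap w A).labW v : ℕ))
  refine Eq.trans ?_ List.map_ofFn.symm
  refine congrArg List.ofFn (funext fun u => ?_)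
  refine Eq.trans ?_ (map_codeU A (A.eU.symm u) _).symm
  refine congrArg (Prod.mk _) (congrArg List.ofFn (funext fun i => ?_))
  change (cap w A).entry (Sum.map (A.capSlots w) id (capEquiv _ _ _ (A.link _))) = _
  rw [length_code_snd]
  rcases A.link ⟨A.eU.symm u, i⟩ with s | j
  · rfl
  · obtain ⟨j, rfl⟩ := finSumFinEquiv.surjective j
    simp only [capEquiv, Equiv.trans_apply, Equiv.sumCongr_apply, Sum.map_inr,
          Equiv.symm_apply_apply]
    rcases j with j | j
    · exact (if_pos j.2).symm
    · refine Eq.trans ?_ (if_neg (by simp)).symm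
      change Sum.inl (A.nW + 0, (j : ℕ)) = Sum.inl (A.nW, m + (j : ℕ) - m)
      rw [add_zero, Nat.add_sub_cancel_left]

/-- Each construction acts on codes by a primitive recursive function. This is what makes a sequence
of gadgets computable. -/
theorem rotateCode_primrec (m : ℕ) : Primrec (rotateCode m) := by
  refine Primrec.pair (mapEntries_primrec ?_ Primrec.fst) Primrec.snd
  refine Primrec.sumCasesOn Primrec.snd (Primrec.sumInl.comp Primrec.snd) ?_
  refine Primrec.sumInr.comp (Primrec.ite ?_ (Primrec.const 0) (Primrec.succ.comp Primrec.snd))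
  exact Primrec.eq.comp (Primrec.succ.comp Primrec.snd) (Primrec.const m)

theorem unionCode_primrec (m : ℕ) : Primrec₂ (unionCode m) := by
  refine Primrec.pair (Primrec.list_append.comp (Primrec.fst.comp Primrec.fst)
    (mapEntries_primrec ?_ (Primrec.fst.comp Primrec.snd)))
    (Primrec.list_append.comp (Primrec.snd.comp Primrec.fst) (Primrec.snd.comp Primrec.snd))
  refine Primrec.sumCasesOn Primrec.snd (Primrec.sumInl.comp (Primrec.pair ?_ ?_))
    (Primrec.sumInr.comp (Primrec.nat_add.comp (Primrec.const m) Primrec.snd))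
  · refine Primrec.nat_add.comp ?_ (Primrec.fst.comp Primrec.snd)
    exact Primrec.list_length.comp
      (Primrec.snd.comp (Primrec.fst.comp (Primrec.fst.comp Primrec.fst)))
  · exact Primrec.snd.comp Primrec.snd

theorem capCode_primrec (m w : ℕ) : Primrec (capCode m w) := by
  refine Primrec.pair (mapEntries_primrec ?_ Primrec.fst)
    (Primrec.list_append.comp Primrec.snd (Primrec.const [w]))
  refine Primrec.sumCasesOn Primrec.snd (Primrec.sumInl.comp Primrec.snd) ?_
  refine Primrec.ite ?_ (Primrec.sumInr.comp Primrec.snd)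
    (Primrec.sumInl.comp (Primrec.pair ?_ ?_))
  · exact Primrec.nat_lt.comp Primrec.snd (Primrec.const m)
  · exact Primrec.list_length.comp
      (Primrec.snd.comp (Primrec.fst.comp Primrec.fst))
  · exact Primrec.nat_sub.comp Primrec.snd (Primrec.const m)

end Assembly

/-! ### Computable sequences of plane gadgets -/

/-- The signatures are realized by a computable sequence of plane gadgets of polynomial size. -/
def Constructible {a b : ℕ} (L : Fin a → Signature) (R : Fin b → Signature) {m : ℕ}
    (g : ℕ → Sig m) : Prop :=
  ∃ A : ℕ → Assembly L R m, (∀ n, (A n).Plane) ∧ Computable (fun n => (A n).code) ∧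
    (∃ p : Polynomial ℕ, ∀ n, (A n).size ≤ p.eval n) ∧ ∀ n, (A n).signature = g n

namespace Constructible

variable {a b : ℕ} {L : Fin a → Signature} {R : Fin b → Signature} {m n : ℕ}

theorem vertex (u : Fin a) (h : 0 < (L u).arity) : Constructible L R fun _ => (L u).fn :=
  ⟨fun _ => Assembly.vertex L R u, fun _ => Assembly.vertex_plane h, Computable.const _,
    ⟨1, fun _ => by simp [Assembly.size]⟩, fun _ => Assembly.vertex_signature u⟩

theorem rotate {g : ℕ → Sig m} (h : Constructible L R g) :
    Constructible L R fun n x => g n (x ∘ finRotate m) := by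
  obtain ⟨A, hA, hc, ⟨p, hp⟩, hg⟩ := h
  refine ⟨fun n => (A n).rotate, fun n => (hA n).rotate, ?_, ⟨p, hp⟩, fun n => ?_⟩
  · exact ((Assembly.rotateCode_primrec m).to_comp.comp hc).of_eq
      fun n => (Assembly.rotate_code (A n)).symm
  · ext x
    rw [Assembly.rotate_signature, hg]

theorem union {g : ℕ → Sig m} {g' : ℕ → Sig n} (h : Constructible L R g)
    (h' : Constructible L R g') (hm : 0 < m) (hn : 0 < n) :
    Constructible L R fun k (x : Fin (m + n) → Bool) =>
      g k (fun i => x (Fin.castAdd n i)) * g' k fun i => x (Fin.natAdd m i) := by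
  obtain ⟨A, hA, hc, ⟨p, hp⟩, hg⟩ := h
  obtain ⟨A', hA', hc', ⟨p', hp'⟩, hg'⟩ := h'
  refine ⟨fun n => (A n).union (A' n), fun n => (hA n).union (hA' n) hm hn, ?_,
    ⟨p + p', fun n => ?_⟩, fun n => ?_⟩
  · exact ((Assembly.unionCode_primrec m).to_comp.comp hc hc').of_eq
      fun n => (Assembly.union_code (A n) (A' n)).symm
  · have h1 := hp n
    have h2 := hp' n
    rw [Polynomial.eval_add]
    simp only [Assembly.size] at h1 h2 ⊢
    omega
  · ext x
    rw [Assembly.union_signature, hg, hg']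

theorem cap {w : Fin b} {g : ℕ → Sig (m + (R w).arity)} (h : Constructible L R g) (hm : 0 < m)
    (hw : 0 < (R w).arity) :
    Constructible L R fun k (x : Fin m → Bool) => ∑ y, g k (Fin.append x y) * (R w).fn y := by
  obtain ⟨A, hA, hc, ⟨p, hp⟩, hg⟩ := h
  refine ⟨fun n => Assembly.cap w (A n), fun n => (hA n).cap hm hw, ?_, ⟨p + 1, fun n => ?_⟩,
    fun n => ?_⟩
  · exact ((Assembly.capCode_primrec m w).to_comp.comp hc).of_eq
      fun n => (Assembly.cap_code w (A n)).symm
  · have h1 := hp n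
    rw [Polynomial.eval_add, Polynomial.eval_one]
    simp only [Assembly.size] at h1 ⊢
    omega
  · ext x
    rw [Assembly.cap_signature, hg]

/-- The iterates of a construction. -/
theorem iterate {step : Assembly L R m → Assembly L R m}
    {stepCode : List (ℕ × List (ℕ × ℕ ⊕ ℕ)) × List ℕ → List (ℕ × List (ℕ × ℕ ⊕ ℕ)) × List ℕ}
    (hcode : ∀ A, (step A).code = stepCode A.code) (hprim : Primrec stepCode)
    (hplane : ∀ A, A.Plane → (step A).Plane) {s : ℕ} (hsize : ∀ A, (step A).size ≤ A.size + s)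
    {A : Assembly L R m} (hA : A.Plane) :
    Constructible L R fun n => (step^[n] A).signature := by
  refine ⟨fun n => step^[n] A, fun n => ?_, ?_,
    ⟨Polynomial.C A.size + Polynomial.C s * Polynomial.X, fun n => ?_⟩, fun _ => rfl⟩
  · induction n with
    | zero => exact hA
    | succ n ih =>
      simp only [Function.iterate_succ_apply']
      exact hplane _ ih
  · refine (Primrec.nat_iterate Primrec.id (Primrec.const A.code)
      (h := fun _ => stepCode) (hprim.comp Primrec.snd)).to_comp.of_eq fun n => ?_
    exact ((Function.Semiconj.iterate_right (f := Assembly.code) hcode n) A).symm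
  · simp only [Polynomial.eval_add, Polynomial.eval_mul, Polynomial.eval_C, Polynomial.eval_X]
    induction n with
    | zero => simp
    | succ n ih =>
      rw [Function.iterate_succ_apply']
      have := hsize (step^[n] A)
      rw [mul_add, mul_one]
      omega

end Constructible

/-! ### Sums over short Boolean strings -/

theorem sum_bool_one (F : (Fin 1 → Bool) → ℂ) : ∑ y, F y = F ![false] + F ![true] := by
  rw [show (Finset.univ : Finset (Fin 1 → Bool)) = {![false], ![true]} by decide,
    Finset.sum_pair (by decide)]

theorem sum_bool_two (F : (Fin 2 → Bool) → ℂ) : ∑ y, F y =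
    F ![false, false] + F ![false, true] + F ![true, false] + F ![true, true] := by
  rw [show (Finset.univ : Finset (Fin 2 → Bool)) =
      {![false, false], ![false, true], ![true, false], ![true, true]} by decide,
    Finset.sum_insert (by decide), Finset.sum_insert (by decide), Finset.sum_pair (by decide)]
  ring

theorem sum_bool_three (F : (Fin 3 → Bool) → ℂ) : ∑ y, F y =
    F ![false, false, false] + F ![false, false, true] + F ![false, true, false] +
      F ![false, true, true] + F ![true, false, false] + F ![true, false, true] +
      F ![true, true, false] + F ![true, true, true] := by
  rw [show (Finset.univ : Finset (Fin 3 → Bool)) =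
      {![false, false, false], ![false, false, true], ![false, true, false],
        ![false, true, true], ![true, false, false], ![true, false, true],
        ![true, true, false], ![true, true, true]} by decide]
  repeat rw [Finset.sum_insert (by decide)]
  rw [Finset.sum_singleton]
  ring

theorem hammingWeight_append {m n : ℕ} (x : Fin m → Bool) (y : Fin n → Bool) :
    hammingWeight (Fin.append x y) = hammingWeight x + hammingWeight y := by
  simp only [hammingWeight, Finset.card_filter, Fin.sum_univ_add, Fin.append_left,
    Fin.append_right]

/-- The symmetric signature with given values at all weights. -/
def weightSig {m : ℕ} (c : ℕ → ℂ) : Sig m := fun x => c (hammingWeight x)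

/-- The signatures `[1,0]`, `[1,0,1]`, `[1,0,1,0]`. -/
abbrev evenSigs : Fin 3 → Signature :=
  ![⟨1, symSig ![1, 0]⟩, ⟨2, symSig ![1, 0, 1]⟩, ⟨3, symSig ![1, 0, 1, 0]⟩]

/-! ### Caps by the three available right signatures -/

namespace Constructible

variable {a : ℕ} {L : Fin a → Signature} {m n : ℕ}

theorem congr {b : ℕ} {R : Fin b → Signature} {g g' : ℕ → Sig m} (h : Constructible L R g)
    (e : ∀ k x, g k x = g' k x) : Constructible L R g' :=
  (funext fun k => funext (e k)) ▸ h

theorem pin {g : ℕ → Sig (m + 1)} (h : Constructible L evenSigs g) (hm : 0 < m) :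
    Constructible L evenSigs fun k (x : Fin m → Bool) => g k (Fin.append x ![false]) := by
  refine (Constructible.cap (w := 0) h hm one_pos).congr fun k x => ?_
  refine (sum_bool_one fun y => g k (Fin.append x y) * symSig ![1, 0] y).trans ?_
  rw [show symSig ![1, 0] ![false] = 1 from rfl, show symSig ![1, 0] ![true] = 0 from rfl]
  ring

theorem loop {g : ℕ → Sig (m + 2)} (h : Constructible L evenSigs g) (hm : 0 < m) :
    Constructible L evenSigs fun k (x : Fin m → Bool) =>
      g k (Fin.append x ![false, false]) + g k (Fin.append x ![true, true]) := by
  refine (Constructible.cap (w := 1) h hm two_pos).congr fun k x => ?_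
  refine (sum_bool_two fun y => g k (Fin.append x y) * symSig ![1, 0, 1] y).trans ?_
  rw [show symSig ![1, 0, 1] ![false, false] = 1 from rfl,
    show symSig ![1, 0, 1] ![false, true] = 0 from rfl,
    show symSig ![1, 0, 1] ![true, false] = 0 from rfl,
    show symSig ![1, 0, 1] ![true, true] = 1 from rfl]
  ring

theorem capEven {g : ℕ → Sig (m + 3)} (h : Constructible L evenSigs g) (hm : 0 < m) :
    Constructible L evenSigs fun k (x : Fin m → Bool) =>
      g k (Fin.append x ![false, false, false]) + g k (Fin.append x ![false, true, true]) +
        g k (Fin.append x ![true, false, true]) + g k (Fin.append x ![true, true, false]) := by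
  refine (Constructible.cap (w := 2) h hm three_pos).congr fun k x => ?_
  refine (sum_bool_three fun y => g k (Fin.append x y) * symSig ![1, 0, 1, 0] y).trans ?_
  rw [show symSig ![1, 0, 1, 0] ![false, false, false] = 1 from rfl,
    show symSig ![1, 0, 1, 0] ![false, false, true] = 0 from rfl,
    show symSig ![1, 0, 1, 0] ![false, true, false] = 0 from rfl,
    show symSig ![1, 0, 1, 0] ![false, true, true] = 1 from rfl,
    show symSig ![1, 0, 1, 0] ![true, false, false] = 0 from rfl,
    show symSig ![1, 0, 1, 0] ![true, false, true] = 1 from rfl,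
    show symSig ![1, 0, 1, 0] ![true, true, false] = 1 from rfl,
    show symSig ![1, 0, 1, 0] ![true, true, true] = 0 from rfl]
  ring

theorem pin_weightSig {c : ℕ → ℕ → ℂ}
    (h : Constructible L evenSigs fun k => (weightSig (c k) : Sig (m + 1))) (hm : 0 < m) :
    Constructible L evenSigs fun k => (weightSig (c k) : Sig m) :=
  (h.pin hm).congr fun k x => by
    simp only [weightSig, hammingWeight_append]
    rfl

theorem loop_weightSig {c : ℕ → ℕ → ℂ}
    (h : Constructible L evenSigs fun k => (weightSig (c k) : Sig (m + 2))) (hm : 0 < m) :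
    Constructible L evenSigs fun k => (weightSig (fun i => c k i + c k (i + 2)) : Sig m) :=
  (h.loop hm).congr fun k x => by
    simp only [weightSig, hammingWeight_append]
    rfl

/-- A binary gadget is attached to the last dangling edge of a ternary one. -/
theorem join {g : ℕ → Sig 3} {b : ℕ → Sig 2} (h : Constructible L evenSigs g)
    (h' : Constructible L evenSigs b) : Constructible L evenSigs fun k (x : Fin 3 → Bool) =>
      g k ![x 1, x 2, false] * b k ![false, x 0] + g k ![x 1, x 2, true] * b k ![true, x 0] := by
  refine ((h.union h' three_pos two_pos).rotate.loop (m := 3) three_pos).congr fun k x => ?_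
  refine congrArg₂ (· + ·) (congrArg₂ (· * ·) (congrArg _ ?_) (congrArg _ ?_))
    (congrArg₂ (· * ·) (congrArg _ ?_) (congrArg _ ?_)) <;>
  · funext i
    fin_cases i <;> rfl

end Constructible

theorem eq_vec_two (x : Fin 2 → Bool) : x = ![x 0, x 1] := by
  funext i
  fin_cases i <;> rfl

theorem eq_vec_three (x : Fin 3 → Bool) : x = ![x 0, x 1, x 2] := by
  funext i
  fin_cases i <;> rfl

theorem weightSig_two {c d : ℕ → ℂ} (h0 : c 0 = d 0) (h1 : c 1 = d 1) (h2 : c 2 = d 2)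
    (x : Fin 2 → Bool) : weightSig c x = weightSig d x := by
  rw [eq_vec_two x]
  cases x 0 <;> cases x 1
  exacts [h0, h1, h1, h2]

theorem weightSig_three {c d : ℕ → ℂ} (h0 : c 0 = d 0) (h1 : c 1 = d 1) (h2 : c 2 = d 2)
    (h3 : c 3 = d 3) (x : Fin 3 → Bool) : weightSig c x = weightSig d x := by
  rw [eq_vec_three x]
  cases x 0 <;> cases x 1 <;> cases x 2
  exacts [h0, h1, h1, h2, h1, h2, h2, h3]

theorem weightSig_vec (c : ℕ → ℂ) (p q r : Bool) :
    weightSig c ![p, q, r] = c (p.toNat + q.toNat + r.toNat) := by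
  cases p <;> cases q <;> cases r <;> rfl

/-! ### Small gadgets with symmetric signatures -/

namespace Constructible

variable {a : ℕ} {L : Fin a → Signature} {m n : ℕ}

/-- Diagonal binary gadgets are attached to all dangling edges. -/
theorem join_diagonal {c d : ℕ → ℕ → ℂ}
    (h : Constructible L evenSigs fun k => (weightSig (c k) : Sig 3))
    (h' : Constructible L evenSigs fun k => (weightSig (d k) : Sig 2)) (hd : ∀ k, d k 1 = 0) :
    Constructible L evenSigs fun k =>
      (weightSig (fun i => c k i * (d k 0 ^ (3 - i) * d k 2 ^ i)) : Sig 3) := by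
  -- Each `join` also shifts the dangling edges cyclically by one, so three of them treat every edge
  -- once and restore the order.
  refine (((h.join h').join h').join h').congr fun k x => ?_
  rw [eq_vec_three x]
  generalize x 0 = p, x 1 = q, x 2 = r
  have h00 : (weightSig (d k) : Sig 2) ![false, false] = d k 0 := rfl
  have h01 : (weightSig (d k) : Sig 2) ![false, true] = 0 := hd k
  have h10 : (weightSig (d k) : Sig 2) ![true, false] = 0 := hd k
  have h11 : (weightSig (d k) : Sig 2) ![true, true] = d k 2 := rfl
  cases p <;> cases q <;> cases r <;>
  · simp only [Matrix.cons_val, h00, h01, h10, h11, mul_zero, zero_add, add_zero, weightSig_vec]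
    simp only [Bool.toNat_true, Bool.toNat_false]
    ring

/-- Disequality gadgets are attached to all dangling edges. -/
theorem join_flip {c d : ℕ → ℕ → ℂ}
    (h : Constructible L evenSigs fun k => (weightSig (c k) : Sig 3))
    (h' : Constructible L evenSigs fun k => (weightSig (d k) : Sig 2)) (hd : ∀ k, d k 0 = 0)
    (hd' : ∀ k, d k 2 = 0) :
    Constructible L evenSigs fun k =>
      (weightSig (fun i => c k (3 - i) * d k 1 ^ 3) : Sig 3) := by
  refine (((h.join h').join h').join h').congr fun k x => ?_
  rw [eq_vec_three x]
  generalize x 0 = p, x 1 = q, x 2 = r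
  have h00 : (weightSig (d k) : Sig 2) ![false, false] = 0 := hd k
  have h01 : (weightSig (d k) : Sig 2) ![false, true] = d k 1 := rfl
  have h10 : (weightSig (d k) : Sig 2) ![true, false] = d k 1 := rfl
  have h11 : (weightSig (d k) : Sig 2) ![true, true] = 0 := hd' k
  cases p <;> cases q <;> cases r <;>
  · simp only [Matrix.cons_val, h00, h01, h10, h11, mul_zero, zero_add, add_zero, weightSig_vec]
    simp only [Bool.toNat_true, Bool.toNat_false]
    ring

/-- Three diagonal binary gadgets around an even ternary vertex. -/
theorem triangle {d : ℕ → ℕ → ℂ}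
    (h : Constructible L evenSigs fun k => (weightSig (d k) : Sig 2)) (hd : ∀ k, d k 1 = 0) :
    Constructible L evenSigs fun k => (weightSig
      (fun i => if i = 0 then d k 0 ^ 3 else if i = 2 then d k 0 * d k 2 ^ 2 else 0) : Sig 3) := by
  -- The rotations arrange the six ends so that the binary gadgets join `x 2`, `x 1`, `x 0` to the
  -- first, second and third slot of the even vertex: three nested, hence noncrossing, pairs.
  refine ((h.union (h.union h two_pos two_pos).rotate two_pos (by norm_num)).rotate.rotate.capEven
    (m := 3) three_pos).congr fun k x => ?_
  have key : ∀ t₁ t₂ t₃ : Bool,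
      (fun i : Fin 2 => ((Fin.append x ![t₁, t₂, t₃] ∘ finRotate 6) ∘ finRotate 6)
        (Fin.castAdd 4 i)) = ![x 2, t₁] ∧
      (fun i : Fin 2 => (((fun j : Fin 4 => ((Fin.append x ![t₁, t₂, t₃] ∘ finRotate 6) ∘
        finRotate 6) (Fin.natAdd 2 j)) ∘ finRotate 4) (Fin.castAdd 2 i))) = ![t₃, x 0] ∧
      (fun i : Fin 2 => (((fun j : Fin 4 => ((Fin.append x ![t₁, t₂, t₃] ∘ finRotate 6) ∘
        finRotate 6) (Fin.natAdd 2 j)) ∘ finRotate 4) (Fin.natAdd 2 i))) = ![x 1, t₂] := by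
    intro t₁ t₂ t₃
    refine ⟨?_, ?_, ?_⟩ <;>
    · funext i
      fin_cases i <;> rfl
  have val : ∀ t₁ t₂ t₃ : Bool, weightSig (d k) (fun i : Fin 2 =>
      ((Fin.append x ![t₁, t₂, t₃] ∘ finRotate 6) ∘ finRotate 6) (Fin.castAdd 4 i)) *
      (weightSig (d k) (fun i : Fin 2 => (((fun j : Fin 4 =>
        ((Fin.append x ![t₁, t₂, t₃] ∘ finRotate 6) ∘ finRotate 6) (Fin.natAdd 2 j)) ∘
          finRotate 4) (Fin.castAdd 2 i))) *
      weightSig (d k) (fun i : Fin 2 => (((fun j : Fin 4 =>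
        ((Fin.append x ![t₁, t₂, t₃] ∘ finRotate 6) ∘ finRotate 6) (Fin.natAdd 2 j)) ∘
          finRotate 4) (Fin.natAdd 2 i)))) = weightSig (d k) ![x 2, t₁] *
      (weightSig (d k) ![t₃, x 0] * weightSig (d k) ![x 1, t₂]) := by
    intro t₁ t₂ t₃
    obtain ⟨h1, h2, h3⟩ := key t₁ t₂ t₃
    rw [h1, h2, h3]
  refine (congrArg₂ (· + ·) (congrArg₂ (· + ·) (congrArg₂ (· + ·) (val _ _ _) (val _ _ _))
    (val _ _ _)) (val _ _ _)).trans ?_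
  rw [eq_vec_three x]
  generalize x 0 = p, x 1 = q, x 2 = r
  have h00 : (weightSig (d k) : Sig 2) ![false, false] = d k 0 := rfl
  have h01 : (weightSig (d k) : Sig 2) ![false, true] = 0 := hd k
  have h10 : (weightSig (d k) : Sig 2) ![true, false] = 0 := hd k
  have h11 : (weightSig (d k) : Sig 2) ![true, true] = d k 2 := rfl
  cases p <;> cases q <;> cases r <;>
  · simp only [Matrix.cons_val, h00, h01, h10, h11, mul_zero, zero_mul, zero_add, add_zero,
      weightSig_vec, Bool.toNat_true, Bool.toNat_false]
    norm_num [-mul_eq_mul_left_iff]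
    try ring

/-- A binary gadget and a ternary one around an even ternary vertex. -/
theorem digon {c d : ℕ → ℕ → ℂ}
    (h : Constructible L evenSigs fun k => (weightSig (c k) : Sig 3))
    (h' : Constructible L evenSigs fun k => (weightSig (d k) : Sig 2)) (hc1 : ∀ k, c k 1 = 0)
    (hc3 : ∀ k, c k 3 = 0) (hd : ∀ k, d k 1 = 0) :
    Constructible L evenSigs fun k => (weightSig
      (fun i => if i = 0 then d k 0 * (c k 0 + c k 2) else if i = 2 then 2 * (d k 2 * c k 2)
        else 0) : Sig 2) := by
  refine ((h'.union h two_pos three_pos).rotate.capEven (m := 2) two_pos).congr fun k x => ?_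
  have key : ∀ t₁ t₂ t₃ : Bool,
      (fun i : Fin 2 => (Fin.append x ![t₁, t₂, t₃] ∘ finRotate 5) (Fin.castAdd 3 i)) =
        ![x 1, t₁] ∧
      (fun i : Fin 3 => (Fin.append x ![t₁, t₂, t₃] ∘ finRotate 5) (Fin.natAdd 2 i)) =
        ![t₂, t₃, x 0] := by
    intro t₁ t₂ t₃
    refine ⟨?_, ?_⟩ <;>
    · funext i
      fin_cases i <;> rfl
  have val : ∀ t₁ t₂ t₃ : Bool, weightSig (d k) (fun i : Fin 2 =>
      (Fin.append x ![t₁, t₂, t₃] ∘ finRotate 5) (Fin.castAdd 3 i)) *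
      weightSig (c k) (fun i : Fin 3 =>
        (Fin.append x ![t₁, t₂, t₃] ∘ finRotate 5) (Fin.natAdd 2 i)) =
      weightSig (d k) ![x 1, t₁] * weightSig (c k) ![t₂, t₃, x 0] := by
    intro t₁ t₂ t₃
    rw [(key t₁ t₂ t₃).1, (key t₁ t₂ t₃).2]
  refine (congrArg₂ (· + ·) (congrArg₂ (· + ·) (congrArg₂ (· + ·) (val _ _ _) (val _ _ _))
    (val _ _ _)) (val _ _ _)).trans ?_
  rw [eq_vec_two x]
  generalize x 0 = p, x 1 = q
  have h00 : (weightSig (d k) : Sig 2) ![false, false] = d k 0 := rfl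
  have h01 : (weightSig (d k) : Sig 2) ![false, true] = 0 := hd k
  have h10 : (weightSig (d k) : Sig 2) ![true, false] = 0 := hd k
  have h11 : (weightSig (d k) : Sig 2) ![true, true] = d k 2 := rfl
  have e00 : ∀ c : ℕ → ℂ, (weightSig c : Sig 2) ![false, false] = c 0 := fun _ => rfl
  have e01 : ∀ c : ℕ → ℂ, (weightSig c : Sig 2) ![false, true] = c 1 := fun _ => rfl
  have e10 : ∀ c : ℕ → ℂ, (weightSig c : Sig 2) ![true, false] = c 1 := fun _ => rfl
  have e11 : ∀ c : ℕ → ℂ, (weightSig c : Sig 2) ![true, true] = c 2 := fun _ => rfl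
  cases p <;> cases q <;>
  · simp only [Matrix.cons_val, h00, h01, h10, h11, weightSig_vec, Bool.toNat_true,
      Bool.toNat_false, e00, e01, e10, e11, hc1, hc3, zero_add, add_zero, Nat.reduceAdd]
    norm_num [hc1, hc3]
    try ring

/-- A unary gadget is attached to the last dangling edge of a quaternary one. -/
theorem join_unary {c d : ℕ → ℕ → ℂ}
    (h : Constructible L evenSigs fun k => (weightSig (c k) : Sig 4))
    (h' : Constructible L evenSigs fun k => (weightSig (d k) : Sig 1)) :
    Constructible L evenSigs fun k =>
      (weightSig (fun i => c k i * d k 0 + c k (i + 1) * d k 1) : Sig 3) := by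
  refine ((h.union h' four_pos one_pos).loop (m := 3) three_pos).congr fun k x => ?_
  have key : ∀ t : Bool, weightSig (c k) (fun i : Fin 4 =>
      Fin.append x ![t, t] (Fin.castAdd 1 i)) * weightSig (d k) (fun i : Fin 1 =>
      Fin.append x ![t, t] (Fin.natAdd 4 i)) =
      c k (hammingWeight x + t.toNat) * d k t.toNat := by
    intro t
    rw [show (fun i : Fin 4 => Fin.append x ![t, t] (Fin.castAdd 1 i)) = Fin.append x ![t] by
      funext i; fin_cases i <;> rfl,
      show (fun i : Fin 1 => Fin.append x ![t, t] (Fin.natAdd 4 i)) = ![t] by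
      funext i; fin_cases i; rfl]
    simp only [weightSig, hammingWeight_append]
    cases t <;> rfl
  exact congrArg₂ (· + ·) (key false) (key true)

/-- The powers of a diagonal binary signature. -/
theorem powers {d : ℕ → ℂ}
    (h : Constructible L evenSigs fun _ => (weightSig d : Sig 2)) (hd : d 1 = 0) :
    Constructible L evenSigs fun k => (weightSig (fun i => d i ^ (k + 1)) : Sig 2) := by
  obtain ⟨A, hA, -, -, hg⟩ := h
  let step : Assembly L evenSigs 2 → Assembly L evenSigs 2 := fun B =>
    Assembly.cap (m := 2) 1 (B.union (A 0)).rotate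
  -- All iterates are built from the single gadget `A 0`, whose code is a constant, so the codes
  -- arise by iterating one primitive recursive function.
  refine (iterate (step := step) (A := A 0)
    (stepCode := fun c => Assembly.capCode 2 1 (Assembly.rotateCode 4
      (Assembly.unionCode 2 c (A 0).code))) (s := (A 0).size + 1) (fun B => ?_) ?_ (fun B hB => ?_)
      (fun B => ?_) (hA 0)).congr fun k => ?_
  · refine (Assembly.cap_code (R := evenSigs) 1 _).trans (congrArg (Assembly.capCode 2 1) ?_)
    refine (Assembly.rotate_code _).trans (congrArg (Assembly.rotateCode 4) ?_)
    exact Assembly.union_code B (A 0)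
  · exact (Assembly.capCode_primrec 2 1).comp ((Assembly.rotateCode_primrec 4).comp
      ((Assembly.unionCode_primrec 2).comp Primrec.id (Primrec.const _)))
  · exact Assembly.Plane.cap (R := evenSigs) (w := 1)
      (hB.union (hA 0) two_pos two_pos).rotate two_pos two_pos
  · simp only [step, Assembly.size]
    omega
  · induction k with
    | zero =>
      intro x
      rw [Function.iterate_zero_apply, hg]
      exact weightSig_two (d := fun i => d i ^ (0 + 1)) (pow_one _).symm (pow_one _).symm (pow_one _).symm x
    | succ k ih =>
      intro x
      rw [Function.iterate_succ_apply']
      refine (Assembly.cap_signature (R := evenSigs) (m := 2) 1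
        ((step^[k] (A 0)).union (A 0)).rotate x).trans ?_
      refine (sum_bool_two fun y => ((step^[k] (A 0)).union (A 0)).rotate.signature
        (Fin.append x y) * symSig ![1, 0, 1] y).trans ?_
      rw [show symSig ![1, 0, 1] ![false, false] = 1 from rfl,
        show symSig ![1, 0, 1] ![false, true] = 0 from rfl,
        show symSig ![1, 0, 1] ![true, false] = 0 from rfl,
        show symSig ![1, 0, 1] ![true, true] = 1 from rfl]
      simp only [Assembly.rotate_signature, Assembly.union_signature, hg, ih]
      have key : ∀ t : Bool, (fun i : Fin 2 => (Fin.append x ![t, t] ∘ finRotate 4)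
          (Fin.castAdd 2 i)) = ![x 1, t] ∧ (fun i : Fin 2 =>
          (Fin.append x ![t, t] ∘ finRotate 4) (Fin.natAdd 2 i)) = ![t, x 0] := by
        intro t
        refine ⟨?_, ?_⟩ <;>
        · funext i
          fin_cases i <;> rfl
      rw [(key false).1, (key false).2, (key true).1, (key true).2]
      rw [eq_vec_two x]
      generalize x 0 = p, x 1 = q
      have e00 : ∀ c : ℕ → ℂ, (weightSig c : Sig 2) ![false, false] = c 0 := fun _ => rfl
      have e01 : ∀ c : ℕ → ℂ, (weightSig c : Sig 2) ![false, true] = c 1 := fun _ => rfl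
      have e10 : ∀ c : ℕ → ℂ, (weightSig c : Sig 2) ![true, false] = c 1 := fun _ => rfl
      have e11 : ∀ c : ℕ → ℂ, (weightSig c : Sig 2) ![true, true] = c 2 := fun _ => rfl
      cases p <;> cases q <;> simp [e00, e01, e10, e11, hd, pow_succ]

/-! ### From constructible families to simulation -/

theorem symSig_eq_weightSig : (symSig ![0, 0, 1, 0] : Sig 3) =
    weightSig fun i => if i = 2 then 1 else 0 := by
  funext x
  rw [eq_vec_three x, weightSig_vec]
  cases x 0 <;> cases x 1 <;> cases x 2 <;> simp
  all_goals rfl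

theorem planarLeftRealizes {c : ℕ → ℂ}
    (h : Constructible L evenSigs fun _ => (weightSig c : Sig 3)) (h0 : c 0 = 0) (h1 : c 1 = 0)
    (h2 : c 2 ≠ 0) (h3 : c 3 = 0) :
    PlanarLeftRealizes L evenSigs (symSig ![0, 0, 1, 0] : Sig 3) := by
  obtain ⟨A, hA, -, -, hg⟩ := h
  refine ⟨(A 0).toLeftGadget, (hA 0).isPlanar, c 2, h2, fun x => ?_⟩
  rw [Assembly.signature_toLeftGadget, hg, symSig_eq_weightSig]
  exact weightSig_three (d := fun i => c 2 * if i = 2 then 1 else 0) (by simp [h0]) (by simp [h1])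
    (by simp) (by simp [h3]) x

theorem planarLeftInterpolates {c : ℕ → ℕ → ℂ}
    (h : Constructible L evenSigs fun k => (weightSig (c k) : Sig 3)) (h1 : ∀ k, c k 1 = 0)
    (h2 : ∀ k, c k 2 ≠ 0) (h3 : ∀ k, c k 3 = 0)
    (ht : Function.Injective fun k => c k 0 / c k 2) :
    PlanarLeftInterpolates L evenSigs (symSig ![0, 0, 1, 0] : Sig 3) := by
  obtain ⟨A, hA, hc, ⟨p, hp⟩, hg⟩ := h
  refine ⟨fun k => (A k).toLeftGadget, fun k => (hA k).isPlanar, ?_, ⟨p, hp⟩,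
    weightSig fun i => if i = 0 then 1 else 0, fun k => c k 0 / c k 2, fun k => c k 2, ht, h2,
    fun k x => ?_⟩
  · exact hc.of_eq fun k => ((A k).code_toLeftGadget).symm
  · rw [Assembly.signature_toLeftGadget, hg, symSig_eq_weightSig]
    exact weightSig_three (d := fun i => c k 2 * ((if i = 2 then 1 else 0) +
      c k 0 / c k 2 * if i = 0 then 1 else 0)) (by simp [mul_div_cancel₀ _ (h2 k)]) (by simp [h1])
      (by simp) (by simp [h3]) x

/-- Pinning gives [c₀,0,c₂], which suffices unless the two norms agree; the ratio might then be a
root of unity, with only finitely many powers. In that case `digon` gives [c₀(c₀+c₂), 0, 2c₂²],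
whose entries have different norms. -/
theorem exists_binary {c : ℕ → ℂ}
    (h : Constructible L evenSigs fun _ => (weightSig c : Sig 3)) (h0 : c 0 ≠ 0) (h1 : c 1 = 0)
    (h2 : c 2 ≠ 0) (h3 : c 3 = 0) (hne : c 2 ^ 2 ≠ c 0 ^ 2) : ∃ d : ℕ → ℂ,
    (Constructible L evenSigs fun _ => (weightSig d : Sig 2)) ∧ d 0 ≠ 0 ∧ d 1 = 0 ∧ d 2 ≠ 0 ∧
      ‖d 0‖ ≠ ‖d 2‖ := by
  by_cases hn : ‖c 0‖ = ‖c 2‖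
  · have hne' : c 0 ≠ c 2 ∧ c 0 + c 2 ≠ 0 := by
      refine ⟨fun e => hne (by rw [e]), fun e => hne ?_⟩
      rw [eq_neg_of_add_eq_zero_right e]
      ring
    refine ⟨_, digon h (h.pin_weightSig two_pos) (fun _ => h1) (fun _ => h3) (fun _ => h1), ?_, ?_,
      ?_, ?_⟩
    · simpa using ⟨h0, hne'.2⟩
    · simp
    · simpa using h2
    -- The triangle inequality is strict because two different numbers of equal norm do not lie on
    -- one ray.
    · have hlt : ‖c 0 + c 2‖ < ‖c 0‖ + ‖c 2‖ :=
        norm_add_lt_of_not_sameRay fun hs => hne'.1 ((sameRay_iff_of_norm_eq hn).1 hs)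
      have hpos : 0 < ‖c 0‖ := norm_pos_iff.2 h0
      simp only [if_true, OfNat.ofNat_ne_zero, if_false, norm_mul, Complex.norm_ofNat]
      rw [← hn] at hlt ⊢
      refine ne_of_lt ?_
      nlinarith
  · exact ⟨c, h.pin_weightSig two_pos, h0, h1, h2, hn⟩

/-- With the `(k+1)`-st power of [d₀,0,d₂] on all three edges, the ratio of the values at weights 0
and 2 becomes (c₀/c₂)(d₀/d₂)^(2(k+1)). Since `d₀` and `d₂` differ in norm, these ratios are pairwise
distinct. -/
theorem simulates_of_even {c : ℕ → ℂ}
    (h : Constructible L evenSigs fun _ => (weightSig c : Sig 3)) (h0 : c 0 ≠ 0) (h1 : c 1 = 0)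
    (h2 : c 2 ≠ 0) (h3 : c 3 = 0) (hne : c 2 ^ 2 ≠ c 0 ^ 2) :
    PlanarLeftSimulates L evenSigs (symSig ![0, 0, 1, 0] : Sig 3) := by
  obtain ⟨d, hd, hd0, hd1, hd2, hn⟩ := exists_binary h h0 h1 h2 h3 hne
  refine Or.inr (planarLeftInterpolates (h.join_diagonal (hd.powers hd1)
    fun k => by rw [hd1, zero_pow k.succ_ne_zero]) (fun k => by rw [h1, zero_mul])
    (fun k => by positivity) (fun k => by rw [h3, zero_mul]) ?_)
  have key : ∀ k, c 0 * ((d 0 ^ (k + 1)) ^ (3 - 0) * (d 2 ^ (k + 1)) ^ 0) /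
      (c 2 * ((d 0 ^ (k + 1)) ^ (3 - 2) * (d 2 ^ (k + 1)) ^ 2)) =
      c 0 / c 2 * ((d 0 / d 2) ^ 2) ^ (k + 1) := by
    intro k
    rw [pow_right_comm (d 0 / d 2), div_pow]
    have := pow_ne_zero (k + 1) hd0
    have := pow_ne_zero (k + 1) hd2
    generalize d 0 ^ (k + 1) = u at *
    generalize d 2 ^ (k + 1) = v at *
    norm_num
    field_simp
  intro k l hkl
  simp only [key] at hkl
  have e := congrArg norm (mul_left_cancel₀ (div_ne_zero h0 h2) hkl)
  simp only [norm_pow, norm_div] at e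
  have hpos : 0 < ‖d 0‖ / ‖d 2‖ := div_pos (norm_pos_iff.2 hd0) (norm_pos_iff.2 hd2)
  have hne1 : (‖d 0‖ / ‖d 2‖) ^ 2 ≠ 1 := fun e1 => by
    refine hn ((div_eq_one_iff_eq (norm_ne_zero_iff.2 hd2)).1 ?_)
    nlinarith
  exact Nat.succ_injective (pow_right_injective₀ (pow_pos hpos 2) hne1 e)

theorem pin_le {c : ℕ → ℂ} {k : ℕ}
    (h : Constructible L evenSigs fun _ => (weightSig c : Sig k)) (hm : 0 < m) (hmk : m ≤ k) :
    Constructible L evenSigs fun _ => (weightSig c : Sig m) := by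
  induction hmk with
  | refl => exact h
  | step hmk ih => exact ih (h.pin_weightSig (hm.trans_le hmk))

/-- Loops at a vertex whose signature is supported on one weight. -/
theorem loop_concentrated (hm : 0 < m) {p : ℕ} (hp : m < p + 2) (j : ℕ) {c : ℕ → ℂ}
    (h : Constructible L evenSigs fun _ => (weightSig c : Sig (m + 2 * j)))
    (hc : ∀ i ≤ m + 2 * j, c i ≠ 0 ↔ i = p + 2 * j) :
    ∃ c' : ℕ → ℂ, (Constructible L evenSigs fun _ => (weightSig c' : Sig m)) ∧
      ∀ i ≤ m, c' i ≠ 0 ↔ i = p := by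
  induction j generalizing c with
  | zero => exact ⟨c, h, hc⟩
  | succ j ih =>
    refine ih (Constructible.loop_weightSig (c := fun _ => c) h (by omega)) fun i hi => ?_
    -- By `hp`, the supporting weight exceeds every weight of the smaller arity. Only the term with
    -- both ends of the loop equal to one can survive, so nothing cancels.
    have h1 : c i = 0 := by
      by_contra h0
      have := (hc i (by omega)).1 h0
      omega
    rw [h1, zero_add, hc (i + 2) (by omega)]
    omega

end Constructible

/-! ### Symmetric affine signatures -/

theorem isAffine_of_support {k : ℕ} {f : Sig k} (y : Fin k → Bool) (h : ∀ x, x ≠ y → f x = 0) :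
    IsAffine f := by
  refine ⟨f y, k, 1, fun i => ((y i).toNat : ZMod 2), fun _ => false, fun _ _ => false,
    fun x => ?_⟩
  rw [Matrix.one_mulVec]
  by_cases hx : x = y
  · simp [hx]
  · rw [h x hx, if_neg]
    · simp
    · refine fun e => hx (funext fun i => ?_)
      have := congrFun e i
      revert this
      cases x i <;> cases y i <;> simp

theorem hammingWeight_eq_sum {k : ℕ} (x : Fin k → Bool) :
    hammingWeight x = ∑ i, (x i).toNat := by
  rw [hammingWeight, Finset.card_filter]
  exact Finset.sum_congr rfl fun i _ => by cases x i <;> rfl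

theorem isAffine_of_parity {k : ℕ} {f : Sig k} (ε : ℕ) (c : ℂ) (s : Bool)
    (h : ∀ x, f x = if hammingWeight x % 2 = ε % 2 then c * Complex.I ^ (s.toNat * hammingWeight x)
      else 0) : IsAffine f := by
  refine ⟨c, 1, fun _ _ => 1, fun _ => (ε : ZMod 2), fun _ => s, fun _ _ => false, fun x => ?_⟩
  have h1 : (Matrix.mulVec (fun (_ : Fin 1) (_ : Fin k) => (1 : ZMod 2))
      (fun i => ((x i).toNat : ZMod 2)) = fun _ => (ε : ZMod 2)) ↔
      hammingWeight x % 2 = ε % 2 := by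
    rw [← Nat.ModEq, ← ZMod.natCast_eq_natCast_iff, hammingWeight_eq_sum, Nat.cast_sum]
    simp [funext_iff, Matrix.mulVec, dotProduct]
  have h2 : ∑ i, s.toNat * (x i).toNat ^ 2 = s.toNat * hammingWeight x := by
    rw [hammingWeight_eq_sum, Finset.mul_sum]
    exact Finset.sum_congr rfl fun i _ => by cases x i <;> simp
  rw [h, h2]
  simp only [h1]
  by_cases hx : hammingWeight x % 2 = ε % 2 <;> simp [hx]

/-- On the support `x₀ = x₁`, the square term and the cross term together realize every fourth root
of unity as the ratio of the two values. -/
theorem isAffine_binary {f : Sig 2} (c : ℂ) (s t : Bool)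
    (h : ∀ p q, f ![p, q] = if p = q then c * Complex.I ^ ((s.toNat + 2 * t.toNat) * p.toNat)
      else 0) : IsAffine f := by
  refine ⟨c, 1, fun _ _ => 1, fun _ => 0, ![s, false], fun _ _ => t, fun x => ?_⟩
  rw [eq_vec_two x, h]
  have h1 : ∀ p q : Bool, (Matrix.mulVec (fun (_ : Fin 1) (_ : Fin 2) => (1 : ZMod 2))
      (fun i => (((![p, q] : Fin 2 → Bool) i).toNat : ZMod 2)) = fun _ => 0) ↔ p = q := by
    decide
  have h2 : Finset.univ.filter (fun j : Fin 2 => 0 < j) = {1} := by decide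
  have h3 : Finset.univ.filter (fun j : Fin 2 => 1 < j) = ∅ := by decide
  simp only [h1]
  generalize x 0 = p, x 1 = q
  rw [Fin.sum_univ_two, Fin.sum_univ_two, h2, h3]
  cases p <;> cases q <;> simp [mul_comm]

/-! ### Symmetric matchgate signatures -/

section Classification

variable {k : ℕ} {f : Sig k}

theorem IsSymmetric.isAffine_of_weightValue (hsym : IsSymmetric f)
    (h : ∀ i ≤ k, i ≠ k → weightValue f i = 0) : IsAffine f := by
  refine isAffine_of_support (fun _ => true) fun x hx => ?_
  rw [hsym.eq_weightValue]
  refine h _ (Nat.lt_succ_iff.1 (hammingWeight_lt x)) fun e => hx ?_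
  have : Finset.univ.filter (fun i => x i = true) = Finset.univ :=
    Finset.eq_univ_of_card _ (by rw [Fintype.card_fin]; exact e)
  funext i
  simpa using this.ge (Finset.mem_univ i)

theorem IsSymmetric.isAffine_of_weightValue_zero (hsym : IsSymmetric f)
    (h : ∀ i ≤ k, i ≠ 0 → weightValue f i = 0) : IsAffine f := by
  refine isAffine_of_support (fun _ => false) fun x hx => ?_
  rw [hsym.eq_weightValue]
  refine h _ (Nat.lt_succ_iff.1 (hammingWeight_lt x)) fun e => hx ?_
  rw [hammingWeight, Finset.card_eq_zero] at e
  funext i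
  have := Finset.eq_empty_iff_forall_notMem.1 e i
  simpa using this

/-- Values in geometric progression on the weights of one parity. -/
theorem IsMatchgateSignature.weightValue_eq (hM : IsMatchgateSignature f) (hsym : IsSymmetric f)
    {e : ℕ} (h : weightValue f e ≠ 0) (p : ℕ) (hp : e + 2 * p ≤ k) :
    weightValue f (e + 2 * p) =
      weightValue f e * (weightValue f (e + 2) / weightValue f e) ^ p := by
  induction p with
  | zero => simp
  | succ p ih =>
    -- This instance relates `f_e f_{e+2p+2}` to `f_{e+2} f_{e+2p}`, the recursion of a geometric
    -- progression.
    have h1 := hM.mul_eq_mul hsym (i := e) (l := p) (by omega)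
    rw [ih (by omega)] at h1
    refine mul_left_cancel₀ h (h1.trans ?_)
    rw [pow_succ]
    field_simp

/-- If the first value of a parity vanishes, so do all but the last. -/
theorem IsMatchgateSignature.weightValue_eq_zero (hM : IsMatchgateSignature f)
    (hsym : IsSymmetric f) {e : ℕ} (h : weightValue f e = 0) (p : ℕ) (hp : e + 2 * p + 2 ≤ k) :
    weightValue f (e + 2 * p) = 0 := by
  induction p with
  | zero => exact h
  | succ p ih =>
    -- With `l = 1` the identity has a square on the right, which needs a further weight two steps
    -- up. This is why the last weight of the parity class escapes.
    have h1 := hM.mul_eq_mul hsym (i := e + 2 * p) (l := 1) (by omega)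
    rw [ih (by omega), zero_mul] at h1
    exact mul_self_eq_zero.1 h1.symm

theorem IsSymmetric.isAffine_of_geometric (hsym : IsSymmetric f) {e : ℕ} (he : e < 2)
    (hpar : ∀ i ≤ k, i % 2 ≠ e → weightValue f i = 0) {r : ℂ} (hr : r ^ 2 = 1) (c : ℂ)
    (hgeo : ∀ p, e + 2 * p ≤ k → weightValue f (e + 2 * p) = c * r ^ p) : IsAffine f := by
  have hw : ∀ x : Fin k → Bool, hammingWeight x ≤ k := fun x =>
    Nat.lt_succ_iff.1 (hammingWeight_lt x)
  rcases sq_eq_one_iff.1 hr with rfl | rfl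
  · refine isAffine_of_parity e c false fun x => ?_
    rw [hsym.eq_weightValue, Nat.mod_eq_of_lt he]
    split_ifs with h
    · have := hgeo (hammingWeight x / 2) (by have := hw x; omega)
      rw [show e + 2 * (hammingWeight x / 2) = hammingWeight x by omega] at this
      simp [this]
    · exact hpar _ (hw x) h
  -- At weight `e + 2 * p` one has `(-1)^p = I^(weight - e)`, and `I^(3 * e)` stands for `I^(-e)`.
  · refine isAffine_of_parity e (c * Complex.I ^ (3 * e)) true fun x => ?_
    rw [hsym.eq_weightValue, Nat.mod_eq_of_lt he]
    split_ifs with h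
    · have := hgeo (hammingWeight x / 2) (by have := hw x; omega)
      rw [show e + 2 * (hammingWeight x / 2) = hammingWeight x by omega] at this
      rw [this, ← Complex.I_sq, ← pow_mul, mul_assoc, ← pow_add, Bool.toNat_true, one_mul,
        show 3 * e + hammingWeight x = 2 * (hammingWeight x / 2) + 4 * e by omega, pow_add,
        pow_mul _ 4, Complex.I_pow_four, one_pow, mul_one]
    · exact hpar _ (hw x) h

/-! ### Simulation according to the parity of the support -/

theorem IsSymmetric.constructible (hsym : IsSymmetric f) (hk : 0 < k) :
    Constructible ![(⟨k, f⟩ : Signature)] evenSigs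
      fun _ => (weightSig (weightValue f) : Sig k) := by
  have h := Constructible.vertex (L := ![(⟨k, f⟩ : Signature)]) (R := evenSigs) 0 hk
  exact h.congr fun _ => hsym.eq_weightValue

/-- The case of binary signatures of even parity. -/
theorem IsSymmetric.simulates_of_binary {f : Sig 2} (hsym : IsSymmetric f) (hA : ¬ IsAffine f)
    (h0 : weightValue f 0 ≠ 0) (h1 : weightValue f 1 = 0) :
    PlanarLeftSimulates ![(⟨2, f⟩ : Signature)] evenSigs (symSig ![0, 0, 1, 0] : Sig 3) := by
  have h2 : weightValue f 2 ≠ 0 := fun h2 =>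
    hA (hsym.isAffine_of_weightValue_zero fun i hi hi0 => by
      interval_cases i
      exacts [absurd rfl hi0, h1, h2])
  refine ((hsym.constructible two_pos).triangle fun _ => h1).simulates_of_even ?_ ?_ ?_ ?_ ?_
  · simpa using h0
  · simp
  · simpa using ⟨h0, h2⟩
  · simp
  -- The `triangle` squares the ratio of the two values. If the square of the new ratio were 1, the
  -- old ratio would be a fourth root of unity and `f` affine.
  · intro h
    simp only [OfNat.ofNat_ne_zero, if_false, if_true] at h
    have h4 : (weightValue f 2 / weightValue f 0) ^ 4 = 1 := by
      rw [div_pow, div_eq_one_iff_eq (pow_ne_zero 4 h0)]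
      refine mul_left_cancel₀ (pow_ne_zero 2 h0) ?_
      linear_combination h
    obtain ⟨s, t, hst⟩ : ∃ s t : Bool,
        weightValue f 2 / weightValue f 0 = Complex.I ^ (s.toNat + 2 * t.toNat) := by
      have : (weightValue f 2 / weightValue f 0 - 1) * (weightValue f 2 / weightValue f 0 + 1) *
          (weightValue f 2 / weightValue f 0 - Complex.I) *
          (weightValue f 2 / weightValue f 0 + Complex.I) = 0 := by
        linear_combination h4 - ((weightValue f 2 / weightValue f 0) ^ 2 - 1) * Complex.I_sq
      rcases mul_eq_zero.1 this with this | this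
      · rcases mul_eq_zero.1 this with this | this
        · rcases mul_eq_zero.1 this with this | this
          · exact ⟨false, false, by simpa using sub_eq_zero.1 this⟩
          · exact ⟨false, true, by simpa using eq_neg_of_add_eq_zero_left this⟩
        · exact ⟨true, false, by simpa using sub_eq_zero.1 this⟩
      · refine ⟨true, true, (eq_neg_of_add_eq_zero_left this).trans ?_⟩
        rw [Bool.toNat_true, pow_add, mul_one, Complex.I_sq, pow_one]
        ring
    rw [div_eq_iff h0] at hst
    refine hA (isAffine_binary (weightValue f 0) s t fun p q => ?_)
    rw [hsym.eq_weightValue]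
    cases p <;> cases q
    · change weightValue f 0 = _
      simp
    · exact h1
    · exact h1
    · change weightValue f 2 = _
      rw [hst, if_pos rfl, Bool.toNat_true, mul_one, mul_comm]

/-- The case of even parity. -/
theorem IsMatchgateSignature.simulates_of_even (hM : IsMatchgateSignature f) (hA : ¬ IsAffine f)
    (hsym : IsSymmetric f) (hpar : ∀ i ≤ k, i % 2 ≠ 0 → weightValue f i = 0) :
    PlanarLeftSimulates ![(⟨k, f⟩ : Signature)] evenSigs (symSig ![0, 0, 1, 0] : Sig 3) := by
  by_cases h0 : weightValue f 0 = 0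
  · have hz : ∀ i, i + 2 ≤ k → weightValue f i = 0 := fun i hi => by
      by_cases he : i % 2 = 0
      · have := hM.weightValue_eq_zero hsym h0 (i / 2) (by omega)
        rwa [show 0 + 2 * (i / 2) = i by omega] at this
      · exact hpar i (by omega) he
    -- Only the largest even weight can carry a nonzero value. For even `k` it is `k`, and `f` is
    -- affine; for odd `k` it is `k - 1`, and loops reduce `f` to a multiple of [0,0,1,0].
    rcases Nat.even_or_odd' k with ⟨j, hk | hk⟩
    · refine absurd (hsym.isAffine_of_weightValue fun i hi hik => ?_) hA
      by_cases hi2 : i + 2 ≤ k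
      · exact hz i hi2
      · exact hpar i hi (by omega)
    · have hlast : weightValue f (k - 1) ≠ 0 := fun hl =>
        hA (hsym.isAffine_of_weightValue fun i hi hik => by
          by_cases hi2 : i + 2 ≤ k
          · exact hz i hi2
          · rwa [show i = k - 1 by omega])
      obtain ⟨j, rfl⟩ : ∃ j', j = j' + 1 := by
        refine ⟨j - 1, ?_⟩
        rcases j with _ | j
        · exact absurd (by simpa [hk] using h0) hlast
        · omega
      obtain rfl : k = 3 + 2 * j := by omega
      obtain ⟨c, hc, hv⟩ := Constructible.loop_concentrated three_pos (p := 2) (by norm_num) j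
        (hsym.constructible (by omega)) fun i hi => by
          constructor
          · intro hi0
            by_contra hne
            by_cases hi2 : i + 2 ≤ 3 + 2 * j
            · exact hi0 (hz i hi2)
            · exact hi0 (hpar i hi (by omega))
          · rintro rfl
            rwa [show 2 + 2 * j = 3 + 2 * j - 1 by omega]
      refine Or.inl (hc.planarLeftRealizes ?_ ?_ ((hv 2 (by norm_num)).2 rfl) ?_)
      all_goals
        by_contra h
        exact absurd ((hv _ (by norm_num)).1 h) (by norm_num)
  · by_cases hk : 3 ≤ k
    · have hgeo := hM.weightValue_eq hsym h0
      have h2 : weightValue f 2 ≠ 0 := fun h2 =>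
        hA (hsym.isAffine_of_weightValue_zero fun i hi hi0 => by
          by_cases he : i % 2 = 0
          · have := hgeo (i / 2) (by omega)
            rw [show 0 + 2 * (i / 2) = i by omega, zero_add, h2, zero_div,
              zero_pow (by omega), mul_zero] at this
            exact this
          · exact hpar i hi he)
      refine ((hsym.constructible (by omega)).pin_le three_pos hk).simulates_of_even h0
        (hpar 1 (by omega) (by norm_num)) h2 (hpar 3 hk (by norm_num)) fun hsq => ?_
      refine hA (hsym.isAffine_of_geometric two_pos hpar (r := weightValue f 2 / weightValue f 0)
        ?_ _ hgeo)
      rw [div_pow, hsq, div_self (pow_ne_zero 2 h0)]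
    · obtain rfl | hk : k = 2 ∨ k < 2 := by omega
      · exact hsym.simulates_of_binary hA h0 (hpar 1 (by norm_num) (by norm_num))
      · exact absurd (hsym.isAffine_of_weightValue_zero fun i hi hi0 =>
          hpar i hi (by omega)) hA

/-- The case of odd parity. -/
theorem IsMatchgateSignature.simulates_of_odd (hM : IsMatchgateSignature f) (hA : ¬ IsAffine f)
    (hsym : IsSymmetric f) (hpar : ∀ i ≤ k, i % 2 ≠ 1 → weightValue f i = 0) :
    PlanarLeftSimulates ![(⟨k, f⟩ : Signature)] evenSigs (symSig ![0, 0, 1, 0] : Sig 3) := by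
  have h0 : weightValue f 0 = 0 := hpar 0 (Nat.zero_le k) (by norm_num)
  have hk : 3 ≤ k := by
    by_contra hk
    -- Below arity 3 weight 1 is the only odd weight, so any ratio of square 1 serves.
    refine hA (hsym.isAffine_of_geometric one_lt_two hpar (one_pow 2) (weightValue f 1)
      fun p hp => ?_)
    obtain rfl : p = 0 := by omega
    simp
  by_cases h1 : weightValue f 1 = 0
  · have hz : ∀ i, i + 2 ≤ k → weightValue f i = 0 := fun i hi => by
      by_cases he : i % 2 = 1
      · have := hM.weightValue_eq_zero hsym h1 (i / 2) (by omega)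
        rwa [show 1 + 2 * (i / 2) = i by omega] at this
      · exact hpar i (by omega) he
    rcases Nat.even_or_odd' k with ⟨j, hj | hj⟩
    · have hlast : weightValue f (k - 1) ≠ 0 := fun hl =>
        hA (hsym.isAffine_of_weightValue fun i hi hik => by
          by_cases hi2 : i + 2 ≤ k
          · exact hz i hi2
          · rwa [show i = k - 1 by omega])
      obtain ⟨j, rfl⟩ : ∃ j', j = j' + 2 := ⟨j - 2, by omega⟩
      obtain rfl : k = 4 + 2 * j := by omega
      obtain ⟨c, hc, hv⟩ := Constructible.loop_concentrated four_pos (p := 3) (by norm_num) j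
        (hsym.constructible (by omega)) fun i hi => by
          constructor
          · intro hi0
            by_contra hne
            by_cases hi2 : i + 2 ≤ 4 + 2 * j
            · exact hi0 (hz i hi2)
            · exact hi0 (hpar i hi (by omega))
          · rintro rfl
            rwa [show 3 + 2 * j = 4 + 2 * j - 1 by omega]
      have hc0 : ∀ i ≤ 4, i ≠ 3 → c i = 0 := fun i hi hi3 => by
        by_contra h
        exact hi3 ((hv i hi).1 h)
      have hc3 : c 3 ≠ 0 := (hv 3 (by norm_num)).2 rfl
      -- From a multiple of [0,0,0,1,0], pinning and a loop produce a multiple of the unary [0,1].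
      -- Attached to the quaternary gadget, it fixes one input to one and leaves a multiple of
      -- [0,0,1,0].
      have hu := (hc.pin_weightSig three_pos).loop_weightSig (m := 1) one_pos
      refine Or.inl ((hc.join_unary hu).planarLeftRealizes ?_ ?_ ?_ ?_)
      all_goals norm_num [hc0, hc3]
    · refine absurd (hsym.isAffine_of_weightValue fun i hi hik => ?_) hA
      by_cases hi2 : i + 2 ≤ k
      · exact hz i hi2
      · exact hpar i hi (by omega)
  · have hgeo := hM.weightValue_eq hsym h1
    have h2 : weightValue f 2 = 0 := hpar 2 (by omega) (by norm_num)
    have hc := (hsym.constructible (by omega)).pin_le three_pos hk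
    -- Pinned to arity 2, `f` is a multiple of the disequality [0,1,0]. Put on all three edges of
    -- [0,f₁,0,f₃], it reverses the weights and gives a multiple of [f₃,0,f₁,0], which has even
    -- parity.
    have hflip := hc.join_flip (hc.pin_weightSig two_pos) (fun _ => h0) fun _ => h2
    have h13 := pow_ne_zero 3 h1
    by_cases h3 : weightValue f 3 = 0
    · refine Or.inl (hflip.planarLeftRealizes ?_ ?_ ?_ ?_)
      · simp [h3]
      · simp [h2]
      · simpa using h1
      · simp [h0]
    · refine hflip.simulates_of_even (mul_ne_zero h3 h13) ?_ (mul_ne_zero h1 h13) ?_ fun hsq => ?_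
      · simp [h2]
      · simp [h0]
      · refine hA (hsym.isAffine_of_geometric one_lt_two hpar
          (r := weightValue f 3 / weightValue f 1) ?_ _ hgeo)
        rw [mul_pow, mul_pow] at hsq
        have : weightValue f 1 ^ 2 = weightValue f 3 ^ 2 :=
          mul_right_cancel₀ (pow_ne_zero 2 h13) hsq
        rw [div_pow, ← this, div_self (pow_ne_zero 2 h1)]

end Classification

end Holant

end

theorem mainTheorem8 (k : ℕ) (f : Holant.Sig k) (hM : Holant.IsMatchgateSignature f)
    (hA : ¬ Holant.IsAffine f) (hsym : Holant.IsSymmetric f) :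
    Holant.PlanarLeftSimulates
      ![(⟨k, f⟩ : Holant.Signature)]
      ![(⟨1, Holant.symSig ![1, 0]⟩ : Holant.Signature),
        ⟨2, Holant.symSig ![1, 0, 1]⟩,
        ⟨3, Holant.symSig ![1, 0, 1, 0]⟩]
      (Holant.symSig ![0, 0, 1, 0] : Holant.Sig 3) := by
  -- A single nonzero value at an odd weight forces odd parity throughout; without one the support
  -- is even, possibly empty.
  by_cases h : ∃ i ≤ k, i % 2 = 1 ∧ Holant.weightValue f i ≠ 0
  · obtain ⟨i, hi, hi1, hne⟩ := h
    refine hM.simulates_of_odd hA hsym fun j hj hj1 => ?_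
    by_contra h0
    exact hj1 ((hM.parity hj hi h0 hne).trans hi1)
  · refine hM.simulates_of_even hA hsym fun j hj hj0 => ?_
    by_contra h0
    exact h ⟨j, hj, by omega, h0⟩
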